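/- **Setting.** A structured descriptor system with $n$ states, $F\dot{\mathbf x}=A\mathbf x$, is given by $F=Q_F+T_F$, $A=Q_A+T_A$, where $Q_F,Q_A\in\mathbb R^{n\times n}$ are fixed and each of $T_F,T_A$ has a prescribed set of entries that are free real parameters, all its other entries being $0$. Let $V=\{1,\dots,n\}$. *First matroid.* For $S\subseteq V$ let $T_B(S)$ be the diagonal matrix with a free parameter in entry $(i,i)$ for $i\in S$ and zeros elsewhere. Let $\mathcal M([I|Q_A|0])$ be the linear matroid on the $3n$ columns of $[I|Q_A|0]$, let $\mathcal M([I|T_A|T_B(S)])$ be the generic linear matroid on the columns of $[I|T_A|T_B(S)]$ (a set of columns is independent if it is linearly independent for some values of the free parameters), and let $\vee$ denote matroid union. $\mathcal M_1$ is the matroid on $V$ with rank function $$\rho_1(S)=\operatorname{rank}\bigl(\mathcal M([I|Q_A|0])\vee\mathcal M([I|T_A|T_B(S)])\bigr)-\operatorname{rank}\bigl(\mathcal M([I|Q_A|0])\vee\mathcal M([I|T_A|T_B(\emptyset)])\bigr).$$ *Second matroid.* Let $\Omega=\begin{pmatrix}Q_A-Q_F\\ I\end{pmatrix}$, with rows indexed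 $w_1,\dots,w_n,x_1,\dots,x_n$. An *admissible matching* is an injective map $m$ from $\{w_1^T,\dots,w_n^T\}$ to $\{w_1^Q,\dots,w_n^Q,x_1^Q,\dots,x_n^Q\}$ such that, for each $i$, either $m(w_i^T)=w_i^Q$, or $m(w_i^T)=x_j^Q$ where entry $(i,j)$ of $T_A$ or of $T_F$ is free, and such that the rows of $\Omega$ indexed by $J=\{v: v^Q=m(w_i^T)\text{ for some }i\}$ are linearly independent. Put $\tilde\Omega=\Omega\,\Omega_J^{-1}$, with columns indexed by $J$. The graph $G'$ on $\{w_i^T,w_i^Q,x_i^T,x_i^Q: i\in V\}$ has the following directed edges: for every $(i,j)$ that is free in $T_A$ or $T_F$, the edge $(w_i^T,x_j^Q)$ if $m(w_i^T)\ne x_j^Q$ and $(x_j^Q,w_i^T)$ if $m(w_i^T)=x_j^Q$; for every $i$, the edge $(w_i^T,w_i^Q)$ if $m(w_i^T)\ne w_i^Q$ and $(w_i^Q,w_i^T)$ if $m(w_i^T)=w_i^Q$; and $(v^Q,y^Q)$ for all $v\notin J$, $y\in J$ with $\tilde\Omega_{vy}\neq0$. Call a strongly connected component of $G'$ *isolated*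 if no edge leaves it for another component. $\mathcal M_2$ is the matroid on $V$ whose rank function $\rho_2(S)$ is the number of isolated components that meet $\{w_i^T:i\in S\}$. *Problem.* Given $k\in\mathbb N$ and $f:2^V\to\mathbb R$, the joint performance–controllability input selection problem is $$\text{maximize } f(S)\quad\text{over } S\subseteq V\quad\text{s.t. } |S|\le k,\quad V\setminus S\in\mathcal M_1^*,\quad V\setminus S\in\mathcal M_2^*,\qquad(\ast)$$ where $\mathcal M_i^*$ is the dual matroid, and membership means independence. *Time* is the number of steps of a single program, independent of $n$ and of the data, in the unit-cost model over the reals: arithmetic operations and comparisons on real numbers and elementary memory operations cost one step each, and the only real constant is $1$. **Theorem.** (a) In time polynomial in $n$ one can compute from $Q_F$, $Q_A$ and the free positions of $T_F$, $T_A$ an admissible matching, or report correctly that none exists. (b) If $f(S)=\sum_{i\in S}\tau_i$ for real weights $\tau_1,\dots,\tau_n$ (of any sign), then in time polynomial in $n$ one can compute from the system, an arbitrary admissible matching $m$, $k$ and $\tau$ an optimal solution of $(\ast)$, or report correctly that $(\ast)$ is infeasible. The same holds if "isolated" is defined by "no edge enters the component from another component". -/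

import Mathlib

/-! ### Independence systems on a finite ground set -/

namespace IndepSystem

/-- The linear matroid of a real matrix: a set of columns is independent if the columns (as an
indexed family) are linearly independent. -/
def linearIndep {m E : Type*} (M : Matrix m E ℝ) (X : Finset E) : Prop :=
  LinearIndepOn ℝ M.col (X : Set E)

/-- Independent sets of the union `I₁ ∨ I₂`. -/
def unionIndep {E : Type*} [DecidableEq E] (I₁ I₂ : Finset E → Prop) (X : Finset E) : Prop :=
  ∃ X₁ X₂, I₁ X₁ ∧ I₂ X₂ ∧ X = X₁ ∪ X₂

open Classical in
/-- The rank: the largest size of an independent set. -/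
noncomputable def rank {E : Type*} [Fintype E] (I : Finset E → Prop) : ℕ :=
  (Finset.univ.filter I).sup Finset.card

/-- Independent sets of the matroid induced by a rank function. -/
def ofRank {V : Type*} (ρ : Finset V → ℕ) (X : Finset V) : Prop :=
  ρ X = X.card

/-- Bases are the maximal independent sets. -/
def IsBasis {V : Type*} (I : Finset V → Prop) (B : Finset V) : Prop :=
  I B ∧ ∀ C, I C → B ⊆ C → C = B

/-- Independent sets of the dual: the subsets of complements of bases. -/
def dualIndep {V : Type*} [Fintype V] [DecidableEq V] (I : Finset V → Prop) (R : Finset V) :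
    Prop :=
  ∃ B, IsBasis I B ∧ R ⊆ Bᶜ

end IndepSystem

/-! ### Structured linear descriptor systems -/

/-- A structured descriptor system `F ẋ = A x` with `n` states, `F = Q_F + T_F`,
`A = Q_A + T_A`. The matrices `QF`, `QA` are fixed; `TF i j = true` (resp. `TA i j = true`) says
that the `(i, j)` entry of `T_F` (resp. `T_A`) is a free real parameter, all other entries of
`T_F`, `T_A` being zero. -/
structure DescriptorSystem (n : ℕ) where
  QF : Matrix (Fin n) (Fin n) ℝ
  QA : Matrix (Fin n) (Fin n) ℝ
  TF : Matrix (Fin n) (Fin n) Bool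
  TA : Matrix (Fin n) (Fin n) Bool

/-- The vertices `w_i^T, w_i^Q, x_i^T, x_i^Q` of the auxiliary graph. -/
inductive AuxNode (n : ℕ) where
  | wT (i : Fin n)
  | wQ (i : Fin n)
  | xT (i : Fin n)
  | xQ (i : Fin n)

/-- Which strongly connected components count as isolated in the condensation of the auxiliary
graph: those that no edge leaves (so that hitting all of them makes every vertex reach a hit
component), or those that no edge enters. -/
inductive IsolationRule where
  | noOutgoing
  | noIncoming

namespace DescriptorSystem

open IndepSystem

variable {n : ℕ}

/-- Independent sets of `M([I | Q_A | 0])`. -/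
def fixedIndep (sys : DescriptorSystem n) : Finset (Fin n ⊕ (Fin n ⊕ Fin n)) → Prop :=
  linearIndep (Matrix.fromCols (1 : Matrix (Fin n) (Fin n) ℝ)
    (Matrix.fromCols sys.QA (0 : Matrix (Fin n) (Fin n) ℝ)))

/-- Independent sets of `M([I | T_A | T_B(S)])`, the generic linear matroid: a set of columns is
independent if it is linearly independent for some values of the free parameters. Here `T_B(S)` is
diagonal with a free parameter in the `i`-th entry for `i ∈ S`. -/
def freeIndep (sys : DescriptorSystem n) (S : Finset (Fin n))
    (X : Finset (Fin n ⊕ (Fin n ⊕ Fin n))) : Prop :=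
  ∃ (T : Matrix (Fin n) (Fin n) ℝ) (d : Fin n → ℝ),
    (∀ i j, T i j ≠ 0 → sys.TA i j = true) ∧ (∀ i, d i ≠ 0 → i ∈ S) ∧
    linearIndep (Matrix.fromCols (1 : Matrix (Fin n) (Fin n) ℝ)
      (Matrix.fromCols T (Matrix.diagonal d))) X

/-- `rank (M([I | Q_A | 0]) ∨ M([I | T_A | T_B(S)]))`. -/
noncomputable def mixedRank (sys : DescriptorSystem n) (S : Finset (Fin n)) : ℕ :=
  rank (unionIndep sys.fixedIndep (sys.freeIndep S))

/-- The rank function `ρ₁` of the matroid `M₁` (note `T_B(∅) = 0`, and `mixedRank` is monotone). -/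
noncomputable def rho1 (sys : DescriptorSystem n) (S : Finset (Fin n)) : ℕ :=
  sys.mixedRank S - sys.mixedRank ∅

/-- The matrix `Ω` without inputs; its rows are indexed by `w_1, …, w_n` (left summand) and
`x_1, …, x_n` (right summand). -/
def Omega (sys : DescriptorSystem n) : Matrix (Fin n ⊕ Fin n) (Fin n) ℝ :=
  Matrix.fromRows (sys.QA - sys.QF) 1

/-- Edges of the bipartite graph `H` between `w_i^T` and the vertices `w_j^Q` (`inl j`) and
`x_j^Q` (`inr j`). -/
def HEdge (sys : DescriptorSystem n) (i : Fin n) : Fin n ⊕ Fin n → Prop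
  | Sum.inl j => j = i
  | Sum.inr j => sys.TA i j = true ∨ sys.TF i j = true

/-- The square matrix `Ω_J`, `J = {m(w_1^T), …, m(w_n^T)}`, its `i`-th row being the row of `Ω`
indexed by `m(w_i^T)`. -/
def OmegaJ (sys : DescriptorSystem n) (m : Fin n → Fin n ⊕ Fin n) : Matrix (Fin n) (Fin n) ℝ :=
  sys.Omega.submatrix m id

/-- `m` is a matching of `H` that covers all `w_i^T` and whose set `J` of matched partners indexes
linearly independent rows of `Ω`. -/
structure IsAdmissible (sys : DescriptorSystem n) (m : Fin n → Fin n ⊕ Fin n) : Prop where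
  edge : ∀ i, sys.HEdge i (m i)
  injective : Function.Injective m
  linearIndependent : LinearIndependent ℝ (sys.OmegaJ m).row

/-- `Ω̃ = Ω Ω_J⁻¹`; its `i`-th column is the one indexed by `m(w_i^T) ∈ J`. -/
noncomputable def OmegaTilde (sys : DescriptorSystem n) (m : Fin n → Fin n ⊕ Fin n) :
    Matrix (Fin n ⊕ Fin n) (Fin n) ℝ :=
  sys.Omega * (sys.OmegaJ m)⁻¹

/-- The vertex `v^Q` of a row index `v` of `Ω`. -/
def qNode : Fin n ⊕ Fin n → AuxNode n
  | Sum.inl i => AuxNode.wQ i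
  | Sum.inr j => AuxNode.xQ j

/-- Edges of the auxiliary graph `G'`, that is, the auxiliary graph for the empty input set. -/
inductive AuxEdge (sys : DescriptorSystem n) (m : Fin n → Fin n ⊕ Fin n) :
    AuxNode n → AuxNode n → Prop where
  | free (i j : Fin n) (h : sys.TA i j = true ∨ sys.TF i j = true) (hm : m i ≠ Sum.inr j) :
      AuxEdge sys m (AuxNode.wT i) (AuxNode.xQ j)
  | freeMatched (i j : Fin n) (h : sys.TA i j = true ∨ sys.TF i j = true)
      (hm : m i = Sum.inr j) : AuxEdge sys m (AuxNode.xQ j) (AuxNode.wT i)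
  | own (i : Fin n) (hm : m i ≠ Sum.inl i) : AuxEdge sys m (AuxNode.wT i) (AuxNode.wQ i)
  | ownMatched (i : Fin n) (hm : m i = Sum.inl i) : AuxEdge sys m (AuxNode.wQ i) (AuxNode.wT i)
  | fixed (v : Fin n ⊕ Fin n) (i : Fin n) (hv : v ∉ Set.range m)
      (h : sys.OmegaTilde m v i ≠ 0) : AuxEdge sys m (qNode v) (qNode (m i))

/-- The strongly connected component `[v]` of a vertex `v` of `G'`. -/
def component (sys : DescriptorSystem n) (m : Fin n → Fin n ⊕ Fin n) (v : AuxNode n) :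
    Set (AuxNode n) :=
  {u | Relation.ReflTransGen (sys.AuxEdge m) v u ∧ Relation.ReflTransGen (sys.AuxEdge m) u v}

/-- `C` is a strongly connected component of `G'` that is isolated in the condensation. -/
def IsIsolated (sys : DescriptorSystem n) (m : Fin n → Fin n ⊕ Fin n) (rule : IsolationRule)
    (C : Set (AuxNode n)) : Prop :=
  (∃ v, C = sys.component m v) ∧
    match rule with
    | IsolationRule.noOutgoing => ∀ u v, u ∈ C → sys.AuxEdge m u v → v ∈ C
    | IsolationRule.noIncoming => ∀ u v, v ∈ C → sys.AuxEdge m u v → u ∈ C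

/-- The rank function `ρ₂` of the matroid `M₂`: the number of isolated components that meet
`{w_i^T : i ∈ S}`. -/
noncomputable def rho2 (sys : DescriptorSystem n) (m : Fin n → Fin n ⊕ Fin n)
    (rule : IsolationRule) (S : Finset (Fin n)) : ℕ :=
  Set.ncard {C | sys.IsIsolated m rule C ∧ ∃ i ∈ S, AuxNode.wT i ∈ C}

/-- The constraints `|S| ≤ k`, `V ∖ S ∈ M₁*`, `V ∖ S ∈ M₂*`. -/
def IsFeasible (sys : DescriptorSystem n) (m : Fin n → Fin n ⊕ Fin n) (rule : IsolationRule)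
    (k : ℕ) (S : Finset (Fin n)) : Prop :=
  S.card ≤ k ∧ dualIndep (ofRank sys.rho1) Sᶜ ∧ dualIndep (ofRank (sys.rho2 m rule)) Sᶜ

/-- `S` solves the joint performance and controllability input selection problem: maximize `f(S)`
over all feasible `S`. -/
def IsSolution (sys : DescriptorSystem n) (m : Fin n → Fin n ⊕ Fin n) (rule : IsolationRule)
    (k : ℕ) (f : Finset (Fin n) → ℝ) (S : Finset (Fin n)) : Prop :=
  sys.IsFeasible m rule k S ∧ ∀ S', sys.IsFeasible m rule k S' → f S' ≤ f S

end DescriptorSystem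

/-! ### The machine model

WHILE programs with finitely many variables that hold binary trees whose leaves are `nil` or real
numbers. Construction and inspection of a tree cell, arithmetic on reals and comparison of reals
cost one step each; there are no real constants except `1`. No operation looks at more
than the root cells of its operands, so (trees being stored by reference) this is, up to a constant
factor, the unit-cost real random access machine. -/

namespace RealWhile

inductive Val where
  | nil
  | num (r : ℝ)
  | cons (a b : Val)

namespace Val

def hd : Val → Val
  | cons a _ => a
  | _ => nil

def tl : Val → Val
  | cons _ b => b
  | _ => nil

/-- `nil` is false, everything else is true. -/
def IsTrue (v : Val) : Prop := v ≠ nil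

def ofBool : Bool → Val
  | true => cons nil nil
  | false => nil

def isNum : Val → Val
  | num _ => ofBool true
  | _ => ofBool false

def isCons : Val → Val
  | cons _ _ => ofBool true
  | _ => ofBool false

/-- A binary operation on reals; on other operands the result is `nil`. -/
def arith (op : ℝ → ℝ → ℝ) : Val → Val → Val
  | num a, num b => num (op a b)
  | _, _ => nil

open Classical in
noncomputable def leq : Val → Val → Val
  | num a, num b => ofBool (decide (a ≤ b))
  | _, _ => nil

end Val

inductive Expr where
  | var (x : ℕ)
  | nil
  | one
  | cons (a b : Expr)
  | hd (a : Expr)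
  | tl (a : Expr)
  | isNum (a : Expr)
  | isCons (a : Expr)
  | add (a b : Expr)
  | sub (a b : Expr)
  | mul (a b : Expr)
  | div (a b : Expr)
  | leq (a b : Expr)

/-- The contents of the variables. -/
abbrev Store := ℕ → Val

namespace Expr

noncomputable def eval (σ : Store) : Expr → Val
  | var x => σ x
  | nil => Val.nil
  | one => Val.num 1
  | cons a b => Val.cons (a.eval σ) (b.eval σ)
  | hd a => (a.eval σ).hd
  | tl a => (a.eval σ).tl
  | isNum a => (a.eval σ).isNum
  | isCons a => (a.eval σ).isCons
  | add a b => Val.arith (fun x y => x + y) (a.eval σ) (b.eval σ)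
  | sub a b => Val.arith (fun x y => x - y) (a.eval σ) (b.eval σ)
  | mul a b => Val.arith (fun x y => x * y) (a.eval σ) (b.eval σ)
  | div a b => Val.arith (fun x y => x / y) (a.eval σ) (b.eval σ)
  | leq a b => Val.leq (a.eval σ) (b.eval σ)

/-- The number of steps an evaluation takes: one per operation. -/
def cost : Expr → ℕ
  | var _ => 1
  | nil => 1
  | one => 1
  | cons a b => a.cost + b.cost + 1
  | hd a => a.cost + 1
  | tl a => a.cost + 1
  | isNum a => a.cost + 1
  | isCons a => a.cost + 1
  | add a b => a.cost + b.cost + 1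
  | sub a b => a.cost + b.cost + 1
  | mul a b => a.cost + b.cost + 1
  | div a b => a.cost + b.cost + 1
  | leq a b => a.cost + b.cost + 1

end Expr

inductive Cmd where
  | skip
  | assign (x : ℕ) (e : Expr)
  | seq (c d : Cmd)
  | cond (e : Expr) (c d : Cmd)
  | loop (e : Expr) (c : Cmd)

/-- `Exec c σ t σ'`: started in the store `σ`, the program `c` halts after exactly `t` steps in the
store `σ'`. The command `loop e c` is `while e do c`. -/
inductive Exec : Cmd → Store → ℕ → Store → Prop where
  | skip (σ : Store) : Exec Cmd.skip σ 1 σ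
  | assign (x : ℕ) (e : Expr) (σ : Store) :
      Exec (Cmd.assign x e) σ (e.cost + 1) (Function.update σ x (e.eval σ))
  | seq {c d : Cmd} {σ σ' σ'' : Store} {s t : ℕ} (hc : Exec c σ s σ') (hd : Exec d σ' t σ'') :
      Exec (Cmd.seq c d) σ (s + t) σ''
  | condTrue {e : Expr} {c : Cmd} (d : Cmd) {σ σ' : Store} {t : ℕ} (he : (e.eval σ).IsTrue)
      (hc : Exec c σ t σ') : Exec (Cmd.cond e c d) σ (e.cost + 1 + t) σ'
  | condFalse {e : Expr} (c : Cmd) {d : Cmd} {σ σ' : Store} {t : ℕ} (he : ¬ (e.eval σ).IsTrue)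
      (hd : Exec d σ t σ') : Exec (Cmd.cond e c d) σ (e.cost + 1 + t) σ'
  | loopTrue {e : Expr} {c : Cmd} {σ σ' σ'' : Store} {s t : ℕ} (he : (e.eval σ).IsTrue)
      (hc : Exec c σ s σ') (hl : Exec (Cmd.loop e c) σ' t σ'') :
      Exec (Cmd.loop e c) σ (e.cost + 1 + s + t) σ''
  | loopFalse {e : Expr} (c : Cmd) {σ : Store} (he : ¬ (e.eval σ).IsTrue) :
      Exec (Cmd.loop e c) σ (e.cost + 1) σ

/-- The initial store: the input is in variable `0`, all other variables are `nil`. -/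
def initStore (input : Val) : Store := fun x => if x = 0 then input else Val.nil

/-- On the given input, `c` halts within `T` steps with the given output in variable `0`. -/
def ComputesWithin (c : Cmd) (input output : Val) (T : ℕ) : Prop :=
  ∃ t σ, t ≤ T ∧ Exec c (initStore input) t σ ∧ σ 0 = output

/-! Encodings of the inputs and outputs. -/

namespace Val

def ofList : List Val → Val
  | [] => nil
  | v :: l => cons v (ofList l)

def ofVec {n : ℕ} (v : Fin n → Val) : Val := ofList (List.ofFn v)

/-- A matrix as the list of its rows. -/
def ofMatrix {n : ℕ} (M : Matrix (Fin n) (Fin n) ℝ) : Val :=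
  ofVec fun i => ofVec fun j => num (M i j)

def ofPattern {n : ℕ} (M : Matrix (Fin n) (Fin n) Bool) : Val :=
  ofVec fun i => ofVec fun j => ofBool (M i j)

def ofSystem {n : ℕ} (sys : DescriptorSystem n) : Val :=
  ofList [ofMatrix sys.QF, ofMatrix sys.QA, ofPattern sys.TF, ofPattern sys.TA]

/-- `w_i^Q` is encoded as `(false, i)`, and `x_j^Q` as `(true, j)`. -/
def ofPartner {n : ℕ} : Fin n ⊕ Fin n → Val
  | Sum.inl i => cons (ofBool false) (num (i : ℕ))
  | Sum.inr j => cons (ofBool true) (num (j : ℕ))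

def ofMatching {n : ℕ} (m : Fin n → Fin n ⊕ Fin n) : Val := ofVec fun i => ofPartner (m i)

/-- A set of states as its characteristic vector. -/
def ofSet {n : ℕ} (S : Finset (Fin n)) : Val := ofVec fun i => ofBool (decide (i ∈ S))

/-- The report that there is a result, namely `v`; its absence is reported by `nil`. -/
def found (v : Val) : Val := cons v nil

end Val

end RealWhile

/-! ### Polynomial time computability of families of values -/

namespace RealWhile

/-! Both tasks reduce to one combinatorial problem: each of finitely many classes offers several
vectors, at most one vector may be taken from each class, the vectors taken must be linearly
independent, and among all selections of a prescribed size the total weight is to be maximal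
(`Inst`). This is weighted intersection of a linear matroid with a partition matroid.

It is solved by a primal-dual method. A selection is kept together with prices of the classes such
that no exchange gains reduced weight (`Inst.Inv`). Such a certificate forces optimality among
selections of the same size (`Inst.Inv.weight_le`): the vectors of a rival lie in the spans of the
level sets of the selection, so Hall's theorem pairs the rival's classes with classes of at least
their reduced weight. If an unused class can be reached by tight exchanges, augmenting along a
shortest path keeps the certificate (`Inst.IsPath.inv_augmented`). Otherwise the prices of the
reached classes rise until a further class is reached (`Inst.Inv.raise`). If no exchange leaves the
reached classes, no independent selection is larger (`Inst.Indep.card_le`). A bounded potential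
limits the number of steps (`Inst.solve_spec`).

For the matching, class `i` offers the rows of `Ω` that may be partners of `w_i^T`; admissible
matchings are the independent selections of size `n`.

For the selection problem, `V ∖ S` is independent in the dual of the first matroid iff the union
matroid for `S` has rank `2n` (`dualIndep_rho1_iff`). It is independent in the dual of the second
iff `S` meets every isolated component containing some `w_i^T`, which is linear independence of
explicit vectors on `V ∖ S` (`dualIndep_rho2_iff`). Generic independence of columns means that they
can be matched to rows (`freeIndep_iff`). So with three blocks of coordinates, a selection on the
`3n` columns of `[I | A | B]` records the fixed part, the generic part and the set of states left
out (`selInst_indep_iff`). One choice per class prevents a state from being left out while its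
column of `T_B` is in use. For each `ρ ≤ n` a selection of size `2n + ρ` is optimised, with a weight
so large that the union part gets its full `2n` columns if possible; then `ρ` states are left out.
The bound `k` only restricts `ρ`, and the best `ρ` is taken.

For the running time, `Comp sz f g` asserts one program for a whole family of inputs. It is closed
under pairing, branching, bounded loops and table access, so a polynomial time bound follows by
assembling the definition of the result. Arithmetic has unit cost, so only loop lengths and indices
need polynomial bounds (`CompN`). Membership in a span is decided by orthogonal projection
(`inSpan_iff`). -/

/-- `N` is bounded by a polynomial in the size `sz`. -/
def PolyBdd {ι : Type} (sz N : ι → ℕ) : Prop :=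
  ∃ p : Polynomial ℕ, ∀ i, N i ≤ p.eval (sz i)

/-- A single program computes `g i` from `f i`, for every index `i`, in time polynomial in `sz i`.
Input and output are in variable `0`; variables above some bound are left alone. -/
def Comp {ι : Type} (sz : ι → ℕ) (f g : ι → Val) : Prop :=
  ∃ (c : Cmd) (b : ℕ) (p : Polynomial ℕ), ∀ i σ, σ 0 = f i →
    ∃ t σ₁, t ≤ p.eval (sz i) ∧ Exec c σ t σ₁ ∧ σ₁ 0 = g i ∧ ∀ x, b < x → σ₁ x = σ x

/-- Natural numbers that are polynomially bounded and computable. -/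
structure CompN {ι : Type} (sz : ι → ℕ) (f : ι → Val) (N : ι → ℕ) : Prop where
  bdd : PolyBdd sz N
  comp : Comp sz f fun i => Val.num (N i : ℝ)

abbrev CompR {ι : Type} (sz : ι → ℕ) (f : ι → Val) (r : ι → ℝ) : Prop :=
  Comp sz f fun i => Val.num (r i)

open Classical in
/-- The truth value of a proposition. -/
noncomputable def Val.ofProp (P : Prop) : Val := Val.ofBool (decide P)

abbrev CompP {ι : Type} (sz : ι → ℕ) (f : ι → Val) (P : ι → Prop) : Prop :=
  Comp sz f fun i => Val.ofProp (P i)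

theorem Val.isTrue_ofProp {P : Prop} : (Val.ofProp P).IsTrue ↔ P := by
  unfold ofProp IsTrue
  by_cases h : P <;> simp [h, ofBool]

theorem Val.ofProp_eq_ofBool (b : Bool) : Val.ofProp (b = true) = Val.ofBool b := by
  cases b <;> simp [ofProp]

theorem Val.ofProp_congr {P Q : Prop} (h : P ↔ Q) : Val.ofProp P = Val.ofProp Q := by
  rw [propext h]

namespace PolyBdd

variable {ι : Type} {sz N M : ι → ℕ}

theorem const (k : ℕ) : PolyBdd sz fun _ => k := ⟨Polynomial.C k, fun i => by simp⟩

theorem mono (h : PolyBdd sz M) (hN : ∀ i, N i ≤ M i) : PolyBdd sz N :=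
  h.imp fun _ hp i => (hN i).trans (hp i)

theorem add (hN : PolyBdd sz N) (hM : PolyBdd sz M) : PolyBdd sz fun i => N i + M i := by
  obtain ⟨p, hp⟩ := hN
  obtain ⟨q, hq⟩ := hM
  exact ⟨p + q, fun i => by simpa using add_le_add (hp i) (hq i)⟩

theorem mul (hN : PolyBdd sz N) (hM : PolyBdd sz M) : PolyBdd sz fun i => N i * M i := by
  obtain ⟨p, hp⟩ := hN
  obtain ⟨q, hq⟩ := hM
  exact ⟨p * q, fun i => by simpa using Nat.mul_le_mul (hp i) (hq i)⟩

theorem self : PolyBdd sz sz := ⟨Polynomial.X, fun i => by simp⟩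

theorem reindex {κ : Type} (π : κ → ι) (h : PolyBdd sz N) :
    PolyBdd (fun x => sz (π x)) fun x => N (π x) :=
  h.imp fun _ hp x => hp (π x)

end PolyBdd

/-! ### Sequencing, branching and loops -/

section Basic

variable {ι : Type} {sz : ι → ℕ} {f g h : ι → Val}

theorem Comp.id : Comp sz f f :=
  ⟨Cmd.skip, 0, 1, fun i σ hσ => ⟨1, σ, by simp, Exec.skip σ, hσ, fun _ _ => rfl⟩⟩

theorem Comp.congr (hg : Comp sz f g) (e : ∀ i, g i = h i) : Comp sz f h := by
  rwa [show h = g from funext fun i => (e i).symm]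

/-- One program serves all indices, hence every family pulled back along `π`. Pulling back to a
subtype makes a side condition available; pulling back along a projection makes room for a bound
variable. -/
theorem Comp.reindex {κ : Type} (π : κ → ι) (hg : Comp sz f g) :
    Comp (fun x => sz (π x)) (fun x => f (π x)) fun x => g (π x) := by
  obtain ⟨c, b, p, hp⟩ := hg
  exact ⟨c, b, p, fun x => hp (π x)⟩

theorem Comp.comp (hg : Comp sz f g) (hh : Comp sz g h) : Comp sz f h := by
  obtain ⟨c, b, p, hp⟩ := hg
  obtain ⟨d, b', q, hq⟩ := hh
  refine ⟨Cmd.seq c d, max b b', p + q, fun i σ hσ => ?_⟩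
  obtain ⟨t, σ', ht, he, h0, hx⟩ := hp i σ hσ
  obtain ⟨t', σ'', ht', he', h0', hx'⟩ := hq i σ' h0
  exact ⟨t + t', σ'', by simpa using add_le_add ht ht', Exec.seq he he', h0', fun x hxx =>
    (hx' x (by omega)).trans (hx x (by omega))⟩

/-- Constant expressions and expressions in the input. -/
theorem Comp.expr (e : Expr) (he : ∀ i σ, σ 0 = f i → e.eval σ = g i) : Comp sz f g := by
  refine ⟨Cmd.assign 0 e, 0, Polynomial.C (e.cost + 1), fun i σ hσ =>
    ⟨e.cost + 1, _, by simp, Exec.assign 0 e σ, ?_, fun x hx => ?_⟩⟩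
  · simpa using he i σ hσ
  · exact Function.update_of_ne (by omega) _ _

theorem Comp.nil : Comp sz f fun _ => Val.nil := Comp.expr Expr.nil fun _ _ _ => rfl

theorem Comp.one : CompR sz f fun _ => 1 := Comp.expr Expr.one fun _ _ _ => rfl

theorem Comp.hd (hg : Comp sz f g) : Comp sz f fun i => (g i).hd :=
  hg.comp (Comp.expr (Expr.hd (Expr.var 0)) fun i σ hσ => by simp [Expr.eval, hσ])

theorem Comp.tl (hg : Comp sz f g) : Comp sz f fun i => (g i).tl :=
  hg.comp (Comp.expr (Expr.tl (Expr.var 0)) fun i σ hσ => by simp [Expr.eval, hσ])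

/-- The registers `s` and `s + 1` lie above the bounds of both subprograms, so the last clause of
`Comp` keeps the saved input and the first value intact. -/
theorem Comp.bin (op : Expr → Expr → Expr) (F : Val → Val → Val)
    (hop : ∀ a b σ, (op a b).eval σ = F (a.eval σ) (b.eval σ)) (hg : Comp sz f g)
    (hh : Comp sz f h) : Comp sz f fun i => F (g i) (h i) := by
  obtain ⟨c, b, p, hp⟩ := hg
  obtain ⟨d, b', q, hq⟩ := hh
  set s := max b b' + 1 with hs
  set e := op (Expr.var (s + 1)) (Expr.var 0) with hee
  refine ⟨Cmd.seq (Cmd.assign s (Expr.var 0)) (Cmd.seq c (Cmd.seq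
    (Cmd.assign (s + 1) (Expr.var 0)) (Cmd.seq (Cmd.assign 0 (Expr.var s)) (Cmd.seq d
      -- The three copies of a variable cost 2 each, the last assignment `e.cost + 1`.
      (Cmd.assign 0 e))))), s + 1, p + q + Polynomial.C (7 + e.cost), fun i σ hσ => ?_⟩
  obtain ⟨t, σ', ht, he, h0, hx⟩ := hp i (Function.update σ s (σ 0)) (by
    rw [Function.update_of_ne (by omega)]; exact hσ)
  obtain ⟨t', σ'', ht', he', h0', hx'⟩ := hq i
    (Function.update (Function.update σ' (s + 1) (σ' 0)) 0 (σ' s)) (by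
      rw [Function.update_self, hx s (by omega), Function.update_self, hσ])
  refine ⟨_, _, ?_, Exec.seq (Exec.assign s (Expr.var 0) σ) (Exec.seq he (Exec.seq
    (Exec.assign (s + 1) (Expr.var 0) σ') (Exec.seq (Exec.assign 0 (Expr.var s) _)
      (Exec.seq (s := t') ?_ (Exec.assign 0 e σ''))))), ?_, fun x hxx => ?_⟩
  · simp only [Expr.cost, Polynomial.eval_add, Polynomial.eval_C]
    omega
  · convert he' using 2
    · rfl
    · exact Function.update_of_ne (show s ≠ s + 1 by omega) _ _
  · rw [Function.update_self, hee, hop]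
    simp only [Expr.eval]
    rw [h0', hx' (s + 1) (by omega), Function.update_of_ne (by omega), Function.update_self, h0]
  · rw [Function.update_of_ne (by omega), hx' x (by omega), Function.update_of_ne (by omega),
      Function.update_of_ne (by omega), hx x (by omega), Function.update_of_ne (by omega)]

theorem Comp.cons (hg : Comp sz f g) (hh : Comp sz f h) : Comp sz f fun i => Val.cons (g i) (h i) :=
  Comp.bin Expr.cons Val.cons (fun _ _ _ => rfl) hg hh

theorem CompR.add {a b : ι → ℝ} (ha : CompR sz f a) (hb : CompR sz f b) :
    CompR sz f fun i => a i + b i :=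
  Comp.bin Expr.add (Val.arith fun x y => x + y) (fun _ _ _ => rfl) ha hb

theorem CompR.sub {a b : ι → ℝ} (ha : CompR sz f a) (hb : CompR sz f b) :
    CompR sz f fun i => a i - b i :=
  Comp.bin Expr.sub (Val.arith fun x y => x - y) (fun _ _ _ => rfl) ha hb

theorem CompR.mul {a b : ι → ℝ} (ha : CompR sz f a) (hb : CompR sz f b) :
    CompR sz f fun i => a i * b i :=
  Comp.bin Expr.mul (Val.arith fun x y => x * y) (fun _ _ _ => rfl) ha hb

theorem CompR.div {a b : ι → ℝ} (ha : CompR sz f a) (hb : CompR sz f b) :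
    CompR sz f fun i => a i / b i :=
  Comp.bin Expr.div (Val.arith fun x y => x / y) (fun _ _ _ => rfl) ha hb

theorem CompR.le {a b : ι → ℝ} (ha : CompR sz f a) (hb : CompR sz f b) :
    CompP sz f fun i => a i ≤ b i :=
  Comp.bin Expr.leq Val.leq (fun _ _ _ => rfl) ha hb

theorem CompR.zero : CompR sz f fun _ => 0 :=
  (CompR.sub Comp.one Comp.one).congr fun i => by simp

/-- Case distinction; each branch need only work where it is taken. -/
theorem Comp.iteDep {P : ι → Prop} [∀ i, Decidable (P i)] (hP : CompP sz f P)
    (hg : Comp (fun x : {i // P i} => sz x.1) (fun x => f x.1) fun x => g x.1)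
    (hh : Comp (fun x : {i // ¬ P i} => sz x.1) (fun x => f x.1) fun x => h x.1) :
    Comp sz f fun i => if P i then g i else h i := by
  obtain ⟨a, b₀, r, hr⟩ := hP
  obtain ⟨c, b, p, hp⟩ := hg
  obtain ⟨d, b', q, hq⟩ := hh
  set s := max b₀ (max b b') + 1 with hs
  refine ⟨Cmd.seq (Cmd.assign s (Expr.var 0)) (Cmd.seq a (Cmd.seq
    (Cmd.assign (s + 1) (Expr.var 0)) (Cmd.seq (Cmd.assign 0 (Expr.var s))
      -- Three assignments and the test of a variable cost 2 each; `p + q` covers either branch.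
      (Cmd.cond (Expr.var (s + 1)) c d)))), s + 1, r + p + q + Polynomial.C 8, fun i σ hσ => ?_⟩
  obtain ⟨t, σ', ht, he, h0, hx⟩ := hr i (Function.update σ s (σ 0)) (by
    rw [Function.update_of_ne (by omega)]; exact hσ)
  set τ := Function.update (Function.update σ' (s + 1) (σ' 0)) 0 (σ' s) with hτ
  have hτ0 : τ 0 = f i := by
    rw [hτ, Function.update_self, hx s (by omega), Function.update_self, hσ]
  have hτ1 : τ (s + 1) = Val.ofProp (P i) := by
    rw [hτ, Function.update_of_ne (by omega), Function.update_self, h0]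
  have hτx : ∀ x, s + 1 < x → τ x = σ x := fun x hxx => by
    rw [hτ, Function.update_of_ne (by omega), Function.update_of_ne (by omega), hx x (by omega),
      Function.update_of_ne (by omega)]
  have pre : ∀ {t' σ''}, Exec (Cmd.cond (Expr.var (s + 1)) c d) τ t' σ'' →
      Exec (Cmd.seq (Cmd.assign s (Expr.var 0)) (Cmd.seq a (Cmd.seq
        (Cmd.assign (s + 1) (Expr.var 0)) (Cmd.seq (Cmd.assign 0 (Expr.var s))
          (Cmd.cond (Expr.var (s + 1)) c d))))) σ (2 + (t + (2 + (2 + t')))) σ'' := by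
    intro t' σ'' hex
    refine Exec.seq (Exec.assign s (Expr.var 0) σ) (Exec.seq he (Exec.seq
      (Exec.assign (s + 1) (Expr.var 0) σ') (Exec.seq (Exec.assign 0 (Expr.var s) _) ?_)))
    convert hex using 2
    · rfl
    · exact Function.update_of_ne (show s ≠ s + 1 by omega) _ _
  by_cases hPi : P i
  · obtain ⟨t', σ'', ht', he', h0', hx'⟩ := hp ⟨i, hPi⟩ τ hτ0
    refine ⟨_, σ'', ?_, pre (Exec.condTrue d ?_ he'), ?_, fun x hxx => ?_⟩
    · simp only [Expr.cost, Polynomial.eval_add, Polynomial.eval_C] at *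
      omega
    · rw [Expr.eval, hτ1, Val.isTrue_ofProp]; exact hPi
    · simp [hPi, h0']
    · rw [hx' x (by omega), hτx x hxx]
  · obtain ⟨t', σ'', ht', he', h0', hx'⟩ := hq ⟨i, hPi⟩ τ hτ0
    refine ⟨_, σ'', ?_, pre (Exec.condFalse c ?_ he'), ?_, fun x hxx => ?_⟩
    · simp only [Expr.cost, Polynomial.eval_add, Polynomial.eval_C] at *
      omega
    · rw [Expr.eval, hτ1, Val.isTrue_ofProp]; exact hPi
    · simp [hPi, h0']
    · rw [hx' x (by omega), hτx x hxx]

theorem Comp.ite {P : ι → Prop} [∀ i, Decidable (P i)] (hP : CompP sz f P)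
    (hg : Comp sz f g) (hh : Comp sz f h) : Comp sz f fun i => if P i then g i else h i :=
  Comp.iteDep hP (hg.reindex _) (hh.reindex _)

/-- While loops: the state is in variable `0`, and its head tells whether to go on. -/
theorem Comp.while {T : ι → ℕ} {st : ι → ℕ → Val} (hT : PolyBdd sz T)
    (hs : Comp (fun x : Σ i, Fin (T i) => sz x.1) (fun x => st x.1 x.2)
      fun x => st x.1 (x.2 + 1))
    (htrue : ∀ i t, t < T i → (st i t).hd.IsTrue) (hfalse : ∀ i, ¬ (st i (T i)).hd.IsTrue) :
    Comp sz (fun i => st i 0) fun i => st i (T i) := by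
  obtain ⟨c, b, p, hp⟩ := hs
  obtain ⟨q, hq⟩ := hT
  -- A test of the head costs 3, and there is one more test than there are rounds.
  refine ⟨Cmd.loop (Expr.hd (Expr.var 0)) c, b, q * (p + 3) + 3, fun i σ hσ => ?_⟩
  suffices H : ∀ k t σ, t + k = T i → σ 0 = st i t → ∃ t' σ', t' ≤ k * (p.eval (sz i) + 3) + 3 ∧
      Exec (Cmd.loop (Expr.hd (Expr.var 0)) c) σ t' σ' ∧ σ' 0 = st i (T i) ∧
        ∀ x, b < x → σ' x = σ x by
    obtain ⟨t', σ', h1, h2⟩ := H (T i) 0 σ (by omega) hσ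
    refine ⟨t', σ', h1.trans ?_, h2⟩
    have := Nat.mul_le_mul_right (p.eval (sz i) + 3) (hq i)
    simpa using this
  intro k
  induction k with
  | zero =>
    intro t σ ht hσ
    obtain rfl : t = T i := by omega
    refine ⟨_, σ, ?_, Exec.loopFalse c ?_, hσ, fun _ _ => rfl⟩
    · simp [Expr.cost]
    · rw [Expr.eval, Expr.eval, hσ]; exact hfalse i
  | succ k ih =>
    intro t σ ht hσ
    obtain ⟨t₁, σ₁, h1, h2, h3, h4⟩ := hp ⟨i, ⟨t, by omega⟩⟩ σ hσ
    obtain ⟨t₂, σ₂, k1, k2, k3, k4⟩ := ih (t + 1) σ₁ (by omega) h3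
    refine ⟨_, σ₂, ?_, Exec.loopTrue ?_ h2 k2, k3, fun x hx => (k4 x hx).trans (h4 x hx)⟩
    · simp only [Expr.cost] at *
      rw [add_mul]
      omega
    · rw [Expr.eval, Expr.eval, hσ]; exact htrue i t (by omega)

end Basic

/-! ### Propositions and natural numbers -/

section PropNat

variable {ι : Type} {sz : ι → ℕ} {f : ι → Val}

theorem CompP.congr {P Q : ι → Prop} (hP : CompP sz f P) (h : ∀ i, P i ↔ Q i) : CompP sz f Q :=
  Comp.congr hP fun i => Val.ofProp_congr (h i)

theorem CompP.true : CompP sz f fun _ => True :=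
  (Comp.cons Comp.nil Comp.nil).congr fun i => by simp [Val.ofProp, Val.ofBool]

theorem CompP.false : CompP sz f fun _ => False :=
  Comp.nil.congr fun i => by simp [Val.ofProp, Val.ofBool]

open Classical in
theorem CompP.not {P : ι → Prop} (hP : CompP sz f P) : CompP sz f fun i => ¬ P i :=
  (Comp.ite hP CompP.false CompP.true).congr fun i => by by_cases h : P i <;> simp [h]

open Classical in
theorem CompP.and {P Q : ι → Prop} (hP : CompP sz f P) (hQ : CompP sz f Q) :
    CompP sz f fun i => P i ∧ Q i :=
  (Comp.ite hP hQ CompP.false).congr fun i => by by_cases h : P i <;> simp [h]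

open Classical in
theorem CompP.or {P Q : ι → Prop} (hP : CompP sz f P) (hQ : CompP sz f Q) :
    CompP sz f fun i => P i ∨ Q i :=
  (Comp.ite hP CompP.true hQ).congr fun i => by by_cases h : P i <;> simp [h]

theorem CompP.imp {P Q : ι → Prop} (hP : CompP sz f P) (hQ : CompP sz f Q) :
    CompP sz f fun i => P i → Q i :=
  (hP.not.or hQ).congr fun i => by tauto

theorem CompR.eq {a b : ι → ℝ} (ha : CompR sz f a) (hb : CompR sz f b) :
    CompP sz f fun i => a i = b i :=
  ((ha.le hb).and (hb.le ha)).congr fun i => by rw [le_antisymm_iff]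

theorem CompR.ite {P : ι → Prop} [∀ i, Decidable (P i)] {a b : ι → ℝ} (hP : CompP sz f P)
    (ha : CompR sz f a) (hb : CompR sz f b) : CompR sz f fun i => if P i then a i else b i :=
  (Comp.ite hP ha hb).congr fun i => by dsimp only; split_ifs <;> rfl

namespace CompN

variable {N M : ι → ℕ}

theorem congr (hN : CompN sz f N) (h : ∀ i, N i = M i) : CompN sz f M := by
  rwa [show M = N from funext fun i => (h i).symm]

theorem real (hN : CompN sz f N) : CompR sz f fun i => (N i : ℝ) := hN.comp

theorem zero : CompN sz f fun _ => 0 := ⟨.const 0, CompR.zero.congr fun _ => by simp⟩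

theorem one : CompN sz f fun _ => 1 := ⟨.const 1, Comp.one.congr fun _ => by simp⟩

theorem add (hN : CompN sz f N) (hM : CompN sz f M) : CompN sz f fun i => N i + M i :=
  ⟨hN.bdd.add hM.bdd, (hN.real.add hM.real).congr fun i => by simp⟩

theorem succ (hN : CompN sz f N) : CompN sz f fun i => N i + 1 := hN.add one

theorem mul (hN : CompN sz f N) (hM : CompN sz f M) : CompN sz f fun i => N i * M i :=
  ⟨hN.bdd.mul hM.bdd, (hN.real.mul hM.real).congr fun i => by simp⟩

theorem le (hN : CompN sz f N) (hM : CompN sz f M) : CompP sz f fun i => N i ≤ M i :=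
  (hN.real.le hM.real).congr fun i => by simp

theorem lt (hN : CompN sz f N) (hM : CompN sz f M) : CompP sz f fun i => N i < M i :=
  (hM.le hN).not.congr fun i => by simp

theorem eq (hN : CompN sz f N) (hM : CompN sz f M) : CompP sz f fun i => N i = M i :=
  (hN.real.eq hM.real).congr fun i => by simp

theorem ite {P : ι → Prop} [∀ i, Decidable (P i)] (hP : CompP sz f P) (hN : CompN sz f N)
    (hM : CompN sz f M) : CompN sz f fun i => if P i then N i else M i :=
  ⟨(hN.bdd.add hM.bdd).mono fun i => by split_ifs <;> omega,
    (Comp.ite hP hN.comp hM.comp).congr fun i => by split_ifs <;> rfl⟩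

theorem sub (hN : CompN sz f N) (hM : CompN sz f M) : CompN sz f fun i => N i - M i :=
  ⟨hN.bdd.mono fun i => by omega, (CompR.ite (hM.le hN) (hN.real.sub hM.real) CompR.zero).congr
    fun i => by
      dsimp only
      split_ifs with h
      · rw [Nat.cast_sub h]
      · rw [Nat.sub_eq_zero_of_le (by omega)]; simp⟩

theorem reindex {κ : Type} (π : κ → ι) (hN : CompN sz f N) :
    CompN (fun x => sz (π x)) (fun x => f (π x)) fun x => N (π x) :=
  ⟨hN.bdd.reindex π, hN.comp.reindex π⟩

theorem const (k : ℕ) : CompN sz f fun _ => k := by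
  induction k with
  | zero => exact zero
  | succ k ih => exact ih.succ

theorem comp' {g : ι → Val} (hg : Comp sz f g) (hN : CompN sz g N) : CompN sz f N :=
  ⟨hN.bdd, hg.comp hN.comp⟩

end CompN

end PropNat

/-! ### Iteration -/

section Iteration

/-- The size function below a bound variable that ranges over the numbers below `N`. -/
abbrev bsz {ι : Type} (sz N : ι → ℕ) : (Σ i, Fin (N i)) → ℕ := fun x => sz x.1

/-- The input below a bound variable that ranges over the numbers below `N`. -/
abbrev benv {ι : Type} (f : ι → Val) (N : ι → ℕ) : (Σ i, Fin (N i)) → Val :=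
  fun x => Val.cons (Val.num ((x.2 : ℕ) : ℝ)) (f x.1)

variable {ι : Type} {sz N : ι → ℕ} {f g : ι → Val}

/-- The environment is a stack: a new value is put in front, and the old environment is its tail. -/
theorem Comp.weaken (a : ι → Val) (hg : Comp sz f g) : Comp sz (fun i => Val.cons (a i) (f i)) g :=
  Comp.comp (g := f) (Comp.tl (g := fun i => Val.cons (a i) (f i)) Comp.id) hg

theorem CompN.weaken {K : ι → ℕ} (a : ι → Val) (hK : CompN sz f K) :
    CompN sz (fun i => Val.cons (a i) (f i)) K :=
  ⟨hK.bdd, hK.comp.weaken a⟩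

theorem Comp.up (hg : Comp sz f g) : Comp (bsz sz N) (benv f N) fun x => g x.1 :=
  (hg.reindex (fun x : Σ i, Fin (N i) => x.1)).weaken _

theorem CompN.up {K : ι → ℕ} (hK : CompN sz f K) : CompN (bsz sz N) (benv f N) fun x => K x.1 :=
  (hK.reindex (fun x : Σ i, Fin (N i) => x.1)).weaken _

theorem CompN.idx (hN : CompN sz f N) : CompN (bsz sz N) (benv f N) fun x => (x.2 : ℕ) :=
  ⟨(hN.bdd.reindex Sigma.fst).mono fun x => x.2.2.le, Comp.hd (g := benv f N) Comp.id⟩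

/-- The loop carries the state, the counter and the input, preceded by the truth value of `1 ≤ N -
t` that `Comp.while` tests. The step program need only be correct on states that really occur, so
facts about them may be used as side conditions. -/
theorem Comp.iterate {st : ι → ℕ → Val} (hN : CompN sz f N) (h0 : Comp sz f fun i => st i 0)
    (hs : Comp (bsz sz N) (fun x => Val.cons (st x.1 x.2) (benv f N x))
      fun x => st x.1 (x.2 + 1)) :
    Comp sz f fun i => st i (N i) := by
  set S : ι → ℕ → Val := fun i t => Val.cons (Val.ofProp (1 ≤ (N i : ℝ) - t))
    (Val.cons (st i t) (Val.cons (Val.num (t : ℝ)) (f i))) with hS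
  have key : Comp sz (fun i => S i 0) fun i => S i (N i) := by
    refine Comp.while hN.bdd ?_ ?_ ?_
    · have e1 : Comp (bsz sz N) (fun x => S x.1 x.2) fun x => Val.cons (st x.1 x.2) (benv f N x) :=
        Comp.tl (g := fun x : Σ i, Fin (N i) => S x.1 x.2) Comp.id
      have e2 : Comp (bsz sz N) (fun x => S x.1 x.2) (benv f N) := e1.tl
      have e3 : Comp (bsz sz N) (fun x => S x.1 x.2) (fun x => f x.1) := e2.tl
      have hi : CompN (bsz sz N) (fun x => S x.1 x.2) fun x => (x.2 : ℕ) + 1 :=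
        (CompN.comp' e2 (CompN.idx hN)).succ
      have hNN : CompR (bsz sz N) (fun x => S x.1 x.2) fun x => (N x.1 : ℝ) :=
        e3.comp (hN.comp.reindex fun x : Σ i, Fin (N i) => x.1)
      exact Comp.cons (CompR.le Comp.one (hNN.sub hi.real))
        (Comp.cons (e1.comp hs) (Comp.cons hi.comp e3))
    · intro i t ht
      have : (t : ℝ) + 1 ≤ N i := by exact_mod_cast ht
      rw [hS, Val.hd, Val.isTrue_ofProp]
      linarith
    · intro i
      rw [hS, Val.hd, Val.isTrue_ofProp]
      norm_num
  have hstart : Comp sz f fun i => S i 0 :=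
    Comp.cons (CompR.le Comp.one (hN.real.sub CompN.zero.real))
      (Comp.cons h0 (Comp.cons CompN.zero.comp Comp.id))
  exact (hstart.comp key).tl.hd

/-- The list `[a 0, …, a (N - 1)]`. -/
def vec (N : ℕ) (a : ℕ → Val) : Val := Val.ofList ((List.range N).map a)

theorem vec_congr {N : ℕ} {a b : ℕ → Val} (h : ∀ k < N, a k = b k) : vec N a = vec N b := by
  unfold vec
  congr 1
  exact List.map_congr_left fun k hk => h k (List.mem_range.1 hk)

theorem vec_succ (N : ℕ) (a : ℕ → Val) : vec (N + 1) a = Val.cons (a 0) (vec N fun k => a (k + 1)) := by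
  unfold vec
  rw [List.range_succ_eq_map, List.map_cons, Val.ofList, List.map_map]
  rfl

theorem ofVec_eq_vec {N : ℕ} (a : Fin N → Val) (b : ℕ → Val) (h : ∀ k : Fin N, b k = a k) :
    Val.ofVec a = vec N b := by
  unfold Val.ofVec vec
  congr 1
  apply List.ext_getElem
  · simp
  · intro k h1 h2
    simp only [List.length_ofFn] at h1
    simp [← h ⟨k, h1⟩]

theorem vec_tl_iterate (N : ℕ) (a : ℕ → Val) (j : ℕ) :
    Val.tl^[j] (vec N a) = vec (N - j) fun k => a (k + j) := by
  induction j with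
  | zero => simp
  | succ j ih =>
    rw [Function.iterate_succ_apply', ih]
    rcases h : N - j with _ | M
    · rw [show N - (j + 1) = 0 by omega]; rfl
    · rw [show N - (j + 1) = M by omega, vec_succ, Val.tl]
      congr 1
      funext k
      congr 1
      omega

theorem Comp.get {a : ι → ℕ → Val} {j : ι → ℕ} (ha : Comp sz f fun i => vec (N i) (a i))
    (hj : CompN sz f j) (hlt : ∀ i, j i < N i) : Comp sz f fun i => a i (j i) := by
  have := Comp.iterate (st := fun i t => Val.tl^[t] (vec (N i) (a i))) hj ha (by
    simp only [Function.iterate_succ_apply']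
    exact Comp.tl (Comp.hd (g := fun x => Val.cons _ _) Comp.id))
  refine this.hd.congr fun i => ?_
  have hi := hlt i
  rw [vec_tl_iterate, show N i - j i = (N i - j i - 1) + 1 by omega, vec_succ]
  simp [Val.hd]

theorem Comp.vec {a : ι → ℕ → Val} (hN : CompN sz f N)
    (ha : Comp (bsz sz N) (benv f N) fun x => a x.1 x.2) :
    Comp sz f fun i => vec (N i) (a i) := by
  -- The list grows at its head, so it is built from the last entry backwards: after `t` rounds it
  -- holds the last `t` entries.
  have := Comp.iterate (st := fun i t => RealWhile.vec t fun k => a i (N i - t + k)) hN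
    (Comp.nil.congr fun i => rfl) (by
      have hi : CompN (bsz sz N) (fun x => Val.cons (RealWhile.vec (x.2 : ℕ) fun k =>
          a x.1 (N x.1 - x.2 + k)) (benv f N x)) fun x => N x.1 - (x.2 + 1) :=
        ((hN.up.sub (CompN.idx hN).succ).weaken _)
      have hf : Comp (bsz sz N) (fun x => Val.cons (RealWhile.vec (x.2 : ℕ) fun k =>
          a x.1 (N x.1 - x.2 + k)) (benv f N x)) fun x => f x.1 := Comp.up Comp.id |>.weaken _
      have := ha.reindex (fun x : Σ i, Fin (N i) => (⟨x.1, ⟨N x.1 - (x.2 + 1), by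
        have := x.2.2; omega⟩⟩ : Σ i, Fin (N i)))
      refine (Comp.cons ((Comp.cons hi.comp hf).comp this)
        (Comp.hd (g := fun x => Val.cons _ _) Comp.id)).congr fun x => ?_
      have hx := x.2.2
      rw [vec_succ]
      simp only [Val.hd, add_zero]
      congr 2
      funext k
      congr 1
      omega)
  exact this.congr fun i => by simp

/-- The dimension is not part of the encoded system; it is read off the length of a list. As `N` is
not yet computable here, the loop tests the remaining list instead of a counter. -/
theorem Comp.length {a : ι → ℕ → Val} (hB : PolyBdd sz N)
    (ha : Comp sz f fun i => RealWhile.vec (N i) (a i)) : CompN sz f N := by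
  set S : ι → ℕ → Val := fun i t => Val.cons (RealWhile.vec (N i - t) fun k => a i (k + t))
    (Val.num (t : ℝ)) with hS
  have key : Comp sz (fun i => S i 0) fun i => S i (N i) := by
    refine Comp.while hB ?_ ?_ ?_
    · have e1 : Comp (bsz sz N) (fun x => S x.1 x.2) fun x => (S x.1 x.2).hd.tl :=
        Comp.id.hd.tl
      have e2 : CompR (bsz sz N) (fun x => S x.1 x.2) fun x => ((x.2 : ℕ) : ℝ) :=
        Comp.tl (g := fun x : Σ i, Fin (N i) => S x.1 x.2) Comp.id
      refine (Comp.cons e1 (e2.add Comp.one)).congr fun x => ?_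
      have hx := x.2.2
      simp only [hS, Val.hd]
      rw [show N x.1 - (x.2 : ℕ) = (N x.1 - (x.2 + 1)) + 1 by omega, vec_succ]
      simp only [Val.tl, Nat.cast_add, Nat.cast_one]
      congr 2
      funext k
      congr 1
      omega
    · intro i t ht
      simp only [hS, Val.hd]
      rw [show N i - t = (N i - (t + 1)) + 1 by omega, vec_succ]
      simp [Val.IsTrue]
    · intro i
      simp [hS, Val.hd, Val.IsTrue, RealWhile.vec, Val.ofList]
  have hstart : Comp sz f fun i => S i 0 := Comp.cons (ha.congr fun i => by simp) CompN.zero.comp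
  exact ⟨hB, (hstart.comp key).tl⟩

theorem CompN.get {a : ι → ℕ → ℕ} {B j : ι → ℕ}
    (ha : Comp sz f fun i => RealWhile.vec (N i) fun k => Val.num (a i k : ℝ))
    (hj : CompN sz f j) (hlt : ∀ i, j i < N i) (hB : PolyBdd sz B) (hle : ∀ i, a i (j i) ≤ B i) :
    CompN sz f fun i => a i (j i) :=
  ⟨hB.mono hle, Comp.get ha hj hlt⟩

theorem CompR.sum {r : ι → ℕ → ℝ} (hN : CompN sz f N)
    (hr : CompR (bsz sz N) (benv f N) fun x => r x.1 x.2) :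
    CompR sz f fun i => ∑ k ∈ Finset.range (N i), r i k := by
  refine Comp.iterate (st := fun i t => Val.num (∑ k ∈ Finset.range t, r i k)) hN
    (CompR.zero.congr fun i => by simp) ?_
  simp only [Finset.sum_range_succ]
  exact CompR.add (Comp.hd (g := fun x => Val.cons _ _) Comp.id) (hr.weaken _)

theorem CompP.all {P : ι → ℕ → Prop} (hN : CompN sz f N)
    (hP : CompP (bsz sz N) (benv f N) fun x => P x.1 x.2) :
    CompP sz f fun i => ∀ k < N i, P i k := by
  refine Comp.iterate (st := fun i t => Val.ofProp (∀ k < t, P i k)) hN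
    (CompP.true.congr fun i => by simp) ?_
  refine CompP.congr (CompP.and (Comp.hd (g := fun x => Val.cons _ _) Comp.id) (hP.weaken _))
    fun x => ?_
  simp only [Nat.lt_succ_iff_lt_or_eq, or_imp, forall_and, forall_eq]

theorem CompP.ex {P : ι → ℕ → Prop} (hN : CompN sz f N)
    (hP : CompP (bsz sz N) (benv f N) fun x => P x.1 x.2) :
    CompP sz f fun i => ∃ k < N i, P i k :=
  (CompP.all (P := fun i k => ¬ P i k) hN hP.not).not.congr fun i => by push Not; rfl

open Classical in
/-- The least number below `N` with property `P`, or `N` if there is none. -/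
noncomputable def sel (P : ℕ → Prop) : ℕ → ℕ
  | 0 => 0
  | N + 1 => if sel P N < N then sel P N else if P N then N else N + 1

theorem sel_le (P : ℕ → Prop) (N : ℕ) : sel P N ≤ N := by
  induction N with
  | zero => simp [sel]
  | succ N ih => unfold sel; split_ifs <;> omega

theorem sel_spec {P : ℕ → Prop} {N : ℕ} (h : sel P N < N) : P (sel P N) := by
  induction N with
  | zero => simp at h
  | succ N ih =>
    unfold sel at h ⊢
    split_ifs at h ⊢ with h1 h2
    · exact ih h1
    · exact h2
    · omega

theorem sel_lt {P : ℕ → Prop} {N : ℕ} (h : ∃ k < N, P k) : sel P N < N := by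
  induction N with
  | zero => simp at h
  | succ N ih =>
    unfold sel
    split_ifs with h1 h2
    · omega
    · omega
    · obtain ⟨k, hk, hP⟩ := h
      rcases Nat.lt_succ_iff_lt_or_eq.1 hk with hk | rfl
      · exact absurd (ih ⟨k, hk, hP⟩) h1
      · exact absurd hP h2

open Classical in
theorem CompN.sel {P : ι → ℕ → Prop} (hN : CompN sz f N)
    (hP : CompP (bsz sz N) (benv f N) fun x => P x.1 x.2) :
    CompN sz f fun i => sel (P i) (N i) := by
  refine ⟨hN.bdd.mono fun i => sel_le _ _, ?_⟩
  refine Comp.iterate (st := fun i t => Val.num (RealWhile.sel (P i) t : ℝ)) hN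
    CompN.zero.comp ?_
  have hi := (CompN.idx hN).weaken (fun x => Val.num (RealWhile.sel (P x.1) x.2 : ℝ))
  have hs : CompN (bsz sz N) (fun x => Val.cons (Val.num (RealWhile.sel (P x.1) x.2 : ℝ))
      (benv f N x)) fun x => RealWhile.sel (P x.1) x.2 :=
    ⟨hi.bdd.mono fun x => sel_le _ _, Comp.hd (g := fun x => Val.cons _ _) Comp.id⟩
  exact (CompN.ite (hs.lt hi) hs (CompN.ite (hP.weaken _) hi hi.succ)).comp

end Iteration

end RealWhile

/-! ### Exchange in linearly independent families -/

section LinearAlgebra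

open Submodule

variable {κ V : Type*} [AddCommGroup V] [Module ℝ V] {u : κ → V}

/-- In the expansion of `x` in an independent family only the indices outside `B'` that are
redundant may be dropped. -/
theorem LinearIndepOn.mem_span_image_of_forall_mem [DecidableEq κ] {B B' : Finset κ}
    (hu : LinearIndepOn ℝ u (B : Set κ)) (hB : B' ⊆ B) {x : V} (hx : x ∈ span ℝ (u '' B))
    (h : ∀ c ∈ B, c ∉ B' → x ∈ span ℝ (u '' (↑B \ {c}))) : x ∈ span ℝ (u '' B') := by
  obtain ⟨f, hf⟩ := (Submodule.mem_span_image_finset_iff_exists_fun' ℝ).1 hx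
  have hz : ∀ c ∈ B, c ∉ B' → f c = 0 := by
    intro c hc hcB'
    by_contra hne
    refine hu.notMem_span hc ?_
    have hsum : ∑ k ∈ B.erase c, f k • u k ∈ span ℝ (u '' (↑B \ {c})) :=
      sum_mem fun k hk => smul_mem _ _ (subset_span ⟨k, by
        rw [Finset.mem_erase] at hk; exact ⟨hk.2, hk.1⟩, rfl⟩)
    have hfc : f c • u c = x - ∑ k ∈ B.erase c, f k • u k := by
      rw [← hf, ← Finset.add_sum_erase B _ hc]; abel
    have := smul_mem _ (f c)⁻¹ (hfc ▸ sub_mem (h c hc hcB') hsum)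
    rwa [smul_smul, inv_mul_cancel₀ hne, one_smul] at this
  rw [← hf, ← Finset.sum_subset hB fun c hc hcB' => by rw [hz c hc hcB', zero_smul]]
  exact sum_mem fun k hk => smul_mem _ _ (subset_span ⟨k, hk, rfl⟩)

/-- Steinitz exchange: `y` cannot be expressed without `u k`, so `u k` can be expressed by `y` and
the other vectors. -/
theorem span_image_update_of_exchange [DecidableEq κ] {B : Set κ} {k : κ} {y : V} (hk : k ∈ B)
    (hy : y ∈ span ℝ (u '' B)) (hn : y ∉ span ℝ (u '' (B \ {k}))) :
    span ℝ (Function.update u k y '' B) = span ℝ (u '' B) := by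
  have hB : insert k (B \ {k}) = B := by simp [hk]
  have he : Function.update u k y '' (B \ {k}) = u '' (B \ {k}) :=
    Set.image_congr fun c hc => Function.update_of_ne hc.2 _ _
  rw [← hB] at hy
  rw [Set.image_insert_eq] at hy
  have hk' : u k ∈ span ℝ (insert y (u '' (B \ {k}))) := mem_span_insert_exchange hy hn
  apply le_antisymm
  · rw [span_le, ← hB, Set.image_insert_eq, Function.update_self, he, Set.insert_subset_iff,
      Set.image_insert_eq]
    exact ⟨hy, fun x hx => subset_span (Set.mem_insert_of_mem _ hx)⟩
  · rw [span_le, ← hB, Set.image_insert_eq, Set.image_insert_eq, Function.update_self, he,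
      Set.insert_subset_iff]
    exact ⟨hk', fun x hx => subset_span (Set.mem_insert_of_mem _ hx)⟩

/-- Simultaneous exchange: if the exchangeable pairs are acyclic apart from the pairs `(c, x c)`,
then all the `u c`, `c ∈ S`, may be replaced by `x c` at once. -/
theorem LinearIndepOn.exchange [DecidableEq κ] {K : Type*} [LinearOrder K] {B : Finset κ}
    (S : Finset κ) (x : κ → V) (key : κ → K) (hS : S ⊆ B) (hu : LinearIndepOn ℝ u (B : Set κ))
    (h1 : ∀ c ∈ S, x c ∈ span ℝ (u '' B)) (h2 : ∀ c ∈ S, x c ∉ span ℝ (u '' (↑B \ {c})))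
    (h3 : ∀ c ∈ S, ∀ c' ∈ S, c ≠ c' → x c' ∉ span ℝ (u '' (↑B \ {c})) → key c' < key c) :
    LinearIndepOn ℝ (fun c => if c ∈ S then x c else u c) (B : Set κ) ∧
      span ℝ ((fun c => if c ∈ S then x c else u c) '' B) = span ℝ (u '' B) := by
  induction hn : S.card generalizing S u with
  | zero =>
    obtain rfl := Finset.card_eq_zero.1 hn
    simpa using hu
  | succ m ih =>
    -- The index of largest key is exchanged first. By `h3` its new vector lies in the span without
    -- `u c` for every other `c ∈ S`. So this exchange changes none of the spans in the hypotheses,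
    -- and induction applies to `S.erase k`.
    obtain ⟨k, hk, hmax⟩ := S.exists_max_image key (Finset.card_pos.1 (by omega))
    have hkB := hS hk
    have hin : ∀ c ∈ S, c ≠ k → x k ∈ span ℝ (u '' (↑B \ {c})) := by
      intro c hc hck
      by_contra hcon
      exact absurd (h3 c hc k hk hck hcon) (not_lt.2 (hmax c hc))
    set u' := Function.update u k (x k) with hu'
    have hspan : span ℝ (u' '' B) = span ℝ (u '' B) :=
      span_image_update_of_exchange (by exact_mod_cast hkB) (h1 k hk) (h2 k hk)
    have hspan' : ∀ c ∈ S, c ≠ k → span ℝ (u' '' (↑B \ {c})) = span ℝ (u '' (↑B \ {c})) := by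
      intro c hc hck
      refine span_image_update_of_exchange ⟨hkB, fun h => hck h.symm⟩ (hin c hc hck) fun h =>
        h2 k hk (span_mono (Set.image_mono ?_) h)
      intro a ha
      exact ⟨ha.1.1, ha.2⟩
    have hind : LinearIndepOn ℝ u' (B : Set κ) := by
      have hB : insert k ((B : Set κ) \ {k}) = B := by simp [hkB]
      rw [← hB, linearIndepOn_insert (by simp)]
      have he : Set.EqOn u u' ((B : Set κ) \ {k}) := fun c hc =>
        (Function.update_of_ne hc.2 _ _).symm
      refine ⟨(hu.mono Set.sdiff_subset).congr he, ?_⟩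
      rw [← Set.image_congr he, hu', Function.update_self]
      exact h2 k hk
    have := ih (u := u') (S.erase k) ((Finset.erase_subset _ _).trans hS) hind
      (fun c hc => by rw [hspan]; exact h1 c (Finset.mem_of_mem_erase hc))
      (fun c hc => by
        rw [hspan' c (Finset.mem_of_mem_erase hc) (Finset.ne_of_mem_erase hc)]
        exact h2 c (Finset.mem_of_mem_erase hc))
      (fun c hc c' hc' hne => by
        rw [hspan' c (Finset.mem_of_mem_erase hc) (Finset.ne_of_mem_erase hc)]
        exact h3 c (Finset.mem_of_mem_erase hc) c' (Finset.mem_of_mem_erase hc') hne)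
      (by rw [Finset.card_erase_of_mem hk]; omega)
    have hfun : (fun c => if c ∈ S.erase k then x c else u' c) =
        fun c => if c ∈ S then x c else u c := by
      funext c
      by_cases hck : c = k
      · subst hck; simp [hk, hu']
      · simp [hck, hu']
    rw [hfun, hspan] at this
    exact this

theorem LinearIndepOn.card_le_of_subset_span {κ' : Type*} {J : Finset κ} {B : Finset κ'}
    {x : κ' → V} (hu : LinearIndepOn ℝ u (J : Set κ)) (h : ∀ c ∈ J, u c ∈ span ℝ (x '' B)) :
    J.card ≤ B.card := by
  classical
  have := linearIndependent_le_span' _ hu.linearIndependent_restrict (x '' (B : Set κ'))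
    (by
      rintro _ ⟨c, rfl⟩
      exact h c.1 c.2)
  rw [Cardinal.mk_fintype, Nat.cast_le] at this
  refine (by simpa using this : J.card ≤ _).trans ?_
  exact Finset.card_image_le

end LinearAlgebra

/-! ### Weighted rainbow independent sets -/

namespace RealWhile

open Submodule

/-- Vectors `v c o` of dimension `d` with weights `w c o`, in `q` classes with `p` options each.
Option `0` means that nothing is selected from the class. -/
structure Inst where
  q : ℕ
  p : ℕ
  d : ℕ
  v : ℕ → ℕ → ℕ → ℝ
  w : ℕ → ℕ → ℝ

namespace Inst

variable (D : Inst) (I : ℕ → ℕ) (lam : ℕ → ℝ)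

def vect (c o : ℕ) : Fin D.d → ℝ := fun k => D.v c o k

/-- Option `0` contributes neither vector nor weight, so spans and sums may run over all classes,
used or not. -/
structure WF : Prop where
  v_zero : ∀ c, D.vect c 0 = 0
  w_zero : ∀ c, D.w c 0 = 0
  p_pos : 0 < D.p

/-- At most one vector is selected from each class. -/
structure IsSel : Prop where
  lt : ∀ c, I c < D.p
  zero : ∀ c, D.q ≤ c → I c = 0

def supp : Finset ℕ := (Finset.range D.q).filter fun c => I c ≠ 0

def cur (c : ℕ) : Fin D.d → ℝ := D.vect c (I c)

def Indep : Prop := LinearIndepOn ℝ (D.cur I) (D.supp I : Set ℕ)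

/-- The span of the selected vectors without the one of class `c'`. -/
def spanExc (c' : ℕ) : Submodule ℝ (Fin D.d → ℝ) := span ℝ (D.cur I '' {c | c < D.q ∧ c ≠ c'})

def weight : ℝ := ∑ c ∈ Finset.range D.q, D.w c (I c)

/-- The reduced weights for the prices `lam`. -/
def red (c o : ℕ) : ℝ := D.w c o - lam c

/-- Class `b` may give up its vector for the vector `v c o` without loss; the class `q` is a
virtual source. -/
def Tight (b c o : ℕ) : Prop :=
  (b = D.q ∨ I b ≠ 0) ∧ D.vect c o ∉ D.spanExc I b ∧ D.red lam c o = D.red lam b (I b)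

/-- Class `c` is reached from the source in at most `k` tight steps. -/
def Reach : ℕ → ℕ → Prop
  | 0, c => c = D.q
  | k + 1, c => Reach k c ∨ ∃ b < D.q + 1, ∃ o < D.p, Reach k b ∧ D.Tight I lam b c o

/-- The optimality certificate. -/
structure Inv : Prop where
  sel : D.IsSel I
  indep : D.Indep I
  nonneg : ∀ c < D.q, 0 ≤ lam c
  zero : ∀ c < D.q, I c = 0 → lam c = 0
  -- No admissible exchange gains reduced weight. For the source `c' = q` nothing is given up; its
  -- reduced weight, which is `-lam q` because option `0` has weight zero, is a threshold for
  -- vectors outside the span. By `src` every selected class is at or above this threshold.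
  slack : ∀ c', (c' = D.q ∨ I c' ≠ 0) → ∀ c < D.q, ∀ o < D.p, D.vect c o ∉ D.spanExc I c' →
    D.red lam c o ≤ D.red lam c' (I c')
  src : ∀ c, I c ≠ 0 → D.red lam D.q (I D.q) ≤ D.red lam c (I c)

variable {D I lam}

theorem mem_supp {c : ℕ} : c ∈ D.supp I ↔ c < D.q ∧ I c ≠ 0 := by simp [supp]

theorem IsSel.lt_q (hI : D.IsSel I) {c : ℕ} (h : I c ≠ 0) : c < D.q := by
  by_contra hc
  exact h (hI.zero c (by omega))

theorem card_supp_le : (D.supp I).card ≤ D.q := by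
  simpa [supp] using Finset.card_filter_le (Finset.range D.q) fun c => I c ≠ 0

theorem spanExc_eq (hD : D.WF) (c' : ℕ) :
    D.spanExc I c' = span ℝ (D.cur I '' (↑(D.supp I) \ {c'})) := by
  apply le_antisymm
  · rw [spanExc, span_le]
    rintro _ ⟨c, ⟨hc, hne⟩, rfl⟩
    by_cases h0 : I c = 0
    · rw [cur, h0, hD.v_zero]
      exact zero_mem _
    · exact subset_span ⟨c, ⟨by simp [mem_supp, hc, h0], hne⟩, rfl⟩
  · refine span_mono (Set.image_mono ?_)
    rintro c ⟨hc, hne⟩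
    exact ⟨(mem_supp.1 hc).1, hne⟩

theorem spanExc_q (hD : D.WF) : D.spanExc I D.q = span ℝ (D.cur I '' D.supp I) := by
  rw [spanExc_eq hD, Set.sdiff_singleton_eq_self]
  simp [mem_supp]

theorem Indep.mem_span (hI : D.Indep I) (hD : D.WF) {x : Fin D.d → ℝ} {B : Finset ℕ}
    (hB : B ⊆ D.supp I) (hx : x ∈ D.spanExc I D.q)
    (h : ∀ c ∈ D.supp I, c ∉ B → x ∈ D.spanExc I c) : x ∈ span ℝ (D.cur I '' B) := by
  refine LinearIndepOn.mem_span_image_of_forall_mem hI hB (by rwa [spanExc_q hD] at hx)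
    fun c hc hcB => ?_
  rw [← spanExc_eq hD]
  exact h c hc hcB

/-- If the expansion of `v c o` needed a class `y` of smaller reduced weight, exchanging `y` for
`(c, o)` would be a gain, against `slack`. This is the link between prices and spans. -/
theorem Inv.mem_level (h : D.Inv I lam) (hD : D.WF) {c o : ℕ} (hc : c < D.q) (ho : o < D.p)
    (hx : D.vect c o ∈ D.spanExc I D.q) :
    D.vect c o ∈ span ℝ (D.cur I ''
      ((D.supp I).filter fun y => D.red lam c o ≤ D.red lam y (I y) : Finset ℕ)) := by
  refine h.indep.mem_span hD (Finset.filter_subset _ _) hx fun y hy hyn => ?_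
  by_contra hcon
  exact hyn (Finset.mem_filter.2 ⟨hy, h.slack y (Or.inr (mem_supp.1 hy).2) c hc o ho hcon⟩)

theorem Inv.mem_spanExc_q (h : D.Inv I lam) {c o : ℕ} (hc : c < D.q) (ho : o < D.p)
    (hx : D.red lam D.q (I D.q) < D.red lam c o) : D.vect c o ∈ D.spanExc I D.q := by
  by_contra hcon
  exact absurd (h.slack D.q (Or.inl rfl) c hc o ho hcon) (not_le.2 hx)

/-- A certified selection has maximal weight among the independent selections of its size. -/
theorem Inv.weight_le (h : D.Inv I lam) (hD : D.WF) {J : ℕ → ℕ} (hJ : D.IsSel J)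
    (hJi : D.Indep J) (hcard : (D.supp J).card = (D.supp I).card) : D.weight J ≤ D.weight I := by
  classical
  set t : D.supp J → Finset ℕ := fun x =>
    (D.supp I).filter fun y => D.red lam x (J x) ≤ D.red lam y (I y) with ht
  -- Hall's theorem gives an injection from the classes of `J` to those of `I` that does not
  -- decrease the reduced weight. The condition is checked at the member of `s` of least reduced
  -- weight, whose candidate set is the largest.
  obtain ⟨φ, hφi, hφ⟩ := (Finset.all_card_le_biUnion_card_iff_exists_injective t).1 (by
    intro s
    rcases s.eq_empty_or_nonempty with rfl | hs
    · simp
    obtain ⟨x₀, hx₀, hmin⟩ := s.exists_min_image (fun x => D.red lam x (J x)) hs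
    refine le_trans ?_ (Finset.card_le_card (Finset.subset_biUnion_of_mem t hx₀))
    -- Up to the threshold, every class of `I` is a candidate, and the two selections have equal
    -- size. Above it, all vectors of `s` lie in the span of the level set `t x₀`, so independence
    -- bounds their number.
    rcases le_or_gt (D.red lam x₀ (J x₀)) (D.red lam D.q (I D.q)) with hle | hgt
    · have : t x₀ = D.supp I := by
        rw [ht]
        exact Finset.filter_true_of_mem fun y hy => hle.trans (h.src y (mem_supp.1 hy).2)
      rw [this, ← hcard]
      simpa using Finset.card_le_univ s
    · have hsub : s.map (Function.Embedding.subtype _) ⊆ D.supp J := by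
        intro x hx
        obtain ⟨a, _, rfl⟩ := Finset.mem_map.1 hx
        exact a.2
      have := LinearIndepOn.card_le_of_subset_span (J := s.map (Function.Embedding.subtype _))
        (B := t x₀) (x := D.cur I) (hJi.mono (by exact_mod_cast hsub)) (by
          intro x hx
          obtain ⟨a, ha, rfl⟩ := Finset.mem_map.1 hx
          have haq := (mem_supp.1 a.2).1
          have h1 := h.mem_level hD haq (hJ.lt a) (h.mem_spanExc_q haq (hJ.lt a)
            (hgt.trans_le (hmin a ha)))
          refine span_mono (Set.image_mono ?_) h1
          intro y hy
          simp only [ht, Finset.coe_filter, Set.mem_ofPred_eq] at hy ⊢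
          exact ⟨hy.1, (hmin a ha).trans hy.2⟩)
      simpa using this)
  have himg : Finset.univ.image φ = D.supp I := by
    apply Finset.eq_of_subset_of_card_le
    · intro y hy
      obtain ⟨x, _, rfl⟩ := Finset.mem_image.1 hy
      exact (Finset.mem_filter.1 (hφ x)).1
    · rw [Finset.card_image_of_injective _ hφi, ← hcard]
      simp
  have key : ∑ x ∈ D.supp J, D.red lam x (J x) ≤ ∑ y ∈ D.supp I, D.red lam y (I y) := by
    rw [← himg, Finset.sum_image fun a _ b _ hab => hφi hab, ← Finset.sum_coe_sort]
    exact Finset.sum_le_sum fun x _ => (Finset.mem_filter.1 (hφ x)).2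
  -- A weight is a reduced weight plus the prices of the used classes. The prices favour `I` too:
  -- they are nonnegative, and zero on the classes that `I` does not use.
  have hw : ∀ K : ℕ → ℕ, D.weight K =
      ∑ x ∈ D.supp K, D.red lam x (K x) + ∑ x ∈ D.supp K, lam x := by
    intro K
    rw [← Finset.sum_add_distrib, weight, supp, Finset.sum_filter]
    refine Finset.sum_congr rfl fun c _ => ?_
    split_ifs with h0
    · simp [red]
    · rw [not_not.1 h0, hD.w_zero]
  have hl : ∑ x ∈ D.supp J, lam x ≤ ∑ x ∈ D.supp I, lam x := by
    have h1 : ∑ x ∈ D.supp J, lam x ≤ ∑ x ∈ Finset.range D.q, lam x :=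
      Finset.sum_le_sum_of_subset_of_nonneg (Finset.filter_subset _ _) fun c hc _ =>
        h.nonneg c (Finset.mem_range.1 hc)
    refine h1.trans (le_of_eq ?_)
    rw [supp, Finset.sum_filter]
    refine Finset.sum_congr rfl fun c hc => ?_
    split_ifs with h0
    · rfl
    · exact h.zero c (Finset.mem_range.1 hc) (not_not.1 h0)
  rw [hw I, hw J]
  exact add_le_add key hl

/-- If the classes in `U` absorb all exchanges, then no independent selection is larger. -/
theorem Indep.card_le (hI : D.Indep I) (hD : D.WF) {U : ℕ → Prop} (hq : U D.q)
    (hU : ∀ c < D.q, U c → I c ≠ 0)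
    (hcl : ∀ c', c' ≤ D.q → U c' → ∀ c < D.q, ¬ U c → ∀ o < D.p, D.vect c o ∈ D.spanExc I c')
    {J : ℕ → ℕ} (hJ : D.IsSel J) (hJi : D.Indep J) : (D.supp J).card ≤ (D.supp I).card := by
  classical
  -- Outside `U` the vectors of `J` lie in the span of those of `I` outside `U`; inside `U`, every
  -- class is already used by `I`.
  have h1 : ((D.supp J).filter fun c => ¬ U c).card ≤ ((D.supp I).filter fun c => ¬ U c).card := by
    refine LinearIndepOn.card_le_of_subset_span (x := D.cur I)
      (hJi.mono (by exact_mod_cast Finset.filter_subset _ _)) fun c hc => ?_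
    obtain ⟨hc, hcU⟩ := Finset.mem_filter.1 hc
    have hcq := (mem_supp.1 hc).1
    refine hI.mem_span hD (Finset.filter_subset _ _) (hcl _ le_rfl hq c hcq hcU _ (hJ.lt c))
      fun y hy hyn => ?_
    have hyU : U y := by
      by_contra hcon
      exact hyn (Finset.mem_filter.2 ⟨hy, hcon⟩)
    exact hcl y (mem_supp.1 hy).1.le hyU c hcq hcU _ (hJ.lt c)
  have h2 : ((D.supp J).filter fun c => U c).card ≤ ((D.supp I).filter fun c => U c).card := by
    refine Finset.card_le_card fun c hc => ?_
    obtain ⟨hc, hcU⟩ := Finset.mem_filter.1 hc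
    have hcq := (mem_supp.1 hc).1
    exact Finset.mem_filter.2 ⟨mem_supp.2 ⟨hcq, hU c hcq hcU⟩, hcU⟩
  rw [← Finset.card_filter_add_card_filter_not (s := D.supp J) (fun c => U c),
    ← Finset.card_filter_add_card_filter_not (s := D.supp I) (fun c => U c)]
  omega

/-- Raising the prices of the classes in `U`. -/
theorem Inv.raise (h : D.Inv I lam) {U : ℕ → Prop} [DecidablePred U] {δ : ℝ} (hδ : 0 ≤ δ)
    (hq : U D.q) (hU : ∀ c < D.q, U c → I c ≠ 0)
    (hs : ∀ c', c' ≤ D.q → U c' → ∀ c < D.q, ¬ U c → ∀ o < D.p, D.vect c o ∉ D.spanExc I c' →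
      δ ≤ D.red lam c' (I c') - D.red lam c o) :
    D.Inv I fun c => if U c then lam c + δ else lam c where
  sel := h.sel
  indep := h.indep
  nonneg c hc := by
    have := h.nonneg c hc
    split_ifs <;> linarith
  zero c hc h0 := by
    rw [if_neg fun hUc => hU c hc hUc h0]
    exact h.zero c hc h0
  slack c' hc' c hc o ho hE := by
    have h1 := h.slack c' hc' c hc o ho hE
    have hle : c' ≤ D.q := by
      rcases hc' with rfl | h'
      · exact le_rfl
      · exact (h.sel.lt_q h').le
    unfold red at *
    dsimp only
    -- Only an exchange from a class in `U` to a class outside loses slack, and there `hs` leaves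
    -- room for `δ`.
    split_ifs with hUc hUc' hUc'
    · linarith
    · linarith
    · have := hs c' hle hUc' c hc hUc o ho hE
      linarith
    · exact h1
  src c hc := by
    have := h.src c hc
    unfold red at *
    dsimp only
    rw [if_pos hq]
    split_ifs <;> linarith

/-! ### Augmentation -/

/-- A shortest augmenting path `q = cs 0, cs 1, …, cs k` in the graph of tight exchanges. -/
structure IsPath (D : Inst) (I : ℕ → ℕ) (lam : ℕ → ℝ) (k : ℕ) (cs os lev : ℕ → ℕ) : Prop where
  pos : 0 < k
  start : cs 0 = D.q
  cs_lt : ∀ i, 0 < i → i ≤ k → cs i < D.q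
  os_lt : ∀ i, 0 < i → i ≤ k → os i < D.p
  lev_cs : ∀ i ≤ k, lev (cs i) = i
  last : I (cs k) = 0
  tight : ∀ i < k, D.Tight I lam (cs i) (cs (i + 1)) (os (i + 1))
  short : ∀ i < k, ∀ j < k, D.Tight I lam (cs i) (cs (j + 1)) (os (j + 1)) → j ≤ i

/-- The selection after augmentation along a path. -/
def augmented (I : ℕ → ℕ) (k : ℕ) (cs os lev : ℕ → ℕ) (c : ℕ) : ℕ :=
  if 0 < lev c ∧ lev c ≤ k ∧ cs (lev c) = c then os (lev c) else I c

section Augment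

variable {k : ℕ} {cs os lev : ℕ → ℕ}

theorem IsPath.augmented_cs (hp : D.IsPath I lam k cs os lev) {i : ℕ} (h0 : 0 < i) (hi : i ≤ k) :
    augmented I k cs os lev (cs i) = os i := by
  unfold augmented
  rw [hp.lev_cs i hi, if_pos ⟨h0, hi, rfl⟩]

theorem IsPath.os_ne_zero (hp : D.IsPath I lam k cs os lev) (hD : D.WF) {i : ℕ} (h0 : 0 < i)
    (hi : i ≤ k) : os i ≠ 0 := by
  intro hz
  obtain ⟨j, rfl⟩ : ∃ j, i = j + 1 := ⟨i - 1, by omega⟩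
  have := (hp.tight j (by omega)).2.1
  rw [hz, hD.v_zero] at this
  exact this (zero_mem _)

theorem IsPath.augmented_q (hp : D.IsPath I lam k cs os lev) :
    augmented I k cs os lev D.q = I D.q := by
  unfold augmented
  rw [if_neg]
  rw [← hp.start, hp.lev_cs 0 (by omega)]
  omega

theorem IsPath.used (hp : D.IsPath I lam k cs os lev) {i : ℕ} (h0 : 0 < i) (hi : i < k) :
    I (cs i) ≠ 0 := by
  rcases (hp.tight i hi).1 with h | h
  · exact absurd h (hp.cs_lt i h0 hi.le).ne
  · exact h

theorem IsPath.isSel_augmented (hp : D.IsPath I lam k cs os lev) (hI : D.IsSel I) :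
    D.IsSel (augmented I k cs os lev) where
  lt c := by
    unfold augmented
    split_ifs with h
    · exact hp.os_lt _ h.1 h.2.1
    · exact hI.lt c
  zero c hc := by
    unfold augmented
    rw [if_neg]
    · exact hI.zero c hc
    · rintro ⟨h1, h2, h3⟩
      have := hp.cs_lt _ h1 h2
      omega

theorem IsPath.supp_augmented (hp : D.IsPath I lam k cs os lev) (hD : D.WF) :
    D.supp (augmented I k cs os lev) = insert (cs k) (D.supp I) := by
  ext c
  rw [Finset.mem_insert, mem_supp, mem_supp]
  constructor
  · rintro ⟨hc, h⟩
    unfold augmented at h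
    split_ifs at h with hc'
    · obtain ⟨h1, h2, h3⟩ := hc'
      rcases h2.lt_or_eq with h2 | h2
      · right
        refine ⟨hc, ?_⟩
        rw [← h3]
        exact hp.used h1 h2
      · left
        rw [← h2, h3]
    · exact Or.inr ⟨hc, h⟩
  · rintro (rfl | ⟨hc, h⟩)
    · refine ⟨hp.cs_lt k hp.pos le_rfl, ?_⟩
      rw [hp.augmented_cs hp.pos le_rfl]
      exact hp.os_ne_zero hD hp.pos le_rfl
    · refine ⟨hc, ?_⟩
      unfold augmented
      split_ifs with hc'
      · exact hp.os_ne_zero hD hc'.1 hc'.2.1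
      · exact h

/-- The exchange along the path, seen from the old classes. -/
theorem IsPath.exchange (hp : D.IsPath I lam k cs os lev) (hD : D.WF) (h : D.Inv I lam) (t : ℝ) :
    let B := (D.supp I).filter fun y => t ≤ D.red lam y (I y)
    let z := fun c => if lev c < k ∧ cs (lev c) = c then D.vect (cs (lev c + 1)) (os (lev c + 1))
      else D.cur I c
    LinearIndepOn ℝ z (B : Set ℕ) ∧ span ℝ (z '' B) = span ℝ (D.cur I '' B) := by
  classical
  intro B z
  have hBs : B ⊆ D.supp I := Finset.filter_subset _ _
  set S := B.filter fun c => lev c < k ∧ cs (lev c) = c with hS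
  have hSp : ∀ c ∈ S, ∃ i, 0 < i ∧ i < k ∧ c = cs i := by
    intro c hc
    obtain ⟨hcB, h1, h2⟩ := Finset.mem_filter.1 hc
    refine ⟨lev c, ?_, h1, h2.symm⟩
    by_contra h0
    rw [show lev c = 0 by omega, hp.start] at h2
    have := (mem_supp.1 (hBs hcB)).1
    omega
  -- After the first arc, every new vector lies in the old span. Otherwise the arc from the source
  -- to it would be tight by `slack` and `src`, and would shorten the path.
  have hxq : ∀ i, 0 < i → i < k → D.vect (cs (i + 1)) (os (i + 1)) ∈ D.spanExc I D.q := by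
    intro i h0 hi
    by_contra hcon
    have ht := hp.tight i hi
    have h1 := h.slack D.q (Or.inl rfl) _ (hp.cs_lt (i + 1) (by omega) hi) _
      (hp.os_lt (i + 1) (by omega) hi) hcon
    have h2 := h.src _ (hp.used h0 hi)
    have := hp.short 0 hp.pos i hi (by
      rw [hp.start]
      exact ⟨Or.inl rfl, hcon, le_antisymm h1 (h2.trans ht.2.2.ge)⟩)
    omega
  -- Classes of smaller reduced weight than `cs i` drop out of the expansion of the new vector,
  -- because its reduced weight equals that of `cs i`. Hence level sets can be treated one at a
  -- time.
  have hxB : ∀ i, 0 < i → i < k → ∀ B' ⊆ D.supp I, (∀ y ∈ D.supp I, y ∉ B' →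
      D.red lam y (I y) < D.red lam (cs i) (I (cs i)) ∨
        D.vect (cs (i + 1)) (os (i + 1)) ∈ D.spanExc I y) →
      D.vect (cs (i + 1)) (os (i + 1)) ∈ span ℝ (D.cur I '' B') := by
    intro i h0 hi B' hB' hy
    refine h.indep.mem_span hD hB' (hxq i h0 hi) fun y hys hyB => ?_
    by_contra hcon
    rcases hy y hys hyB with h1 | h1
    · have := h.slack y (Or.inr (mem_supp.1 hys).2) _ (hp.cs_lt (i + 1) (by omega) hi) _
        (hp.os_lt (i + 1) (by omega) hi) hcon
      rw [(hp.tight i hi).2.2] at this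
      linarith
    · exact hcon h1
  have key := LinearIndepOn.exchange (u := D.cur I) (B := B) S
    (fun c => D.vect (cs (lev c + 1)) (os (lev c + 1)))
    -- If the new vector for `c'` needs the old vector of `c`, then `slack` orders the reduced
    -- weights. If these are equal, the exchange is tight, and `short` orders the levels. So the
    -- lexicographic key decreases.
    (fun c => toLex (D.red lam c (I c), lev c)) (Finset.filter_subset _ _)
    (h.indep.mono (by exact_mod_cast hBs)) ?_ ?_ ?_
  · have hz : (fun c => if c ∈ S then D.vect (cs (lev c + 1)) (os (lev c + 1)) else D.cur I c) =
        fun c => if c ∈ B then z c else D.cur I c := by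
      funext c
      by_cases hcB : c ∈ B <;> simp [hS, hcB, z]
    rw [hz] at key
    have he : Set.EqOn (fun c => if c ∈ B then z c else D.cur I c) z B := fun c hc =>
      if_pos (by exact_mod_cast hc)
    rw [Set.image_congr he] at key
    exact ⟨key.1.congr he, key.2⟩
  · intro c hc
    obtain ⟨i, h0, hi, rfl⟩ := hSp c hc
    rw [hp.lev_cs i hi.le]
    refine hxB i h0 hi B hBs fun y hys hyB => Or.inl ?_
    have hcB := (Finset.mem_filter.1 (Finset.mem_filter.1 hc).1).2
    have : ¬ t ≤ D.red lam y (I y) := fun hle => hyB (Finset.mem_filter.2 ⟨hys, hle⟩)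
    linarith
  · intro c hc hcon
    obtain ⟨i, h0, hi, rfl⟩ := hSp c hc
    rw [hp.lev_cs i hi.le] at hcon
    refine (hp.tight i hi).2.1 ?_
    rw [spanExc_eq hD]
    exact span_mono (Set.image_mono (Set.sdiff_subset_sdiff_left (by exact_mod_cast hBs))) hcon
  · intro c hc c' hc' hne hcon
    have hcB := (Finset.mem_filter.1 hc).1
    have hcB' := (Finset.mem_filter.1 (Finset.mem_filter.1 hc').1).2
    obtain ⟨i, h0, hi, rfl⟩ := hSp c hc
    obtain ⟨j, h0', hj, rfl⟩ := hSp c' hc'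
    rw [hp.lev_cs j hj.le] at hcon
    rw [Prod.Lex.toLex_lt_toLex, hp.lev_cs i hi.le, hp.lev_cs j hj.le]
    have hnot : ¬ (D.red lam (cs i) (I (cs i)) < D.red lam (cs j) (I (cs j)) ∨
        D.vect (cs (j + 1)) (os (j + 1)) ∈ D.spanExc I (cs i)) := by
      intro hor
      apply hcon
      rw [← Finset.coe_singleton, ← Finset.coe_sdiff]
      refine hxB j h0' hj (B \ {cs i}) (Finset.sdiff_subset.trans hBs) fun y hys hyB => ?_
      by_cases hyi : y = cs i
      · rwa [hyi]
      · left
        have hy' : y ∉ B := fun hy => hyB (Finset.mem_sdiff.2 ⟨hy, by simpa using hyi⟩)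
        have : ¬ t ≤ D.red lam y (I y) := fun hle => hy' (Finset.mem_filter.2 ⟨hys, hle⟩)
        linarith
    push Not at hnot
    rcases hnot.1.lt_or_eq with hlt | heq
    · exact Or.inl hlt
    · refine Or.inr ⟨heq, ?_⟩
      have := hp.short i hi j hj ⟨Or.inr (hp.used h0 hi), hnot.2, (hp.tight j hj).2.2.trans heq⟩
      refine lt_of_le_of_ne this fun hij => hne ?_
      rw [show j = i from hij]

/-- The map `τ` shifts the source and each class of the path, except the last, to its successor.
Tightness says that `τ` preserves reduced weights, and `IsPath.exchange` says that the new vectors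
indexed by an old level set have the old span. Every condition of the certificate refers only to
reduced weights and these spans, and so carries over. -/
theorem IsPath.inv_augmented (hp : D.IsPath I lam k cs os lev) (hD : D.WF) (h : D.Inv I lam) :
    D.Inv (augmented I k cs os lev) lam := by
  classical
  set I' := augmented I k cs os lev with hI'
  set z : ℕ → Fin D.d → ℝ := fun c => if lev c < k ∧ cs (lev c) = c then
    D.vect (cs (lev c + 1)) (os (lev c + 1)) else D.cur I c with hz
  set τ : ℕ → ℕ := fun c => if lev c < k ∧ cs (lev c) = c then cs (lev c + 1) else c with hτ
  have hsel := hp.isSel_augmented h.sel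
  have hsupp := hp.supp_augmented hD
  rw [← hI'] at hsel hsupp
  -- off the path nothing changes
  have hoff : ∀ c ∈ insert D.q (D.supp I), ¬ (lev c < k ∧ cs (lev c) = c) → I' c = I c := by
    intro c hc hn
    rw [hI', augmented, if_neg]
    rintro ⟨h1, h2, h3⟩
    rcases h2.lt_or_eq with h2 | h2
    · exact hn ⟨h2, h3⟩
    · rcases Finset.mem_insert.1 hc with rfl | hc
      · have := hp.cs_lt _ h1 h2.le
        omega
      · refine (mem_supp.1 hc).2 ?_
        rw [← h3, h2]
        exact hp.last
  have hzτ : ∀ c ∈ insert D.q (D.supp I), z c = D.cur I' (τ c) := by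
    intro c hc
    simp only [hz, hτ]
    split_ifs with hcon
    · rw [cur, hI', hp.augmented_cs (by omega) (by omega)]
    · rw [cur, cur, hoff c hc hcon]
  have hred : ∀ c ∈ insert D.q (D.supp I),
      D.red lam (τ c) (I' (τ c)) = D.red lam c (I c) := by
    intro c hc
    simp only [hτ]
    split_ifs with hcon
    · rw [hI', hp.augmented_cs (by omega) (by omega), (hp.tight _ hcon.1).2.2, hcon.2]
    · rw [hoff c hc hcon]
  have hsurj : ∀ c ∈ D.supp I', ∃ y ∈ insert D.q (D.supp I), τ y = c := by
    intro c hc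
    by_cases hcp : 0 < lev c ∧ lev c ≤ k ∧ cs (lev c) = c
    · obtain ⟨h1, h2, h3⟩ := hcp
      refine ⟨cs (lev c - 1), ?_, ?_⟩
      · rcases Nat.eq_zero_or_pos (lev c - 1) with h0 | h0
        · rw [h0, hp.start]; simp
        · exact Finset.mem_insert_of_mem (mem_supp.2 ⟨hp.cs_lt _ h0 (by omega),
            hp.used h0 (by omega)⟩)
      · simp only [hτ]
        rw [hp.lev_cs (lev c - 1) (by omega), if_pos ⟨by omega, rfl⟩,
          Nat.sub_add_cancel h1, h3]
    · refine ⟨c, ?_, ?_⟩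
      · rw [hsupp, Finset.mem_insert] at hc
        rcases hc with rfl | hc
        · exact absurd ⟨by rw [hp.lev_cs k le_rfl]; exact hp.pos, (hp.lev_cs k le_rfl).le,
            by rw [hp.lev_cs k le_rfl]⟩ hcp
        · exact Finset.mem_insert_of_mem hc
      · simp only [hτ]
        rw [if_neg]
        rintro ⟨h1, h2⟩
        rcases Nat.eq_zero_or_pos (lev c) with h0 | h0
        · rw [h0, hp.start] at h2
          have := (mem_supp.1 hc).1
          omega
        · exact hcp ⟨h0, h1.le, h2⟩
  have hinto : ∀ c ∈ insert D.q (D.supp I), τ c ∈ D.supp I' := by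
    intro c hc
    simp only [hτ]
    split_ifs with hcon
    · refine mem_supp.2 ⟨hp.cs_lt _ (by omega) (by omega), ?_⟩
      rw [hI', hp.augmented_cs (by omega) (by omega)]
      exact hp.os_ne_zero hD (by omega) (by omega)
    · rcases Finset.mem_insert.1 hc with rfl | hc
      · exact absurd (by rw [← hp.start, hp.lev_cs 0 (by omega)]; exact ⟨hp.pos, rfl⟩) hcon
      · rw [hsupp]
        exact Finset.mem_insert_of_mem hc
  have hsubq : ∀ c ∈ D.supp I, c ∈ insert D.q (D.supp I) := fun c hc =>
    Finset.mem_insert_of_mem hc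
  -- the level sets keep their spans
  have hlevel : ∀ t : ℝ, LinearIndepOn ℝ z
      ((D.supp I).filter fun y => t ≤ D.red lam y (I y) : Finset ℕ) ∧
      span ℝ (z '' ((D.supp I).filter fun y => t ≤ D.red lam y (I y) : Finset ℕ)) =
        span ℝ (D.cur I '' ((D.supp I).filter fun y => t ≤ D.red lam y (I y) : Finset ℕ)) :=
    fun t => hp.exchange hD h t
  have hall : ((D.supp I).filter fun y => D.red lam D.q (I D.q) ≤ D.red lam y (I y)) =
      D.supp I := Finset.filter_true_of_mem fun y hy => h.src y (mem_supp.1 hy).2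
  have htop := hlevel (D.red lam D.q (I D.q))
  rw [hall] at htop
  have hqI' : I' D.q = I D.q := hp.augmented_q
  have hzq : z D.q = D.vect (cs 1) (os 1) := by
    simp only [hz]
    rw [← hp.start, hp.lev_cs 0 (by omega), if_pos ⟨hp.pos, rfl⟩]
  have hspan_le : ∀ B ⊆ D.supp I, ∀ c', (∀ y ∈ B, τ y ≠ c') →
      span ℝ (z '' (B : Set ℕ)) ≤ D.spanExc I' c' := by
    intro B hB c' hne
    rw [spanExc, span_le]
    rintro _ ⟨y, hy, rfl⟩
    have hy' := hsubq y (hB hy)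
    rw [hzτ y hy']
    exact subset_span ⟨τ y, ⟨(mem_supp.1 (hinto y hy')).1, hne y hy⟩, rfl⟩
  refine ⟨hsel, ?_, h.nonneg, ?_, ?_, ?_⟩
  · have hins : LinearIndepOn ℝ z (insert D.q (D.supp I : Set ℕ)) := by
      rw [linearIndepOn_insert (by simp [mem_supp])]
      refine ⟨htop.1, ?_⟩
      rw [htop.2, ← spanExc_q hD, hzq]
      have := (hp.tight 0 hp.pos).2.1
      rwa [hp.start] at this
    have hcomp : LinearIndepOn ℝ (D.cur I' ∘ τ) (insert D.q (D.supp I : Set ℕ)) :=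
      hins.congr fun c hc => hzτ c (by simpa using hc)
    refine (LinearIndepOn.image_of_comp τ _ hcomp).mono fun c hc => ?_
    obtain ⟨y, hy, rfl⟩ := hsurj c hc
    exact ⟨y, by simpa using hy, rfl⟩
  · intro c hc h0
    refine h.zero c hc ?_
    by_contra hne
    have : c ∈ D.supp I' := by rw [hsupp]; exact Finset.mem_insert_of_mem (mem_supp.2 ⟨hc, hne⟩)
    exact (mem_supp.1 this).2 h0
  · intro c' hc' c hc o ho hE
    have hcq : D.spanExc I D.q ≤ D.spanExc I' D.q := by
      rw [spanExc_q hD, ← htop.2]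
      exact hspan_le _ subset_rfl _ fun y hy heq => by
        have := (mem_supp.1 (hinto y (hsubq y hy))).1
        omega
    rcases hc' with rfl | hc'
    · rw [hqI']
      exact h.slack D.q (Or.inl rfl) c hc o ho fun hm => hE (hcq hm)
    · obtain ⟨y, hy, rfl⟩ := hsurj c' (mem_supp.2 ⟨hsel.lt_q hc', hc'⟩)
      rw [hred y hy]
      -- If `(c, o)` had larger reduced weight than the class `τ y` to be given up, its vector would
      -- lie in the span of the level set at its own reduced weight. That level set has the same
      -- span after the exchange and does not contain `y`, so `τ y` is not needed.
      by_contra hlt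
      push Not at hlt
      have hge : D.red lam D.q (I D.q) ≤ D.red lam y (I y) := by
        rcases Finset.mem_insert.1 hy with rfl | hy
        · exact le_rfl
        · exact h.src y (mem_supp.1 hy).2
      have hm := h.mem_level hD hc ho (h.mem_spanExc_q hc ho (hge.trans_lt hlt))
      rw [← (hlevel (D.red lam c o)).2] at hm
      refine hE (hspan_le _ (Finset.filter_subset _ _) _ (fun x hx heq => ?_) hm)
      obtain ⟨hx1, hx2⟩ := Finset.mem_filter.1 hx
      have h1 := hred x (hsubq x hx1)
      rw [heq, hred y hy] at h1
      linarith
  · intro c hc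
    obtain ⟨y, hy, rfl⟩ := hsurj c (mem_supp.2 ⟨hsel.lt_q hc, hc⟩)
    rw [hred y hy, hqI']
    rcases Finset.mem_insert.1 hy with rfl | hy
    · exact le_rfl
    · exact h.src y (mem_supp.1 hy).2

end Augment

end Inst

end RealWhile

/-! ### The primal-dual algorithm -/

namespace RealWhile

open Submodule

namespace Inst

variable {D : Inst} {I : ℕ → ℕ} {lam : ℕ → ℝ}

theorem reach_mono {k l : ℕ} (hkl : k ≤ l) {c : ℕ} (h : D.Reach I lam k c) : D.Reach I lam l c := by
  induction l, hkl using Nat.le_induction with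
  | base => exact h
  | succ l _ ih => exact Or.inl ih

theorem reach_q (k : ℕ) : D.Reach I lam k D.q := reach_mono (Nat.zero_le k) rfl

/-- After `q + 1` rounds nothing new is reached. -/
theorem reach_stable {c : ℕ} (hc : c < D.q + 1) (h : D.Reach I lam (D.q + 2) c) :
    D.Reach I lam (D.q + 1) c := by
  classical
  set R : ℕ → Finset ℕ := fun m => (Finset.range (D.q + 1)).filter fun c => D.Reach I lam m c with hR
  have hmono : ∀ {m l}, m ≤ l → R m ⊆ R l := fun hml =>
    Finset.monotone_filter_right _ fun c _ hc => reach_mono hml hc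
  have hmem : ∀ {m c}, c ∈ R m ↔ c < D.q + 1 ∧ D.Reach I lam m c := by simp [hR]
  have hst := Nat.stabilises_of_monotone (f := fun m => (R m).card) (b := D.q + 1) (n := D.q + 2)
    (fun m l hml => Finset.card_le_card (hmono hml))
    (fun m => by simpa using Finset.card_filter_le (Finset.range (D.q + 1)) _)
    (fun m hm => by
      have heq : R m = R (m + 1) := Finset.eq_of_subset_of_card_le (hmono (by omega)) hm.ge
      refine congrArg Finset.card (subset_antisymm (hmono (by omega)) fun x hx => ?_)
      obtain ⟨hx1, hx2⟩ := hmem.1 hx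
      refine hmem.2 ⟨hx1, ?_⟩
      rcases hx2 with hx2 | ⟨c', hc', o, ho, h1, h2⟩
      · exact hx2
      · have : c' ∈ R m := by rw [heq]; exact hmem.2 ⟨hc', h1⟩
        exact Or.inr ⟨c', hc', o, ho, (hmem.1 this).2, h2⟩) (by omega)
  have heq : R (D.q + 1) = R (D.q + 2) :=
    Finset.eq_of_subset_of_card_le (hmono (by omega)) hst.le
  have : c ∈ R (D.q + 1) := by rw [heq]; exact hmem.2 ⟨hc, h⟩
  exact (hmem.1 this).2

theorem reach_of_tight {c' c o : ℕ} (hc' : c' < D.q + 1) (hc : c < D.q + 1) (ho : o < D.p)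
    (h : D.Reach I lam (D.q + 1) c') (ht : D.Tight I lam c' c o) : D.Reach I lam (D.q + 1) c :=
  reach_stable hc (Or.inr ⟨c', hc', o, ho, h, ht⟩)

variable (D I lam)

/-- The predecessor of class `c` on a path from the source, and the option chosen in `c`. -/
noncomputable def predC (k c : ℕ) : ℕ :=
  sel (fun c' => D.Reach I lam k c' ∧ ∃ o < D.p, D.Tight I lam c' c o) (D.q + 1)

noncomputable def predO (k c : ℕ) : ℕ :=
  sel (fun o => D.Tight I lam (D.predC I lam k c) c o) D.p

open Classical in
/-- One step backwards on a shortest path, from the `k + 1`-st level. -/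
noncomputable def back (k : ℕ) (x : ℕ × (ℕ → ℕ)) : ℕ × (ℕ → ℕ) :=
  if D.Reach I lam k x.1 then x
  else (D.predC I lam k x.1, Function.update x.2 x.1 (D.predO I lam k x.1))

/-- All steps backwards from level `K` down to level `K - t`. -/
noncomputable def trace (K : ℕ) (x : ℕ × (ℕ → ℕ)) : ℕ → ℕ × (ℕ → ℕ)
  | 0 => x
  | t + 1 => D.back I lam (K - 1 - t) (trace K x t)

/-- An unreached class gets level `sInf ∅ = 0`. This is harmless, because `augmented` requires a
positive level and checks that the path passes through the class. -/
noncomputable def level (c : ℕ) : ℕ := sInf {k | D.Reach I lam k c}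

variable {D I lam}

theorem reach_level {k c : ℕ} (h : D.Reach I lam k c) : D.Reach I lam (D.level I lam c) c :=
  Nat.sInf_mem (s := {k | D.Reach I lam k c}) ⟨k, h⟩

theorem level_le {k c : ℕ} (h : D.Reach I lam k c) : D.level I lam c ≤ k := Nat.sInf_le h

theorem level_q : D.level I lam D.q = 0 := Nat.le_zero.1 (level_le (k := 0) rfl)

theorem predC_spec {k c : ℕ} (h : D.Reach I lam (k + 1) c) (hn : ¬ D.Reach I lam k c) :
    D.predC I lam k c < D.q + 1 ∧ D.predO I lam k c < D.p ∧
      D.Reach I lam k (D.predC I lam k c) ∧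
      D.Tight I lam (D.predC I lam k c) c (D.predO I lam k c) := by
  have h1 : ∃ c' < D.q + 1, D.Reach I lam k c' ∧ ∃ o < D.p, D.Tight I lam c' c o := by
    rcases h with h | ⟨c', hc', o, ho, h1, h2⟩
    · exact absurd h hn
    · exact ⟨c', hc', h1, o, ho, h2⟩
  have hlt := sel_lt h1
  have hs := sel_spec hlt
  have hlt' := sel_lt hs.2
  exact ⟨hlt, hlt', hs.1, sel_spec hlt'⟩

/-- The first backward step is split off, so that induction on `K` can vary the starting class and
the selection. -/
theorem trace_shift (K : ℕ) (x : ℕ × (ℕ → ℕ)) (t : ℕ) :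
    D.trace I lam (K + 1) x (t + 1) = D.trace I lam K (D.back I lam K x) t := by
  induction t with
  | zero => simp [trace]
  | succ t ih =>
    rw [trace, ih, trace]
    congr 1
    omega

/-- Tracing back from a reached class yields a shortest path. -/
theorem exists_trace (K c : ℕ) (J : ℕ → ℕ) (h : D.Reach I lam K c) :
    ∃ cs os : ℕ → ℕ, cs 0 = D.q ∧ cs (D.level I lam c) = c ∧
      (∀ i ≤ D.level I lam c, D.level I lam (cs i) = i ∧ D.Reach I lam i (cs i)) ∧
      (∀ i < D.level I lam c, cs i < D.q + 1) ∧
      (∀ i, 0 < i → i ≤ D.level I lam c → os i < D.p) ∧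
      (∀ i < D.level I lam c, D.Tight I lam (cs i) (cs (i + 1)) (os (i + 1))) ∧
      (D.trace I lam K (c, J) K).2 = augmented J (D.level I lam c) cs os (D.level I lam) := by
  induction K generalizing c J with
  | zero =>
    obtain rfl : c = D.q := h
    refine ⟨fun _ => D.q, fun _ => 0, rfl, rfl, ?_⟩
    rw [level_q]
    refine ⟨fun i hi => ?_, by omega, by omega, by omega, ?_⟩
    · rw [Nat.le_zero.1 hi]
      exact ⟨level_q, rfl⟩
    · funext x
      rw [trace, augmented, if_neg (by omega)]
  | succ K ih =>
    rw [trace_shift]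
    by_cases hK : D.Reach I lam K c
    · rw [back, if_pos hK]
      exact ih c J hK
    · rw [back, if_neg hK]
      obtain ⟨h1, h2, h3, h4⟩ := predC_spec h hK
      dsimp only
      set c' := D.predC I lam K c
      set o := D.predO I lam K c
      have hlc : D.level I lam c = K + 1 := by
        refine le_antisymm (level_le h) ?_
        by_contra hlt
        exact hK (reach_mono (by omega) (reach_level h))
      -- Had the predecessor been reached before round `K`, then `c` would have been reached by
      -- round `K`.
      have hlc' : D.level I lam c' = K := by
        refine le_antisymm (level_le h3) ?_
        by_contra hlt
        exact hK (reach_mono (k := D.level I lam c' + 1) (by omega)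
          (Or.inr ⟨c', h1, o, h2, reach_level h3, h4⟩))
      obtain ⟨cs, os, e1, e2, e3, e4, e5, e6, e7⟩ := ih c' (Function.update J c o) h3
      rw [hlc'] at e2 e3 e4 e5 e6 e7
      rw [hlc]
      refine ⟨fun i => if i ≤ K then cs i else c, fun i => if i ≤ K then os i else o, ?_, ?_, ?_,
        ?_, ?_, ?_, ?_⟩
      · simp [e1]
      · simp
      · intro i hi
        dsimp only
        split_ifs with hiK
        · exact e3 i hiK
        · obtain rfl : i = K + 1 := by omega
          exact ⟨hlc, h⟩
      · intro i hi
        dsimp only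
        rw [if_pos (by omega)]
        rcases (show i < K ∨ i = K by omega) with hi | rfl
        · exact e4 i hi
        · rwa [e2]
      · intro i h0 hi
        dsimp only
        split_ifs with hiK
        · exact e5 i h0 hiK
        · exact h2
      · intro i hi
        dsimp only
        rw [if_pos (show i ≤ K by omega)]
        rcases (show i < K ∨ i = K by omega) with hi | rfl
        · rw [if_pos (by omega), if_pos (by omega)]
          exact e6 i hi
        · rw [if_neg (by omega), if_neg (by omega), e2]
          exact h4
      · rw [e7]
        funext x
        unfold augmented
        by_cases hx : x = c
        · subst hx
          rw [hlc, if_neg (by omega), if_pos (by simp)]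
          simp
        · rw [Function.update_of_ne hx]
          by_cases hlx : D.level I lam x ≤ K
          · simp [hlx, show D.level I lam x ≤ K + 1 by omega]
          · rw [if_neg (by omega), if_neg]
            rintro ⟨_, _, h⟩
            dsimp only at h
            rw [if_neg hlx] at h
            exact hx h.symm

/-- The `i`-th class of the traced path has level `i`. A tight arc from `cs i` to `cs (j + 1)`
bounds the level of the latter by `i + 1`, so no arc skips ahead. The source cannot recur, since its
level is `0`. -/
theorem exists_isPath {c : ℕ} (hc : c < D.q) (h : D.Reach I lam (D.q + 1) c) (h0 : I c = 0) :
    ∃ (k : ℕ) (cs os : ℕ → ℕ), D.IsPath I lam k cs os (D.level I lam) ∧ cs k = c ∧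
      (D.trace I lam (D.q + 1) (c, I) (D.q + 1)).2 = augmented I k cs os (D.level I lam) := by
  obtain ⟨cs, os, e1, e2, e3, e4, e5, e6, e7⟩ := exists_trace (D.q + 1) c I h
  have hne : ∀ i, 0 < i → i ≤ D.level I lam c → cs i ≠ D.q := by
    intro i hi hle heq
    have := (e3 i hle).1
    rw [heq, level_q] at this
    omega
  refine ⟨D.level I lam c, cs, os, ⟨?_, e1, ?_, e5, fun i hi => (e3 i hi).1, by rw [e2, h0], e6, ?_⟩,
    e2, e7⟩
  · by_contra hl
    rw [show D.level I lam c = 0 by omega, e1] at e2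
    omega
  · intro i hi hle
    rcases hle.lt_or_eq with hlt | rfl
    · have := e4 i hlt
      have := hne i hi hle
      omega
    · rwa [e2]
  · intro i hi j hj ht
    have := level_le (k := i + 1) (Or.inr ⟨cs i, e4 i hi, os (j + 1), e5 _ (by omega) hj,
      (e3 i hi.le).2, ht⟩)
    rw [(e3 (j + 1) hj).1] at this
    omega

/-- Independent selections can be enlarged class by class. -/
theorem exists_augment (hD : D.WF) {J : ℕ → ℕ} (hI : D.IsSel I) (hIi : D.Indep I) (hJ : D.IsSel J)
    (hJi : D.Indep J) (hlt : (D.supp I).card < (D.supp J).card) :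
    ∃ I' c, D.IsSel I' ∧ D.Indep I' ∧ c ∉ D.supp I ∧ D.supp I' = insert c (D.supp I) := by
  -- With all weights and prices zero, the inequalities of the certificate are trivial and every
  -- possible exchange is tight, so the weighted theory yields plain augmentation.
  set D' : Inst := { D with w := fun _ _ => 0 } with hD'
  have hW : D'.WF := ⟨hD.v_zero, fun _ => rfl, hD.p_pos⟩
  have hinv : D'.Inv I fun _ => 0 := by
    refine ⟨⟨hI.lt, hI.zero⟩, hIi, fun _ _ => le_rfl, fun _ _ _ => rfl, ?_, ?_⟩ <;>
      intros <;> simp [red, hD']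
  by_cases hex : ∃ c < D'.q, D'.Reach I (fun _ => 0) (D'.q + 1) c ∧ I c = 0
  · obtain ⟨c, hc, hr, h0⟩ := hex
    obtain ⟨k, cs, os, hp, hk, -⟩ := exists_isPath hc hr h0
    have := hp.inv_augmented hW hinv
    refine ⟨_, c, ⟨this.sel.lt, this.sel.zero⟩, this.indep, ?_, ?_⟩
    · simp [mem_supp, h0]
    · rw [← hk]
      exact hp.supp_augmented hW
  -- If only used classes are reached, they absorb all exchanges, and `J` could not be larger.
  · push Not at hex
    have := Indep.card_le (D := D') hIi hW (U := D'.Reach I (fun _ => 0) (D'.q + 1)) (reach_q _)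
      hex (fun c' hc' hU c hc hcU o ho => by
        by_contra hcon
        refine hcU (reach_of_tight (by omega) (by omega) ho hU ⟨?_, hcon, by simp [red, hD']⟩)
        rcases hc'.lt_or_eq with h | h
        · exact Or.inr (hex c' h hU)
        · exact Or.inl h) ⟨hJ.lt, hJ.zero⟩ hJi
    exact absurd this (not_le.2 hlt)

/-! The main loop. -/

variable (D I lam)

/-- The exchanges that leave the set of reached classes. -/
def Cand (c' c o : ℕ) : Prop :=
  D.Reach I lam (D.q + 1) c' ∧ ¬ D.Reach I lam (D.q + 1) c ∧ D.vect c o ∉ D.spanExc I c'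

def gap (c' c o : ℕ) : ℝ := D.red lam c' (I c') - D.red lam c o

def Best (c' c o : ℕ) : Prop :=
  D.Cand I lam c' c o ∧ ∀ c₁' < D.q + 1, ∀ c₁ < D.q, ∀ o₁ < D.p, D.Cand I lam c₁' c₁ o₁ →
    D.gap I lam c' c o ≤ D.gap I lam c₁' c₁ o₁

noncomputable def bestS : ℕ := sel (fun c' => ∃ c < D.q, ∃ o < D.p, D.Best I lam c' c o) (D.q + 1)

noncomputable def bestC : ℕ := sel (fun c => ∃ o < D.p, D.Best I lam (D.bestS I lam) c o) D.q

noncomputable def bestO : ℕ := sel (fun o => D.Best I lam (D.bestS I lam) (D.bestC I lam) o) D.p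

noncomputable def minGap : ℝ := D.gap I lam (D.bestS I lam) (D.bestC I lam) (D.bestO I lam)

/-- The first reached class from which nothing is selected. -/
noncomputable def target : ℕ := sel (fun c => D.Reach I lam (D.q + 1) c ∧ I c = 0) D.q

noncomputable def augmentI : ℕ → ℕ :=
  (D.trace I lam (D.q + 1) (D.target I lam, I) (D.q + 1)).2

open Classical in
noncomputable def raised (c : ℕ) : ℝ :=
  if D.Reach I lam (D.q + 1) c then lam c + D.minGap I lam else lam c

open Classical in
/-- One step of the algorithm: augment, or else raise prices, if possible. -/
noncomputable def step (s : ℕ) (x : (ℕ → ℕ) × (ℕ → ℝ)) : (ℕ → ℕ) × (ℕ → ℝ) :=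
  if (D.supp x.1).card = s then x
  else if ∃ c < D.q, D.Reach x.1 x.2 (D.q + 1) c ∧ x.1 c = 0 then (D.augmentI x.1 x.2, x.2)
  else if ∃ c' < D.q + 1, ∃ c < D.q, ∃ o < D.p, D.Cand x.1 x.2 c' c o then
    (x.1, D.raised x.1 x.2)
  else x

/-- The source gets a price so low that its reduced weight, the sum of all `w ^ 2 + 1`, is at least
every weight. This gives `slack` for the empty selection using only arithmetic on the data. -/
noncomputable def start : (ℕ → ℕ) × (ℕ → ℝ) :=
  (fun _ => 0, fun c => if c = D.q then
    0 - ∑ c ∈ Finset.range D.q, ∑ o ∈ Finset.range D.p, (D.w c o * D.w c o + 1) else 0)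

noncomputable def run (s : ℕ) : ℕ → (ℕ → ℕ) × (ℕ → ℝ)
  | 0 => D.start
  | t + 1 => D.step s (run s t)

/-- The number of rounds is the bound on the potential from `progress_lt`; rounds after termination
change nothing. -/
noncomputable def solve (s : ℕ) : ℕ → ℕ := (D.run s ((D.q + 2) * (D.q + 2))).1

-- A lexicographic potential: the size of the selection, then the number of reached classes
-- including the source, which is at most `q + 1`. A gain of one in size thus outweighs the loss of
-- all reached classes.
open Classical in
noncomputable def progress (x : (ℕ → ℕ) × (ℕ → ℝ)) : ℕ :=
  (D.supp x.1).card * (D.q + 2) +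
    ((Finset.range (D.q + 1)).filter fun c => D.Reach x.1 x.2 (D.q + 1) c).card

variable {D I lam}

theorem exists_best (h : ∃ c' < D.q + 1, ∃ c < D.q, ∃ o < D.p, D.Cand I lam c' c o) :
    D.bestS I lam < D.q + 1 ∧ D.bestC I lam < D.q ∧ D.bestO I lam < D.p ∧
      D.Best I lam (D.bestS I lam) (D.bestC I lam) (D.bestO I lam) := by
  classical
  have hex : ∃ c' < D.q + 1, ∃ c < D.q, ∃ o < D.p, D.Best I lam c' c o := by
    set S := (Finset.range (D.q + 1) ×ˢ (Finset.range D.q ×ˢ Finset.range D.p)).filter fun x =>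
      D.Cand I lam x.1 x.2.1 x.2.2 with hS
    obtain ⟨x, hx, hmin⟩ := S.exists_min_image (fun x => D.gap I lam x.1 x.2.1 x.2.2) (by
      obtain ⟨c', hc', c, hc, o, ho, hca⟩ := h
      exact ⟨(c', c, o), by simp [hS, hc', hc, ho, hca]⟩)
    simp only [hS, Finset.mem_filter, Finset.mem_product, Finset.mem_range, Prod.forall] at hx hmin
    exact ⟨x.1, hx.1.1, x.2.1, hx.1.2.1, x.2.2, hx.1.2.2, hx.2, fun c₁' h1 c₁ h2 o₁ h3 h4 =>
      hmin c₁' c₁ o₁ ⟨⟨h1, h2, h3⟩, h4⟩⟩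
  have h1 := sel_lt hex
  have h2 := sel_spec h1
  have h3 := sel_lt h2
  have h4 := sel_spec h3
  have h5 := sel_lt h4
  exact ⟨h1, h3, h5, sel_spec h5⟩

theorem inv_start (hD : D.WF) : D.Inv D.start.1 D.start.2 := by
  have hs : D.supp (fun _ => 0) = ∅ := by simp [supp]
  refine ⟨⟨fun _ => hD.p_pos, fun _ _ => rfl⟩, ?_, ?_, ?_, ?_, ?_⟩
  · change LinearIndepOn ℝ _ (D.supp (fun _ => 0) : Set ℕ)
    rw [hs]
    simp
  · intro c hc
    simp [start, hc.ne]
  · intro c hc _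
    simp [start, hc.ne]
  · rintro c' (rfl | h) c hc o ho _
    · have h1 : D.w c o * D.w c o + 1 ≤
          ∑ c ∈ Finset.range D.q, ∑ o ∈ Finset.range D.p, (D.w c o * D.w c o + 1) := by
        have hn : ∀ a b, 0 ≤ D.w a b * D.w a b + 1 := fun a b =>
          add_nonneg (mul_self_nonneg _) zero_le_one
        refine le_trans ?_ (Finset.single_le_sum (f := fun c => ∑ o ∈ Finset.range D.p,
          (D.w c o * D.w c o + 1)) (fun a _ => Finset.sum_nonneg fun b _ => hn a b)
            (Finset.mem_range.2 hc))
        exact Finset.single_le_sum (f := fun o => D.w c o * D.w c o + 1) (fun b _ => hn c b)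
          (Finset.mem_range.2 ho)
      simp only [red, start, if_pos, hc.ne, if_false, hD.w_zero]
      nlinarith [sq_nonneg (D.w c o - 1)]
    · exact absurd rfl h
  · intro c h
    exact absurd rfl h

/-- A step keeps the certificate and makes progress, unless the target size is reached or there is
no larger independent selection. -/
theorem step_spec (hD : D.WF) (s : ℕ) {x : (ℕ → ℕ) × (ℕ → ℝ)} (h : D.Inv x.1 x.2)
    (hs : (D.supp x.1).card ≤ s) :
    D.Inv (D.step s x).1 (D.step s x).2 ∧ (D.supp (D.step s x).1).card ≤ s ∧
      (D.progress x < D.progress (D.step s x) ∨ D.step s x = x ∧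
        ((D.supp x.1).card = s ∨
          ∀ J, D.IsSel J → D.Indep J → (D.supp J).card ≤ (D.supp x.1).card)) := by
  classical
  obtain ⟨I, lam⟩ := x
  dsimp only at h hs
  unfold step
  by_cases h1 : (D.supp I).card = s
  · rw [if_pos h1]
    exact ⟨h, hs, Or.inr ⟨rfl, Or.inl h1⟩⟩
  rw [if_neg h1]
  by_cases h2 : ∃ c < D.q, D.Reach I lam (D.q + 1) c ∧ I c = 0
  · rw [if_pos h2]
    have hlt := sel_lt h2
    obtain ⟨hr, h0⟩ := sel_spec hlt
    obtain ⟨k, cs, os, hp, hk, htr⟩ := exists_isPath hlt hr h0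
    have haug : D.augmentI I lam = augmented I k cs os (D.level I lam) := htr
    have hcard : (D.supp (D.augmentI I lam)).card = (D.supp I).card + 1 := by
      rw [haug, hp.supp_augmented hD, Finset.card_insert_of_notMem]
      simp [mem_supp, hp.last]
    dsimp only
    refine ⟨haug ▸ hp.inv_augmented hD h, by omega, Or.inl ?_⟩
    unfold progress
    dsimp only
    rw [hcard, add_mul]
    have := Finset.card_filter_le (Finset.range (D.q + 1)) fun c => D.Reach I lam (D.q + 1) c
    rw [Finset.card_range] at this
    omega
  rw [if_neg h2]
  push Not at h2
  have hused : ∀ c' < D.q + 1, D.Reach I lam (D.q + 1) c' → c' = D.q ∨ I c' ≠ 0 := by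
    intro c' hc' hr
    rcases (show c' < D.q ∨ c' = D.q by omega) with h | h
    · exact Or.inr (h2 c' h hr)
    · exact Or.inl h
  by_cases h3 : ∃ c' < D.q + 1, ∃ c < D.q, ∃ o < D.p, D.Cand I lam c' c o
  · rw [if_pos h3]
    obtain ⟨b1, b2, b3, ⟨b4, b5, b6⟩, b7⟩ := exists_best h3
    have hpos : 0 ≤ D.minGap I lam := by
      have := h.slack _ (hused _ b1 b4) _ b2 _ b3 b6
      unfold minGap gap
      linarith
    refine ⟨h.raise hpos (reach_q _) h2 fun c' hc' hU c hc hcU o ho hE =>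
      b7 c' (by omega) c hc o ho ⟨hU, hcU, hE⟩, hs, Or.inl ?_⟩
    unfold progress
    dsimp only
    refine add_lt_add_of_le_of_lt le_rfl (Finset.card_lt_card ?_)
    -- Inside the reached set all prices rise by the same amount, so the tight exchanges there
    -- remain tight.
    have hkeep : ∀ k ≤ D.q + 1, ∀ c, D.Reach I lam k c → D.Reach I (D.raised I lam) k c := by
      intro k
      induction k with
      | zero => exact fun _ c hc => hc
      | succ k ih =>
        intro hk c hc
        have hcK := reach_mono hk hc
        rcases hc with hc | ⟨c', hc', o, ho, hr, ht⟩
        · exact Or.inl (ih (by omega) c hc)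
        · refine Or.inr ⟨c', hc', o, ho, ih (by omega) c' hr, ht.1, ht.2.1, ?_⟩
          have hc'K := reach_mono (show k ≤ D.q + 1 by omega) hr
          have := ht.2.2
          unfold red at this ⊢
          unfold raised
          rw [if_pos hcK, if_pos hc'K]
          linarith
    rw [Finset.ssubset_iff_of_subset (Finset.monotone_filter_right _ fun c _ hc =>
      hkeep _ le_rfl c hc)]
    refine ⟨D.bestC I lam, ?_, ?_⟩
    · refine Finset.mem_filter.2 ⟨Finset.mem_range.2 (by omega), ?_⟩
      -- The rise is exactly the gap of the best exchange, which thereby becomes tight and reaches a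
      -- new class.
      refine reach_of_tight b1 (by omega) b3 (hkeep _ le_rfl _ b4) ⟨hused _ b1 b4, b6, ?_⟩
      unfold red raised minGap gap red
      rw [if_pos b4, if_neg b5]
      ring
    · simp [b5]
  · rw [if_neg h3]
    refine ⟨h, hs, Or.inr ⟨rfl, Or.inr fun J hJ hJi => ?_⟩⟩
    push Not at h3
    refine h.indep.card_le hD (U := D.Reach I lam (D.q + 1)) (reach_q _) h2
      (fun c' hc' hU c hc hcU o ho => ?_) hJ hJi
    by_contra hcon
    exact h3 c' (by omega) c hc o ho ⟨hU, hcU, hcon⟩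

theorem progress_lt (x : (ℕ → ℕ) × (ℕ → ℝ)) : D.progress x < (D.q + 2) * (D.q + 2) := by
  classical
  unfold progress
  have h1 : (D.supp x.1).card ≤ D.q := card_supp_le
  have h2 := Finset.card_filter_le (Finset.range (D.q + 1)) fun c => D.Reach x.1 x.2 (D.q + 1) c
  rw [Finset.card_range] at h2
  have := Nat.mul_le_mul_right (D.q + 2) h1
  have h4 : (D.q + 2) * (D.q + 2) = D.q * (D.q + 2) + 2 * (D.q + 2) := by ring
  omega

theorem run_inv (hD : D.WF) (s t : ℕ) :
    D.Inv (D.run s t).1 (D.run s t).2 ∧ (D.supp (D.run s t).1).card ≤ s := by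
  induction t with
  | zero =>
    refine ⟨inv_start hD, ?_⟩
    change (D.supp fun _ => 0).card ≤ s
    simp [supp]
  | succ t ih =>
    have := step_spec hD s ih.1 ih.2
    exact ⟨this.1, this.2.1⟩

/-- The potential cannot grow in every round, so the run becomes stationary. It then has size `s`,
and the certificate proves optimality. Otherwise its size, which never exceeds `s`, is maximal and
different from `s`, so size `s` is impossible. -/
theorem solve_spec (hD : D.WF) (s : ℕ) :
    D.IsSel (D.solve s) ∧ D.Indep (D.solve s) ∧
      ((D.supp (D.solve s)).card = s → ∀ J, D.IsSel J → D.Indep J → (D.supp J).card = s →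
        D.weight J ≤ D.weight (D.solve s)) ∧
      ((D.supp (D.solve s)).card ≠ s → ∀ J, D.IsSel J → D.Indep J → (D.supp J).card ≠ s) := by
  have hprog : ∀ t, t ≤ D.progress (D.run s t) ∨ D.step s (D.run s t) = D.run s t ∧
      ((D.supp (D.run s t).1).card = s ∨ ∀ J, D.IsSel J → D.Indep J →
        (D.supp J).card ≤ (D.supp (D.run s t).1).card) := by
    intro t
    induction t with
    | zero => exact Or.inl (Nat.zero_le _)
    | succ t ih =>
      rw [run]
      rcases ih with ih | ih
      · obtain ⟨h1, h2⟩ := run_inv hD s t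
        rcases (step_spec hD s h1 h2).2.2 with h3 | h3
        · exact Or.inl (by omega)
        · refine Or.inr ?_
          rw [h3.1]
          exact h3
      · refine Or.inr ?_
        rw [ih.1]
        exact ih
  obtain ⟨h1, h2⟩ := run_inv hD s ((D.q + 2) * (D.q + 2))
  refine ⟨h1.sel, h1.indep, fun hc J hJ hJi hJc => h1.weight_le hD hJ hJi (hJc.trans hc.symm),
    fun hc J hJ hJi hJc => ?_⟩
  rcases hprog ((D.q + 2) * (D.q + 2)) with h | ⟨-, h | h⟩
  · exact absurd (progress_lt _) (not_lt.2 h)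
  · exact hc h
  · have := h J hJ hJi
    exact hc (by unfold solve; omega)

end Inst

end RealWhile

/-! ### Membership in a span by orthogonal projection -/

namespace RealWhile

open Submodule Matrix

/-- This is the rank-one update `P - r rᵀ / (rᵀ r)` with `r = P x`. If `r = 0`, the quotient is `0`
by the convention for division and `P` stays as it is, so no pivoting or case distinction is needed.
-/
noncomputable def projStep (d : ℕ) (P : ℕ → ℕ → ℝ) (x : ℕ → ℝ) (i j : ℕ) : ℝ :=
  P i j - (∑ k ∈ Finset.range d, P i k * x k) * (∑ k ∈ Finset.range d, P j k * x k) /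
    ∑ l ∈ Finset.range d, (∑ k ∈ Finset.range d, P l k * x k) * ∑ k ∈ Finset.range d, P l k * x k

/-- The projection along the first vectors of the family `u` onto their orthogonal complement. -/
noncomputable def proj (d : ℕ) (u : ℕ → ℕ → ℝ) : ℕ → ℕ → ℕ → ℝ
  | 0 => fun i j => if i = j then 1 else 0
  | t + 1 => projStep d (proj d u t) (u t)

/-- The vector `r` is the part of `u` orthogonal to `W`, and `M` fixes it. Removing the direction
`r` from the range of `M` adds `u` to the kernel. If `r = 0`, then `u` is already in `W` and `M` is
unchanged. -/
theorem projection_update {d : ℕ} {M : Matrix (Fin d) (Fin d) ℝ} {W : Submodule ℝ (Fin d → ℝ)}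
    (hs : Mᵀ = M) (hi : M * M = M) (hk : ∀ x, M *ᵥ x = 0 ↔ x ∈ W) (u : Fin d → ℝ) :
    let r := M *ᵥ u
    let M' := M - (r ⬝ᵥ r)⁻¹ • vecMulVec r r
    M'ᵀ = M' ∧ M' * M' = M' ∧ ∀ x, M' *ᵥ x = 0 ↔ x ∈ W ⊔ span ℝ {u} := by
  intro r M'
  have hMr : M *ᵥ r = r := by
    change M *ᵥ (M *ᵥ u) = M *ᵥ u
    rw [mulVec_mulVec, hi]
  have hrM : r ᵥ* M = r := by
    rw [← mulVec_transpose, hs, hMr]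
  have hM' : ∀ x, M' *ᵥ x = M *ᵥ x - ((r ⬝ᵥ r)⁻¹ * (r ⬝ᵥ x)) • r := by
    intro x
    change (M - (r ⬝ᵥ r)⁻¹ • vecMulVec r r) *ᵥ x = _
    rw [sub_mulVec, smul_mulVec, vecMulVec_mulVec, mul_smul, op_smul_eq_smul]
  have hru : r ⬝ᵥ u = r ⬝ᵥ r := by
    conv_rhs => rw [show r ⬝ᵥ r = r ⬝ᵥ (M *ᵥ u) from rfl, dotProduct_mulVec, hrM]
  refine ⟨?_, ?_, fun x => ?_⟩
  · change (M - (r ⬝ᵥ r)⁻¹ • vecMulVec r r)ᵀ = _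
    rw [transpose_sub, hs, transpose_smul, transpose_vecMulVec]
  · change (M - (r ⬝ᵥ r)⁻¹ • vecMulVec r r) * (M - (r ⬝ᵥ r)⁻¹ • vecMulVec r r) =
      M - (r ⬝ᵥ r)⁻¹ • vecMulVec r r
    rw [sub_mul, mul_sub, mul_sub, hi, Matrix.mul_smul, Matrix.smul_mul, mul_vecMulVec, vecMulVec_mul,
      hMr, hrM, Matrix.smul_mul, Matrix.mul_smul, vecMulVec_mul_vecMulVec, vecMulVec_smul,
      smul_smul, smul_smul]
    by_cases h0 : r ⬝ᵥ r = 0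
    · simp [h0]
    · rw [show (r ⬝ᵥ r)⁻¹ * (r ⬝ᵥ r)⁻¹ * r ⬝ᵥ r = (r ⬝ᵥ r)⁻¹ by field_simp]
      abel
  · by_cases h0 : r ⬝ᵥ r = 0
    · have hr : r = 0 := dotProduct_self_eq_zero.1 h0
      have hu : u ∈ W := (hk u).1 hr
      rw [hM', hr, smul_zero, sub_zero, hk, sup_eq_left.2 (by simpa using hu)]
    · rw [hM', mem_sup]
      constructor
      · intro hx
        set t := (r ⬝ᵥ r)⁻¹ * (r ⬝ᵥ x)
        refine ⟨x - t • u, ?_, t • u, smul_mem _ _ (mem_span_singleton_self u), by abel⟩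
        rw [← hk, mulVec_sub, mulVec_smul]
        exact hx
      · rintro ⟨y, hy, z, hz, rfl⟩
        obtain ⟨t, rfl⟩ := mem_span_singleton.1 hz
        have hry : r ⬝ᵥ y = 0 := by
          conv_lhs => rw [← hrM, ← dotProduct_mulVec, (hk y).2 hy, dotProduct_zero]
        rw [mulVec_add, (hk y).2 hy, mulVec_smul, dotProduct_add, hry, dotProduct_smul, hru,
          smul_eq_mul]
        rw [show (r ⬝ᵥ r)⁻¹ * (0 + t * r ⬝ᵥ r) = t by field_simp; ring]
        simp [r]

theorem proj_spec (d : ℕ) (u : ℕ → ℕ → ℝ) (N : ℕ) :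
    let M : Matrix (Fin d) (Fin d) ℝ := Matrix.of fun i j => proj d u N i j
    Mᵀ = M ∧ M * M = M ∧ ∀ x, M *ᵥ x = 0 ↔
      x ∈ span ℝ ((fun t (k : Fin d) => u t k) '' {t | t < N}) := by
  induction N with
  | zero =>
    have : (Matrix.of fun i j : Fin d => proj d u 0 i j) = 1 := by
      ext i j
      simp [proj, Matrix.one_apply, Fin.ext_iff]
    intro M
    rw [show M = 1 from this]
    simp
  | succ N ih =>
    obtain ⟨h1, h2, h3⟩ := ih
    have key := projection_update h1 h2 h3 fun k : Fin d => u N k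
    have hset : {t | t < N + 1} = insert N {t | t < N} := by
      ext t
      simp only [Set.mem_ofPred_eq, Set.mem_insert_iff]
      omega
    intro M
    rw [hset, Set.image_insert_eq, span_insert, sup_comm]
    have hM : M = (Matrix.of fun i j : Fin d => proj d u N i j) -
        (((Matrix.of fun i j : Fin d => proj d u N i j) *ᵥ fun k => u N k) ⬝ᵥ
          ((Matrix.of fun i j : Fin d => proj d u N i j) *ᵥ fun k => u N k))⁻¹ •
        vecMulVec ((Matrix.of fun i j : Fin d => proj d u N i j) *ᵥ fun k => u N k)
          ((Matrix.of fun i j : Fin d => proj d u N i j) *ᵥ fun k => u N k) := by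
      ext i j
      simp only [M, Matrix.of_apply, proj, projStep, Matrix.sub_apply, Matrix.smul_apply, vecMulVec_apply,
        smul_eq_mul, mulVec, dotProduct, Finset.sum_range]
      ring
    rw [hM]
    exact key

/-- The test whether `x` is in the span of `u 0, …, u (N - 1)`. -/
def InSpan (d N : ℕ) (u : ℕ → ℕ → ℝ) (x : ℕ → ℝ) : Prop :=
  ∀ i < d, ∑ k ∈ Finset.range d, proj d u N i k * x k = 0

theorem inSpan_iff (d N : ℕ) (u : ℕ → ℕ → ℝ) (x : ℕ → ℝ) :
    InSpan d N u x ↔ (fun k : Fin d => x k) ∈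
      span ℝ ((fun t (k : Fin d) => u t k) '' {t | t < N}) := by
  rw [← (proj_spec d u N).2.2, funext_iff, InSpan, Fin.forall_iff]
  simp only [mulVec, dotProduct, Matrix.of_apply, Finset.sum_range, Pi.zero_apply]

end RealWhile

/-! ### The algorithm runs in polynomial time -/

namespace RealWhile

open Submodule

/-- A vector of reals, a vector of natural numbers, and a matrix of reals. -/
def rvec (N : ℕ) (a : ℕ → ℝ) : Val := vec N fun k => Val.num (a k)

def nvec (N : ℕ) (a : ℕ → ℕ) : Val := vec N fun k => Val.num (a k : ℝ)

def rmat (N M : ℕ) (a : ℕ → ℕ → ℝ) : Val := vec N fun k => rvec M (a k)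

noncomputable def pvec (N : ℕ) (P : ℕ → Prop) : Val := vec N fun k => Val.ofProp (P k)

/-! ### Programs for tables, projections and span tests -/

section Generic

variable {ι : Type} {sz N M d : ι → ℕ} {f : ι → Val}

theorem Comp.state {A : (Σ i, Fin (N i)) → Val} :
    Comp (bsz sz N) (fun x => Val.cons (A x) (benv f N x)) A :=
  Comp.hd (g := fun x => Val.cons (A x) (benv f N x)) Comp.id

theorem CompN.idxw {A : (Σ i, Fin (N i)) → Val} (hN : CompN sz f N) :
    CompN (bsz sz N) (fun x => Val.cons (A x) (benv f N x)) fun x => (x.2 : ℕ) :=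
  (CompN.idx hN).weaken _

theorem CompR.get {a : ι → ℕ → ℝ} {j : ι → ℕ} (ha : Comp sz f fun i => rvec (N i) (a i))
    (hj : CompN sz f j) (hlt : ∀ i, j i < N i) : CompR sz f fun i => a i (j i) :=
  Comp.get (a := fun i k => Val.num (a i k)) ha hj hlt

theorem Comp.row {a : ι → ℕ → ℕ → ℝ} {j : ι → ℕ} (ha : Comp sz f fun i => rmat (N i) (M i) (a i))
    (hj : CompN sz f j) (hlt : ∀ i, j i < N i) : Comp sz f fun i => rvec (M i) (a i (j i)) :=
  Comp.get (a := fun i k => rvec (M i) (a i k)) ha hj hlt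

theorem CompR.get₂ {a : ι → ℕ → ℕ → ℝ} {j k : ι → ℕ}
    (ha : Comp sz f fun i => rmat (N i) (M i) (a i)) (hj : CompN sz f j) (hlt : ∀ i, j i < N i)
    (hk : CompN sz f k) (hlt' : ∀ i, k i < M i) : CompR sz f fun i => a i (j i) (k i) :=
  CompR.get (ha.row hj hlt) hk hlt'

theorem CompP.get {P : ι → ℕ → Prop} {j : ι → ℕ} (ha : Comp sz f fun i => pvec (N i) (P i))
    (hj : CompN sz f j) (hlt : ∀ i, j i < N i) : CompP sz f fun i => P i (j i) :=
  Comp.get (a := fun i k => Val.ofProp (P i k)) ha hj hlt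

theorem CompR.vec {a : ι → ℕ → ℝ} (hN : CompN sz f N)
    (ha : CompR (bsz sz N) (benv f N) fun x => a x.1 x.2) : Comp sz f fun i => rvec (N i) (a i) :=
  Comp.vec hN ha

theorem CompR.mat {a : ι → ℕ → ℕ → ℝ} (hN : CompN sz f N) (hM : CompN sz f M)
    (ha : CompR (bsz (bsz sz N) fun x => M x.1) (benv (benv f N) fun x => M x.1)
      fun x => a x.1.1 x.1.2 x.2) : Comp sz f fun i => rmat (N i) (M i) (a i) :=
  Comp.vec hN (CompR.vec (a := fun x k => a x.1 x.2 k) hM.up ha)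

open Classical in
theorem CompN.count {P : ι → ℕ → Prop} [∀ i, DecidablePred (P i)] (hN : CompN sz f N)
    (hP : CompP (bsz sz N) (benv f N) fun x => P x.1 x.2) :
    CompN sz f fun i => ((Finset.range (N i)).filter (P i)).card := by
  refine ⟨hN.bdd.mono fun i => (Finset.card_filter_le _ _).trans (by simp), ?_⟩
  refine (CompR.sum (r := fun i k => if P i k then 1 else 0) hN
    (CompR.ite hP Comp.one CompR.zero)).congr fun i => ?_
  rw [Finset.card_filter]
  push_cast
  rfl

theorem CompR.mulVec {P : ι → ℕ → ℕ → ℝ} {x : ι → ℕ → ℝ} {j : ι → ℕ} (hd : CompN sz f d)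
    (hP : Comp sz f fun i => rmat (d i) (d i) (P i)) (hx : Comp sz f fun i => rvec (d i) (x i))
    (hj : CompN sz f j) (hlt : ∀ i, j i < d i) :
    CompR sz f fun i => ∑ k ∈ Finset.range (d i), P i (j i) k * x i k :=
  CompR.sum (r := fun i k => P i (j i) k * x i k) hd
    (CompR.mul (CompR.get₂ (j := fun x => j x.1) hP.up hj.up (fun x => hlt x.1) (CompN.idx hd)
        fun x => x.2.2) (CompR.get (a := fun y => x y.1) hx.up (CompN.idx hd) fun x => x.2.2))

theorem Comp.projStep {P : ι → ℕ → ℕ → ℝ} {x : ι → ℕ → ℝ} (hd : CompN sz f d)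
    (hP : Comp sz f fun i => rmat (d i) (d i) (P i)) (hx : Comp sz f fun i => rvec (d i) (x i)) :
    Comp sz f fun i => rmat (d i) (d i) (projStep (d i) (P i) (x i)) := by
  have hi := (CompN.idx hd).up (N := fun y => d y.1)
  have hj := CompN.idx (hd.up (N := d))
  have hmv : CompR (bsz sz d) (benv f d) fun y =>
      ∑ k ∈ Finset.range (d y.1), P y.1 y.2 k * x y.1 k :=
    CompR.mulVec hd.up hP.up hx.up (CompN.idx hd) fun y => y.2.2
  have hden : CompR sz f fun i => ∑ l ∈ Finset.range (d i),
      (∑ k ∈ Finset.range (d i), P i l k * x i k) * ∑ k ∈ Finset.range (d i), P i l k * x i k :=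
    CompR.sum (r := fun i l => (∑ k ∈ Finset.range (d i), P i l k * x i k) *
      ∑ k ∈ Finset.range (d i), P i l k * x i k) hd (CompR.mul hmv hmv)
  refine CompR.mat (a := fun i => RealWhile.projStep (d i) (P i) (x i)) hd hd ?_
  exact CompR.sub (CompR.get₂ hP.up.up hi (fun y => y.1.2.2) hj fun y => y.2.2)
    (CompR.div (CompR.mul hmv.up (CompR.mulVec hd.up.up hP.up.up hx.up.up hj fun y => y.2.2))
      hden.up.up)

theorem Comp.proj {u : ι → ℕ → ℕ → ℝ} (hd : CompN sz f d) (hN : CompN sz f N)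
    (hu : Comp sz f fun i => rmat (N i) (d i) (u i)) :
    Comp sz f fun i => rmat (d i) (d i) (proj (d i) (u i) (N i)) := by
  refine Comp.iterate (st := fun i t => rmat (d i) (d i) (RealWhile.proj (d i) (u i) t)) hN ?_ ?_
  · exact CompR.mat (a := fun i => RealWhile.proj (d i) (u i) 0) hd hd
      (CompR.ite ((CompN.idx hd).up.eq (CompN.idx hd.up)) Comp.one CompR.zero)
  · exact Comp.projStep (hd.up.weaken _) Comp.state
      (Comp.row (hu.up.weaken _) (CompN.idxw hN) fun x => x.2.2)

theorem CompP.inSpan {u : ι → ℕ → ℕ → ℝ} {x : ι → ℕ → ℝ} (hd : CompN sz f d) (hN : CompN sz f N)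
    (hu : Comp sz f fun i => rmat (N i) (d i) (u i)) (hx : Comp sz f fun i => rvec (d i) (x i)) :
    CompP sz f fun i => InSpan (d i) (N i) (u i) (x i) :=
  CompP.all (P := fun i j => ∑ k ∈ Finset.range (d i), RealWhile.proj (d i) (u i) (N i) j k * x i k = 0)
    hd (CompR.eq (CompR.mulVec hd.up (Comp.proj hd hN hu).up hx.up (CompN.idx hd) fun x => x.2.2)
      CompR.zero)

end Generic

/-- The data of an instance are available. -/
structure CompI {ι : Type} (sz : ι → ℕ) (f : ι → Val) (D : ι → Inst) : Prop where
  q : CompN sz f fun i => (D i).q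
  p : CompN sz f fun i => (D i).p
  d : CompN sz f fun i => (D i).d
  v : Comp sz f fun i => vec ((D i).q + 1) fun c => rmat (D i).p (D i).d ((D i).v c)
  w : Comp sz f fun i => rmat ((D i).q + 1) (D i).p (D i).w
  wf : ∀ i, (D i).WF

/-- The data of an instance, a selection, and prices are available. -/
structure CompS {ι : Type} (sz : ι → ℕ) (f : ι → Val) (D : ι → Inst) (I : ι → ℕ → ℕ)
    (lam : ι → ℕ → ℝ) : Prop extends CompI sz f D where
  sel : Comp sz f fun i => nvec ((D i).q + 1) (I i)
  sel_lt : ∀ i c, I i c < (D i).p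
  lam : Comp sz f fun i => rvec ((D i).q + 1) (lam i)

/-! ### Programs for the steps of the primal-dual algorithm -/

section Algorithm

variable {ι : Type} {sz N : ι → ℕ} {f : ι → Val} {D : ι → Inst} {I : ι → ℕ → ℕ}
  {lam : ι → ℕ → ℝ}

theorem CompI.reindex {κ : Type} (π : κ → ι) (h : CompI sz f D) :
    CompI (fun x => sz (π x)) (fun x => f (π x)) fun x => D (π x) :=
  ⟨h.q.reindex π, h.p.reindex π, h.d.reindex π, h.v.reindex π, h.w.reindex π, fun x => h.wf (π x)⟩

theorem CompI.weaken (a : ι → Val) (h : CompI sz f D) :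
    CompI sz (fun i => Val.cons (a i) (f i)) D :=
  ⟨h.q.weaken a, h.p.weaken a, h.d.weaken a, h.v.weaken a, h.w.weaken a, h.wf⟩

theorem CompI.up (h : CompI sz f D) : CompI (bsz sz N) (benv f N) fun x => D x.1 :=
  (h.reindex (fun x : Σ i, Fin (N i) => x.1)).weaken _

theorem CompS.reindex {κ : Type} (π : κ → ι) (h : CompS sz f D I lam) :
    CompS (fun x => sz (π x)) (fun x => f (π x)) (fun x => D (π x)) (fun x => I (π x))
      fun x => lam (π x) :=
  ⟨h.toCompI.reindex π, h.sel.reindex π, fun x => h.sel_lt (π x), h.lam.reindex π⟩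

theorem CompS.weaken (a : ι → Val) (h : CompS sz f D I lam) :
    CompS sz (fun i => Val.cons (a i) (f i)) D I lam :=
  ⟨h.toCompI.weaken a, h.sel.weaken a, h.sel_lt, h.lam.weaken a⟩

theorem CompS.up (h : CompS sz f D I lam) :
    CompS (bsz sz N) (benv f N) (fun x => D x.1) (fun x => I x.1) fun x => lam x.1 :=
  (h.reindex (fun x : Σ i, Fin (N i) => x.1)).weaken _

theorem CompS.get (h : CompS sz f D I lam) {c : ι → ℕ} (hc : CompN sz f c)
    (hlt : ∀ i, c i < (D i).q + 1) : CompN sz f fun i => I i (c i) :=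
  CompN.get h.sel hc hlt h.p.bdd fun i => (h.sel_lt i _).le

theorem CompI.opts (h : CompI sz f D) {c : ι → ℕ} (hc : CompN sz f c)
    (hlt : ∀ i, c i < (D i).q + 1) :
    Comp sz f fun i => rmat (D i).p (D i).d ((D i).v (c i)) :=
  Comp.get (a := fun i c => rmat (D i).p (D i).d ((D i).v c)) h.v hc hlt

theorem CompI.vec (h : CompI sz f D) {c o : ι → ℕ} (hc : CompN sz f c)
    (hlt : ∀ i, c i < (D i).q + 1) (ho : CompN sz f o) (hlt' : ∀ i, o i < (D i).p) :
    Comp sz f fun i => rvec (D i).d ((D i).v (c i) (o i)) :=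
  (h.opts hc hlt).row ho hlt'

theorem CompS.red (h : CompS sz f D I lam) {c o : ι → ℕ} (hc : CompN sz f c)
    (hlt : ∀ i, c i < (D i).q + 1) (ho : CompN sz f o) (hlt' : ∀ i, o i < (D i).p) :
    CompR sz f fun i => (D i).red (lam i) (c i) (o i) :=
  CompR.sub (CompR.get₂ h.w hc hlt ho hlt') (CompR.get h.lam hc hlt)

/-- The omitted class is replaced by the zero vector, so that the spanning family is always indexed
by all numbers below `q`, as the span test expects. -/
theorem spanExc_eq_span (D : Inst) (I : ℕ → ℕ) (c' : ℕ) :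
    D.spanExc I c' = span ℝ ((fun t (k : Fin D.d) => if t = c' then 0 else D.v t (I t) k) ''
      {t | t < D.q}) := by
  apply le_antisymm
  · rw [Inst.spanExc, span_le]
    rintro _ ⟨c, ⟨hc, hne⟩, rfl⟩
    refine subset_span ⟨c, hc, ?_⟩
    funext k
    exact if_neg hne
  · rw [span_le]
    rintro _ ⟨c, hc, rfl⟩
    by_cases h : c = c'
    · simp only [h, if_true]
      exact zero_mem _
    · simp only [h, if_false]
      exact subset_span ⟨c, ⟨hc, h⟩, rfl⟩

theorem CompS.exch (h : CompS sz f D I lam) {c' c o : ι → ℕ} (hc' : CompN sz f c')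
    (hc : CompN sz f c) (hlt : ∀ i, c i < (D i).q + 1) (ho : CompN sz f o)
    (hlt' : ∀ i, o i < (D i).p) :
    CompP sz f fun i => (D i).vect (c i) (o i) ∉ (D i).spanExc (I i) (c' i) := by
  have hsel := h.up (N := fun i => (D i).q) |>.get (CompN.idx h.q) fun x =>
    x.2.2.trans (Nat.lt_succ_self _)
  have hu : Comp sz f fun i => rmat (D i).q (D i).d fun t k =>
      if t = c' i then 0 else (D i).v t (I i t) k :=
    CompR.mat (a := fun i t k => if t = c' i then 0 else (D i).v t (I i t) k) h.q h.d
      (CompR.ite ((CompN.idx h.q).up.eq hc'.up.up) CompR.zero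
        (CompR.get (h.up.up.vec (CompN.idx h.q).up (fun x =>
          x.1.2.2.trans (Nat.lt_succ_self _)) hsel.up fun x => h.sel_lt _ _) (CompN.idx h.d.up)
            fun x => x.2.2))
  refine (CompP.not (CompP.inSpan h.d h.q hu (h.vec hc hlt ho hlt'))).congr fun i => ?_
  rw [inSpan_iff, spanExc_eq_span]
  rfl

theorem CompS.tight (h : CompS sz f D I lam) {c' c o : ι → ℕ} (hc' : CompN sz f c')
    (hlt : ∀ i, c' i < (D i).q + 1) (hc : CompN sz f c) (hlt₁ : ∀ i, c i < (D i).q + 1)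
    (ho : CompN sz f o) (hlt₂ : ∀ i, o i < (D i).p) :
    CompP sz f fun i => (D i).Tight (I i) (lam i) (c' i) (c i) (o i) :=
  CompP.and (CompP.or (hc'.eq h.q) ((h.get hc' hlt).eq CompN.zero).not)
    (CompP.and (h.exch hc' hc hlt₁ ho hlt₂) (CompR.eq (h.red hc hlt₁ ho hlt₂)
      (h.red hc' hlt (h.get hc' hlt) fun _ => h.sel_lt _ _)))

/-- The table of one round is the loop state from which the next is computed, so no reachability
value is recomputed by recursion through all earlier rounds. -/
theorem CompS.reachVec (h : CompS sz f D I lam) {k : ι → ℕ} (hk : CompN sz f k) :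
    Comp sz f fun i => pvec ((D i).q + 1) ((D i).Reach (I i) (lam i) (k i)) := by
  refine Comp.iterate (st := fun i t => pvec ((D i).q + 1) ((D i).Reach (I i) (lam i) t)) hk ?_ ?_
  · exact Comp.vec h.q.succ ((CompN.idx h.q.succ).eq h.q.up)
  · have hS := (h.up (N := k)).weaken
      (fun x => pvec ((D x.1).q + 1) ((D x.1).Reach (I x.1) (lam x.1) x.2))
    have hR := Comp.state (sz := sz) (f := f) (N := k)
      (A := fun x => pvec ((D x.1).q + 1) ((D x.1).Reach (I x.1) (lam x.1) x.2))
    refine Comp.vec hS.q.succ (CompP.or (CompP.get hR.up (CompN.idx hS.q.succ) fun x => x.2.2)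
      (CompP.ex hS.q.succ.up (CompP.ex hS.p.up.up (CompP.and
        (CompP.get hR.up.up.up (CompN.idx hS.q.succ.up).up fun x => x.1.2.2)
        (hS.up.up.up.tight (CompN.idx hS.q.succ.up).up (fun x => x.1.2.2)
          (CompN.idx hS.q.succ).up.up (fun x => x.1.1.2.2) (CompN.idx hS.p.up.up)
          fun x => x.2.2)))))

theorem CompS.reach (h : CompS sz f D I lam) {k c : ι → ℕ} (hk : CompN sz f k)
    (hc : CompN sz f c) (hlt : ∀ i, c i < (D i).q + 1) :
    CompP sz f fun i => (D i).Reach (I i) (lam i) (k i) (c i) :=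
  CompP.get (h.reachVec hk) hc hlt

theorem CompS.predC (h : CompS sz f D I lam) {k c : ι → ℕ} (hk : CompN sz f k)
    (hc : CompN sz f c) (hlt : ∀ i, c i < (D i).q + 1) :
    CompN sz f fun i => (D i).predC (I i) (lam i) (k i) (c i) :=
  CompN.sel h.q.succ (CompP.and (h.up.reach hk.up (CompN.idx h.q.succ) fun x => x.2.2)
    (CompP.ex h.p.up (h.up.up.tight (CompN.idx h.q.succ).up (fun x => x.1.2.2) hc.up.up
      (fun x => hlt x.1.1) (CompN.idx h.p.up) fun x => x.2.2)))

theorem CompS.predO (h : CompS sz f D I lam) {k c : ι → ℕ} (hk : CompN sz f k)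
    (hc : CompN sz f c) (hlt : ∀ i, c i < (D i).q + 1)
    (hlt' : ∀ i, (D i).predC (I i) (lam i) (k i) (c i) < (D i).q + 1) :
    CompN sz f fun i => (D i).predO (I i) (lam i) (k i) (c i) :=
  CompN.sel h.p (h.up.tight (h.predC hk hc hlt).up (fun x => hlt' x.1) hc.up (fun x => hlt x.1)
    (CompN.idx h.p) fun x => x.2.2)

/-- Table access needs indices in range, and a predecessor exists only for a class that is reached
one level higher; both facts must persist along the trace. -/
theorem Inst.trace_inv {D : Inst} {I : ℕ → ℕ} {lam : ℕ → ℝ} {K : ℕ} {x : ℕ × (ℕ → ℕ)}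
    (hr : D.Reach I lam K x.1) (hx : x.1 < D.q + 1) (hlt : ∀ c, x.2 c < D.p) (t : ℕ)
    (ht : t ≤ K) :
    D.Reach I lam (K - t) (D.trace I lam K x t).1 ∧ (D.trace I lam K x t).1 < D.q + 1 ∧
      ∀ c, (D.trace I lam K x t).2 c < D.p := by
  induction t with
  | zero => exact ⟨hr, hx, hlt⟩
  | succ t ih =>
    obtain ⟨h1, h2, h3⟩ := ih (by omega)
    rw [Inst.trace, Inst.back]
    split_ifs with h
    · rw [show K - (t + 1) = K - 1 - t by omega]
      exact ⟨h, h2, h3⟩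
    · rw [show K - t = (K - 1 - t) + 1 by omega] at h1
      obtain ⟨e1, e2, e3, e4⟩ := Inst.predC_spec h1 h
      rw [show K - (t + 1) = K - 1 - t by omega]
      refine ⟨e3, e1, fun c => ?_⟩
      dsimp only
      by_cases hc : c = (D.trace I lam K x t).1
      · rw [hc, Function.update_self]
        exact e2
      · rw [Function.update_of_ne hc]
        exact h3 c

open Classical in
theorem CompS.trace (h : CompS sz f D I lam) {K c : ι → ℕ} (hK : CompN sz f K)
    (hc : CompN sz f c) (hlt : ∀ i, c i < (D i).q + 1)
    (hr : ∀ i, (D i).Reach (I i) (lam i) (K i) (c i)) :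
    Comp sz f fun i => nvec ((D i).q + 1) ((D i).trace (I i) (lam i) (K i) (c i, I i) (K i)).2 := by
  set T : ι → ℕ → ℕ × (ℕ → ℕ) := fun i t => (D i).trace (I i) (lam i) (K i) (c i, I i) t with hT
  have hinv : ∀ i t, t ≤ K i → (D i).Reach (I i) (lam i) (K i - t) (T i t).1 ∧
      (T i t).1 < (D i).q + 1 ∧ ∀ c, (T i t).2 c < (D i).p := fun i t ht =>
    Inst.trace_inv (x := (c i, I i)) (hr i) (hlt i) (h.sel_lt i) t ht
  refine Comp.tl (Comp.iterate (st := fun i t => Val.cons (Val.num ((T i t).1 : ℝ))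
    (nvec ((D i).q + 1) (T i t).2)) hK (Comp.cons hc.comp h.sel) ?_)
  have hA := Comp.state (sz := sz) (f := f) (N := K)
    (A := fun x => Val.cons (Val.num ((T x.1 x.2).1 : ℝ)) (nvec ((D x.1).q + 1) (T x.1 x.2).2))
  have hS := (h.up (N := K)).weaken (fun x => Val.cons (Val.num ((T x.1 x.2).1 : ℝ))
    (nvec ((D x.1).q + 1) (T x.1 x.2).2))
  have hcur : CompN _ _ fun x : Σ i, Fin (K i) => (T x.1 x.2).1 :=
    ⟨hS.q.succ.bdd.mono fun x => (hinv x.1 x.2 x.2.2.le).2.1.le, hA.hd⟩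
  have hk : CompN (bsz sz K) _ fun x => K x.1 - 1 - x.2 :=
    (((hK.up.sub CompN.one).weaken (fun x => Val.cons (Val.num ((T x.1 x.2).1 : ℝ))
      (nvec ((D x.1).q + 1) (T x.1 x.2).2))).sub (CompN.idxw hK))
  have hltc : ∀ x : Σ i, Fin (K i), (T x.1 x.2).1 < (D x.1).q + 1 := fun x =>
    (hinv x.1 x.2 x.2.2.le).2.1
  -- The predecessor is known to be in range only where the class is not reached one level down, so
  -- each branch is computed under its own condition.
  refine Comp.congr (Comp.iteDep (P := fun x : Σ i, Fin (K i) =>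
    (D x.1).Reach (I x.1) (lam x.1) (K x.1 - 1 - x.2) (T x.1 x.2).1)
    (g := fun x => Val.cons (Val.num ((T x.1 x.2).1 : ℝ)) (nvec ((D x.1).q + 1) (T x.1 x.2).2))
    (h := fun x => Val.cons (Val.num (((D x.1).predC (I x.1) (lam x.1) (K x.1 - 1 - x.2)
        (T x.1 x.2).1 : ℕ) : ℝ)) (nvec ((D x.1).q + 1) fun c' => if c' = (T x.1 x.2).1 then
          (D x.1).predO (I x.1) (lam x.1) (K x.1 - 1 - x.2) (T x.1 x.2).1 else (T x.1 x.2).2 c'))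
    (hS.reach hk hcur hltc) (hA.reindex _) ?_) ?_
  · set π : {x : Σ i, Fin (K i) // ¬ (D x.1).Reach (I x.1) (lam x.1) (K x.1 - 1 - x.2)
      (T x.1 x.2).1} → Σ i, Fin (K i) := fun y => y.1 with hπ
    have hS' := hS.reindex π
    have hk' := hk.reindex π
    have hcur' := hcur.reindex π
    have hp : ∀ y, (D (π y).1).predC (I (π y).1) (lam (π y).1) (K (π y).1 - 1 - (π y).2)
        (T (π y).1 (π y).2).1 < (D (π y).1).q + 1 := by
      intro y
      have h1 := (hinv (π y).1 (π y).2 (π y).2.2.le).1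
      have := (π y).2.2
      rw [show K (π y).1 - (π y).2 = (K (π y).1 - 1 - (π y).2) + 1 by omega] at h1
      exact (Inst.predC_spec h1 y.2).1
    refine Comp.cons (hS'.predC hk' hcur' fun y => hltc _).comp (Comp.vec hS'.q.succ
      (CompN.ite ((CompN.idx hS'.q.succ).eq hcur'.up)
        (hS'.predO hk' hcur' (fun y => hltc _) hp).up ?_).comp)
    exact CompN.get (a := fun y => (T (π y.1).1 (π y.1).2).2) (hA.tl.reindex π).up
      (CompN.idx hS'.q.succ) (fun y => y.2.2) hS'.p.up.bdd
      fun y => ((hinv _ _ (π y.1).2.2.le).2.2 _).le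
  · intro x
    have hstep : T x.1 (x.2 + 1) = (D x.1).back (I x.1) (lam x.1) (K x.1 - 1 - x.2) (T x.1 x.2) :=
      rfl
    rw [hstep, Inst.back]
    split_ifs with hcon
    · rfl
    · dsimp only
      congr 1
      refine vec_congr fun c' _ => ?_
      rw [Function.update_apply]

theorem CompS.cand (h : CompS sz f D I lam) {c' c o : ι → ℕ} (hc' : CompN sz f c')
    (hlt : ∀ i, c' i < (D i).q + 1) (hc : CompN sz f c) (hlt₁ : ∀ i, c i < (D i).q)
    (ho : CompN sz f o) (hlt₂ : ∀ i, o i < (D i).p) :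
    CompP sz f fun i => (D i).Cand (I i) (lam i) (c' i) (c i) (o i) :=
  CompP.and (h.reach h.q.succ hc' hlt) (CompP.and
    (CompP.not (h.reach h.q.succ hc fun i => (hlt₁ i).trans (Nat.lt_succ_self _)))
    (h.exch hc' hc (fun i => (hlt₁ i).trans (Nat.lt_succ_self _)) ho hlt₂))

theorem CompS.gap (h : CompS sz f D I lam) {c' c o : ι → ℕ} (hc' : CompN sz f c')
    (hlt : ∀ i, c' i < (D i).q + 1) (hc : CompN sz f c) (hlt₁ : ∀ i, c i < (D i).q)
    (ho : CompN sz f o) (hlt₂ : ∀ i, o i < (D i).p) :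
    CompR sz f fun i => (D i).gap (I i) (lam i) (c' i) (c i) (o i) :=
  CompR.sub (h.red hc' hlt (h.get hc' hlt) fun _ => h.sel_lt _ _)
    (h.red hc (fun i => (hlt₁ i).trans (Nat.lt_succ_self _)) ho hlt₂)

theorem CompS.best (h : CompS sz f D I lam) {c' c o : ι → ℕ} (hc' : CompN sz f c')
    (hlt : ∀ i, c' i < (D i).q + 1) (hc : CompN sz f c) (hlt₁ : ∀ i, c i < (D i).q)
    (ho : CompN sz f o) (hlt₂ : ∀ i, o i < (D i).p) :
    CompP sz f fun i => (D i).Best (I i) (lam i) (c' i) (c i) (o i) := by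
  refine CompP.and (h.cand hc' hlt hc hlt₁ ho hlt₂) (CompP.all h.q.succ (CompP.all h.q.up
    (CompP.all h.p.up.up (CompP.imp ?_ (CompR.le ?_ ?_)))))
  · exact h.up.up.up.cand (CompN.idx h.q.succ).up.up (fun x => x.1.1.2.2) (CompN.idx h.q.up).up
      (fun x => x.1.2.2) (CompN.idx h.p.up.up) fun x => x.2.2
  · exact (h.gap hc' hlt hc hlt₁ ho hlt₂).up.up.up
  · exact h.up.up.up.gap (CompN.idx h.q.succ).up.up (fun x => x.1.1.2.2) (CompN.idx h.q.up).up
      (fun x => x.1.2.2) (CompN.idx h.p.up.up) fun x => x.2.2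

/-- Without a candidate the searches return their upper bounds, which are not valid indices; hence
the hypothesis. -/
theorem CompS.minGap (h : CompS sz f D I lam)
    (hex : ∀ i, ∃ c' < (D i).q + 1, ∃ c < (D i).q, ∃ o < (D i).p,
      (D i).Cand (I i) (lam i) c' c o) :
    CompR sz f fun i => (D i).minGap (I i) (lam i) := by
  have hb := fun i => Inst.exists_best (hex i)
  have h1 : CompN sz f fun i => (D i).bestS (I i) (lam i) :=
    CompN.sel h.q.succ (CompP.ex h.q.up (CompP.ex h.p.up.up (h.up.up.up.best
      (CompN.idx h.q.succ).up.up (fun x => x.1.1.2.2) (CompN.idx h.q.up).up (fun x => x.1.2.2)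
      (CompN.idx h.p.up.up) fun x => x.2.2)))
  have h2 : CompN sz f fun i => (D i).bestC (I i) (lam i) :=
    CompN.sel h.q (CompP.ex h.p.up (h.up.up.best h1.up.up (fun x => (hb x.1.1).1)
      (CompN.idx h.q).up (fun x => x.1.2.2) (CompN.idx h.p.up) fun x => x.2.2))
  have h3 : CompN sz f fun i => (D i).bestO (I i) (lam i) :=
    CompN.sel h.p (h.up.best h1.up (fun x => (hb x.1).1) h2.up (fun x => (hb x.1).2.1)
      (CompN.idx h.p) fun x => x.2.2)
  exact h.gap h1 (fun i => (hb i).1) h2 (fun i => (hb i).2.1) h3 fun i => (hb i).2.2.1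

/-- The value that represents a selection with prices. -/
def encState (q : ℕ) (x : (ℕ → ℕ) × (ℕ → ℝ)) : Val := Val.cons (nvec (q + 1) x.1) (rvec (q + 1) x.2)

open Classical in
theorem CompS.step (h : CompS sz f D I lam) {s : ι → ℕ} (hs : CompN sz f s) :
    Comp sz f fun i => encState (D i).q ((D i).step (s i) (I i, lam i)) := by
  have hsame : Comp sz f fun i => encState (D i).q (I i, lam i) := Comp.cons h.sel h.lam
  have hcount : CompN sz f fun i => ((D i).supp (I i)).card :=
    CompN.count h.q (CompP.not (CompN.eq (h.up.get (CompN.idx h.q) fun x =>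
      x.2.2.trans (Nat.lt_succ_self _)) CompN.zero))
  have hunused : CompP sz f fun i => ∃ c < (D i).q,
      (D i).Reach (I i) (lam i) ((D i).q + 1) c ∧ I i c = 0 :=
    CompP.ex h.q (CompP.and (h.up.reach h.q.succ.up (CompN.idx h.q) fun x =>
      x.2.2.trans (Nat.lt_succ_self _)) (CompN.eq (h.up.get (CompN.idx h.q) fun x =>
      x.2.2.trans (Nat.lt_succ_self _)) CompN.zero))
  have hcand : CompP sz f fun i => ∃ c' < (D i).q + 1, ∃ c < (D i).q, ∃ o < (D i).p,
      (D i).Cand (I i) (lam i) c' c o :=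
    CompP.ex h.q.succ (CompP.ex h.q.up (CompP.ex h.p.up.up (h.up.up.up.cand
      (CompN.idx h.q.succ).up.up (fun x => x.1.1.2.2) (CompN.idx h.q.up).up (fun x => x.1.2.2)
      (CompN.idx h.p.up.up) fun x => x.2.2)))
  have htarget : CompN sz f fun i => (D i).target (I i) (lam i) :=
    CompN.sel h.q (CompP.and (h.up.reach h.q.succ.up (CompN.idx h.q) fun x =>
      x.2.2.trans (Nat.lt_succ_self _)) (CompN.eq (h.up.get (CompN.idx h.q) fun x =>
      x.2.2.trans (Nat.lt_succ_self _)) CompN.zero))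
  -- Augmentation and price change are computed only where a target, respectively a candidate,
  -- exists; only there are the searched indices in range.
  refine (Comp.ite (P := fun i => ((D i).supp (I i)).card = s i) (hcount.eq hs) hsame
    (Comp.iteDep (g := fun i => encState (D i).q ((D i).augmentI (I i) (lam i), lam i)) hunused ?_
      (Comp.reindex (fun x : {i // ¬ ∃ c < (D i).q, (D i).Reach (I i) (lam i) ((D i).q + 1) c ∧
          I i c = 0} => x.1) (Comp.iteDep
        (g := fun i => encState (D i).q (I i, (D i).raised (I i) (lam i)))
        (h := fun i => encState (D i).q (I i, lam i)) hcand ?_ (hsame.reindex _))))).congr fun i => ?_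
  · set π : {i // ∃ c < (D i).q, (D i).Reach (I i) (lam i) ((D i).q + 1) c ∧ I i c = 0} → ι :=
      fun x => x.1 with hπ
    have hsp := fun x => sel_spec (RealWhile.sel_lt (x : {i // ∃ c < (D i).q,
      (D i).Reach (I i) (lam i) ((D i).q + 1) c ∧ I i c = 0}).2)
    exact Comp.cons ((h.reindex π).trace (h.q.succ.reindex π) (htarget.reindex π)
      (fun x => (RealWhile.sel_lt x.2).trans (Nat.lt_succ_self _)) fun x => (hsp x).1) (h.lam.reindex π)
  · set π : {i // ∃ c' < (D i).q + 1, ∃ c < (D i).q, ∃ o < (D i).p,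
      (D i).Cand (I i) (lam i) c' c o} → ι := fun x => x.1 with hπ
    have h' := h.reindex π
    have hidx := CompN.idx h'.q.succ
    have hl : CompR _ _ fun x : Σ y, Fin ((D (π y)).q + 1) => lam (π x.1) x.2 :=
      CompR.get h'.lam.up hidx fun x => x.2.2
    exact Comp.cons h'.sel (CompR.vec (a := fun y => (D (π y)).raised (I (π y)) (lam (π y)))
      h'.q.succ (CompR.ite (h'.up.reach h'.q.succ.up hidx fun x => x.2.2)
        (CompR.add hl (h'.minGap fun y => y.2).up) hl))
  · unfold Inst.step
    split_ifs <;> rfl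

theorem CompI.solve (h : CompI sz f D) {s : ι → ℕ} (hs : CompN sz f s) :
    Comp sz f fun i => nvec ((D i).q + 1) ((D i).solve (s i)) := by
  have hT : CompN sz f fun i => ((D i).q + 2) * ((D i).q + 2) :=
    (h.q.add (CompN.const 2)).mul (h.q.add (CompN.const 2))
  refine Comp.hd (Comp.iterate (st := fun i t => encState (D i).q ((D i).run (s i) t)) hT ?_ ?_)
  · refine Comp.cons (Comp.vec h.q.succ CompN.zero.comp) (CompR.vec h.q.succ
      (CompR.ite ((CompN.idx h.q.succ).eq h.q.up) (CompR.sub CompR.zero ?_) CompR.zero))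
    refine Comp.up (CompR.sum (r := fun i c => ∑ o ∈ Finset.range (D i).p,
      ((D i).w c o * (D i).w c o + 1)) h.q (CompR.sum (r := fun x o =>
        (D x.1).w x.2 o * (D x.1).w x.2 o + 1) h.p.up ?_))
    have hw : CompR _ _ fun x : Σ y : Σ i, Fin (D i).q, Fin (D y.1).p =>
        (D x.1.1).w x.1.2 x.2 :=
      CompR.get₂ h.w.up.up (CompN.idx h.q).up (fun x => x.1.2.2.trans (Nat.lt_succ_self _))
        (CompN.idx h.p.up) fun x => x.2.2
    exact CompR.add (CompR.mul hw hw) Comp.one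
  · have hA := Comp.state (sz := sz) (f := f) (N := fun i => ((D i).q + 2) * ((D i).q + 2))
      (A := fun x => encState (D x.1).q ((D x.1).run (s x.1) x.2))
    exact CompS.step (D := fun x : Σ i, Fin (((D i).q + 2) * ((D i).q + 2)) => D x.1)
      (I := fun x => ((D x.1).run (s x.1) x.2).1) (lam := fun x => ((D x.1).run (s x.1) x.2).2)
      ⟨h.up.weaken _, hA.hd, fun x => (Inst.run_inv (h.wf x.1) (s x.1) x.2).1.sel.lt, hA.tl⟩
      (hs.up.weaken _)

end Algorithm

end RealWhile

/-! ### Access to the data of a descriptor system -/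

namespace RealWhile

theorem Comp.computesWithin {ι : Type} {sz : ι → ℕ} {f g : ι → Val} (h : Comp sz f g) :
    ∃ (P : Cmd) (p : Polynomial ℕ), ∀ i, ComputesWithin P (f i) (g i) (p.eval (sz i)) := by
  obtain ⟨c, _, p, hp⟩ := h
  refine ⟨c, p, fun i => ?_⟩
  obtain ⟨t, σ, ht, he, h0, -⟩ := hp i (initStore (f i)) (by simp [initStore])
  exact ⟨t, σ, ht, he, h0⟩

/-- The entries of a square matrix as a function on all pairs of natural numbers. -/
def ent {n : ℕ} (M : Matrix (Fin n) (Fin n) ℝ) (a b : ℕ) : ℝ :=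
  if h : a < n ∧ b < n then M ⟨a, h.1⟩ ⟨b, h.2⟩ else 0

def entP {n : ℕ} (M : Matrix (Fin n) (Fin n) Bool) (a b : ℕ) : Prop :=
  ∃ h : a < n ∧ b < n, M ⟨a, h.1⟩ ⟨b, h.2⟩ = true

@[simp] theorem ent_fin {n : ℕ} (M : Matrix (Fin n) (Fin n) ℝ) (a b : Fin n) :
    ent M a b = M a b := by simp [ent]

@[simp] theorem entP_fin {n : ℕ} (M : Matrix (Fin n) (Fin n) Bool) (a b : Fin n) :
    entP M a b ↔ M a b = true := by simp [entP]

/-- The data of a descriptor system are available. -/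
structure CompSys {ι : Type} (sz : ι → ℕ) (f : ι → Val) {n : ι → ℕ}
    (sys : ∀ i, DescriptorSystem (n i)) : Prop where
  n : CompN sz f n
  QF : Comp sz f fun i => Val.ofMatrix (sys i).QF
  QA : Comp sz f fun i => Val.ofMatrix (sys i).QA
  TF : Comp sz f fun i => Val.ofPattern (sys i).TF
  TA : Comp sz f fun i => Val.ofPattern (sys i).TA

section Access

variable {ι : Type} {sz N n : ι → ℕ} {f : ι → Val}

theorem ofMatrix_eq {n : ℕ} (M : Matrix (Fin n) (Fin n) ℝ) :
    Val.ofMatrix M = rmat n n (ent M) :=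
  ofVec_eq_vec _ _ fun i => (ofVec_eq_vec _ _ fun j => by simp).symm

theorem ofPattern_eq {n : ℕ} (M : Matrix (Fin n) (Fin n) Bool) :
    Val.ofPattern M = vec n fun i => pvec n (entP M i) :=
  ofVec_eq_vec _ _ fun i => (ofVec_eq_vec _ _ fun j => by
    rw [← Val.ofProp_eq_ofBool]
    exact Val.ofProp_congr (entP_fin M i j)).symm

open Classical in
theorem CompR.ent {M : ∀ i, Matrix (Fin (n i)) (Fin (n i)) ℝ} {a b : ι → ℕ} (hn : CompN sz f n)
    (hM : Comp sz f fun i => Val.ofMatrix (M i)) (ha : CompN sz f a) (hb : CompN sz f b) :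
    CompR sz f fun i => ent (M i) (a i) (b i) := by
  have h : Comp sz f fun i => if a i < n i ∧ b i < n i then
      Val.num (RealWhile.ent (M i) (a i) (b i)) else Val.num 0 := by
    refine Comp.iteDep (P := fun i => a i < n i ∧ b i < n i)
      (g := fun i => Val.num (RealWhile.ent (M i) (a i) (b i)))
      (h := fun _ => Val.num 0) ((ha.lt hn).and (hb.lt hn)) ?_ CompR.zero
    exact CompR.get₂ (ι := {i // a i < n i ∧ b i < n i}) (a := fun x => RealWhile.ent (M x.1))
      (N := fun x => n x.1) (M := fun x => n x.1) ((hM.reindex _).congr fun x => ofMatrix_eq _)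
      (ha.reindex _) (fun x => x.2.1) (hb.reindex _) fun x => x.2.2
  refine h.congr fun i => ?_
  split_ifs with hlt
  · rfl
  · dsimp only
    rw [RealWhile.ent, dif_neg hlt]

open Classical in
theorem CompP.entP {M : ∀ i, Matrix (Fin (n i)) (Fin (n i)) Bool} {a b : ι → ℕ}
    (hn : CompN sz f n) (hM : Comp sz f fun i => Val.ofPattern (M i)) (ha : CompN sz f a)
    (hb : CompN sz f b) : CompP sz f fun i => entP (M i) (a i) (b i) := by
  have h : Comp sz f fun i => if a i < n i ∧ b i < n i then
      Val.ofProp (RealWhile.entP (M i) (a i) (b i)) else Val.ofProp False := by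
    refine Comp.iteDep (P := fun i => a i < n i ∧ b i < n i)
      (g := fun i => Val.ofProp (RealWhile.entP (M i) (a i) (b i)))
      (h := fun _ => Val.ofProp False) ((ha.lt hn).and (hb.lt hn)) ?_ CompP.false
    have hM' : Comp (fun x : {i // a i < n i ∧ b i < n i} => sz x.1) (fun x => f x.1) fun x =>
        RealWhile.vec (n x.1) fun k => pvec (n x.1) (RealWhile.entP (M x.1) k) :=
      (hM.reindex _).congr fun x => ofPattern_eq _
    exact CompP.get (P := fun x : {i // a i < n i ∧ b i < n i} => RealWhile.entP (M x.1) (a x.1))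
      (Comp.get (ι := {i // a i < n i ∧ b i < n i}) (a := fun x k => pvec (n x.1) (RealWhile.entP (M x.1) k)) hM'
        (ha.reindex _) fun x => x.2.1) (hb.reindex _) fun x => x.2.2
  refine h.congr fun i => ?_
  split_ifs with hlt
  · rfl
  · exact Val.ofProp_congr ⟨False.elim, fun h => hlt h.1⟩

open Classical in
theorem CompR.entV {τ : ∀ i, Fin (n i) → ℝ} {a : ι → ℕ} (hn : CompN sz f n)
    (hM : Comp sz f fun i => Val.ofVec fun j => Val.num (τ i j)) (ha : CompN sz f a) :
    CompR sz f fun i => if h : a i < n i then τ i ⟨a i, h⟩ else 0 := by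
  have h : Comp sz f fun i => if a i < n i then
      Val.num (if h : a i < n i then τ i ⟨a i, h⟩ else 0) else Val.num 0 := by
    refine Comp.iteDep (P := fun i => a i < n i)
      (g := fun i => Val.num (if h : a i < n i then τ i ⟨a i, h⟩ else 0))
      (h := fun _ => Val.num 0) (ha.lt hn) ?_ CompR.zero
    exact CompR.get (ι := {i // a i < n i}) (a := fun x k => if h : k < n x.1 then τ x.1 ⟨k, h⟩ else 0)
      (N := fun x => n x.1) ((hM.reindex _).congr fun x => ofVec_eq_vec _ _ fun k => by simp)
      (ha.reindex _) fun x => x.2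
  refine h.congr fun i => ?_
  dsimp only
  split_ifs <;> rfl

variable {sys : ∀ i, DescriptorSystem (n i)}

theorem CompSys.reindex {κ : Type} (π : κ → ι) (h : CompSys sz f sys) :
    CompSys (fun x => sz (π x)) (fun x => f (π x)) fun x => sys (π x) :=
  ⟨h.n.reindex π, h.QF.reindex π, h.QA.reindex π, h.TF.reindex π, h.TA.reindex π⟩

theorem CompSys.weaken (a : ι → Val) (h : CompSys sz f sys) :
    CompSys sz (fun i => Val.cons (a i) (f i)) sys :=
  ⟨h.n.weaken a, h.QF.weaken a, h.QA.weaken a, h.TF.weaken a, h.TA.weaken a⟩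

theorem CompSys.up (h : CompSys sz f sys) : CompSys (bsz sz N) (benv f N) fun x => sys x.1 :=
  (h.reindex (fun x : Σ i, Fin (N i) => x.1)).weaken _

theorem CompSys.of_comp (hB : PolyBdd sz n) (h : Comp sz f fun i => Val.ofSystem (sys i)) :
    CompSys sz f sys :=
  ⟨Comp.length (a := fun i a => rvec (n i) (ent (sys i).QF a)) hB
    (h.hd.congr fun _ => ofMatrix_eq _), h.hd, h.tl.hd, h.tl.tl.hd, h.tl.tl.tl.hd⟩

/-- The free entries of `T_A` and `T_F`. -/
def freeP {n : ℕ} (sys : DescriptorSystem n) (a b : ℕ) : Prop := entP sys.TA a b ∨ entP sys.TF a b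

theorem CompSys.freeP (h : CompSys sz f sys) {a b : ι → ℕ} (ha : CompN sz f a)
    (hb : CompN sz f b) : CompP sz f fun i => freeP (sys i) (a i) (b i) :=
  (CompP.entP h.n h.TA ha hb).or (CompP.entP h.n h.TF ha hb)

/-- The entries of `Ω`. -/
noncomputable def om {n : ℕ} (sys : DescriptorSystem n) (v k : ℕ) : ℝ :=
  if v < n then ent sys.QA v k - ent sys.QF v k else if v = n + k then 1 else 0

theorem CompSys.om (h : CompSys sz f sys) {v k : ι → ℕ} (hv : CompN sz f v)
    (hk : CompN sz f k) : CompR sz f fun i => om (sys i) (v i) (k i) :=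
  CompR.ite (hv.lt h.n) ((CompR.ent h.n h.QA hv hk).sub (CompR.ent h.n h.QF hv hk))
    (CompR.ite (hv.eq (h.n.add hk)) Comp.one CompR.zero)

end Access

/-- The position of a row of `Ω`. -/
def pcode {n : ℕ} : Fin n ⊕ Fin n → ℕ
  | Sum.inl i => i
  | Sum.inr j => n + j

theorem pcode_lt {n : ℕ} (v : Fin n ⊕ Fin n) : pcode v < 2 * n := by
  rcases v with i | i <;> simp only [pcode] <;> omega

theorem pcode_injective {n : ℕ} : Function.Injective (pcode (n := n)) := by
  rintro (i | i) (j | j) h <;> simp only [pcode] at h <;> first | omega | skip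
  · rw [Fin.ext h]
  · rw [Fin.ext (by omega : (i : ℕ) = j)]

theorem om_pcode {n : ℕ} (sys : DescriptorSystem n) (v : Fin n ⊕ Fin n) (k : Fin n) :
    om sys (pcode v) k = sys.Omega v k := by
  rcases v with i | i
  · simp [om, pcode, DescriptorSystem.Omega]
  · simp [om, pcode, DescriptorSystem.Omega, Matrix.one_apply, Fin.ext_iff]

/-! ### Admissible matchings -/

section Matching

variable {n : ℕ}

open Classical in
/-- Selecting an admissible matching: option `1 + j` stands for the partner `x_j^Q`, and option
`n + 1` for the partner `w_i^Q`. -/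
noncomputable def matchInst (sys : DescriptorSystem n) : Inst where
  q := n
  p := n + 2
  d := n
  v c o k := if o = 0 then 0 else if o = n + 1 then om sys c k else
    if freeP sys c (o - 1) then om sys (n + (o - 1)) k else 0
  w _ _ := 0

theorem matchInst_wf (sys : DescriptorSystem n) : (matchInst sys).WF :=
  ⟨fun c => by funext k; simp [Inst.vect, matchInst], fun c => rfl, by simp [matchInst]⟩

/-- The matching that a selection stands for. -/
def matchOf (n : ℕ) (I : ℕ → ℕ) (i : Fin n) : Fin n ⊕ Fin n :=
  if h : I i - 1 < n then Sum.inr ⟨I i - 1, h⟩ else Sum.inl i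

/-- Size `n` forces a choice in every class. A forbidden partner carries the zero vector, which an
independent selection cannot contain. Injectivity comes for free: a partner used twice would give
two equal rows of `Ω_J`. -/
theorem isAdmissible_matchOf (sys : DescriptorSystem n) {I : ℕ → ℕ}
    (hI : (matchInst sys).IsSel I) (hi : (matchInst sys).Indep I)
    (hc : ((matchInst sys).supp I).card = n) : sys.IsAdmissible (matchOf n I) := by
  have hs : (matchInst sys).supp I = Finset.range n :=
    Finset.eq_of_subset_of_card_le (Finset.filter_subset _ _) (by simp [hc])
  have hI0 : ∀ i : Fin n, I i ≠ 0 := fun i => (Inst.mem_supp.1 (hs ▸ Finset.mem_range.2 i.2)).2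
  have hlt : ∀ c, I c < n + 2 := hI.lt
  have hli : LinearIndependent ℝ fun i k : Fin n => (matchInst sys).v i (I i) k := by
    have := hi
    rw [Inst.Indep, hs] at this
    exact LinearIndependent.comp this
      (fun i : Fin n => (⟨(i : ℕ), by simp⟩ : ((Finset.range n : Finset ℕ) : Set ℕ)))
      fun i j hij => Fin.ext (by simpa using hij)
  have hne := hli.ne_zero
  have key : ∀ i : Fin n, sys.HEdge i (matchOf n I i) ∧
      (fun k : Fin n => (matchInst sys).v i (I i) k) = sys.Omega (matchOf n I i) := by
    intro i
    have h1 := hI0 i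
    have h2 := hlt i
    have h3 := hne i
    unfold matchOf
    split_ifs with h
    · have ho : I i ≠ n + 1 := by omega
      by_cases hf : freeP sys i (I i - 1)
      · refine ⟨?_, ?_⟩
        · simpa [freeP, entP, DescriptorSystem.HEdge, h] using hf
        · funext k
          rw [← om_pcode]
          simp only [matchInst, h1, ho, hf, if_false, if_true, pcode]
      · exact absurd (by funext k; simp [matchInst, h1, ho, hf]) h3
    · have ho : I i = n + 1 := by omega
      refine ⟨rfl, ?_⟩
      funext k
      rw [← om_pcode]
      simp [matchInst, ho, pcode]
  have hli' : LinearIndependent ℝ (sys.OmegaJ (matchOf n I)).row := by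
    convert hli using 1
    funext i
    exact (key i).2.symm
  refine ⟨fun i => (key i).1, fun i j hij => hli'.injective ?_, hli'⟩
  funext k
  simp [DescriptorSystem.OmegaJ, Matrix.row, hij]

theorem exists_sel_of_isAdmissible (sys : DescriptorSystem n) {m : Fin n → Fin n ⊕ Fin n}
    (hm : sys.IsAdmissible m) : ∃ I, (matchInst sys).IsSel I ∧ (matchInst sys).Indep I ∧
      ((matchInst sys).supp I).card = n := by
  set I : ℕ → ℕ := fun i => if h : i < n then Sum.elim (fun _ => n + 1)
    (fun j : Fin n => (j : ℕ) + 1) (m ⟨i, h⟩) else 0 with hI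
  have hIf : ∀ i : Fin n, I i = Sum.elim (fun _ => n + 1) (fun j : Fin n => (j : ℕ) + 1) (m i) :=
    fun i => by simp [hI]
  have hs : (matchInst sys).supp I = Finset.range n := by
    refine Finset.filter_true_of_mem fun i hi => ?_
    rw [hIf ⟨i, Finset.mem_range.1 hi⟩]
    rcases m _ with j | j <;> simp
  refine ⟨I, ⟨fun c => ?_, fun c hc => dif_neg (not_lt.2 hc)⟩, ?_, by simp [hs]⟩
  · change _ < n + 2
    by_cases hc : c < n
    · rw [hIf ⟨c, hc⟩]
      rcases m _ with j | j <;> simp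
    · simp [hI, hc]
  · have key : ∀ i : Fin n, (fun k : Fin n => (matchInst sys).v i (I i) k) = sys.OmegaJ m i := by
      intro i
      funext k
      have he := hm.edge i
      simp only [matchInst, hIf, DescriptorSystem.OmegaJ, Matrix.submatrix_apply, id, ← om_pcode]
      rcases hmi : m i with j | j
      · rw [hmi] at he
        obtain rfl : j = i := he
        simp [pcode]
      · rw [hmi] at he
        have hf : freeP sys i j := by
          simp only [DescriptorSystem.HEdge] at he
          simpa [freeP, entP] using he
        have : (j : ℕ) ≠ n := by omega
        simp [pcode, hf, this]
    rw [Inst.Indep, hs]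
    have := hm.linearIndependent.comp
      (fun x : ((Finset.range n : Finset ℕ) : Set ℕ) => (⟨x, Finset.mem_range.1 x.2⟩ : Fin n))
      fun x y hxy => Subtype.ext (by simpa using hxy)
    rw [show (sys.OmegaJ m).row ∘ (fun x : ((Finset.range n : Finset ℕ) : Set ℕ) =>
      (⟨x, Finset.mem_range.1 x.2⟩ : Fin n)) = fun (x : ((Finset.range n : Finset ℕ) : Set ℕ))
        (k : Fin n) => (matchInst sys).v x (I x) k from
        funext fun x => (key ⟨x, Finset.mem_range.1 x.2⟩).symm] at this
    exact this

variable {ι : Type} {sz N : ι → ℕ} {n : ι → ℕ} {f : ι → Val} {sys : ∀ i, DescriptorSystem (n i)}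

theorem CompSys.matchInst (h : CompSys sz f sys) :
    CompI sz f fun i => matchInst (sys i) := by
  classical
  refine ⟨h.n, h.n.add (CompN.const 2), h.n, ?_, ?_, fun i => matchInst_wf _⟩
  · have hp := h.n.add (CompN.const (sz := sz) (f := f) 2)
    have hc := CompN.idx h.n.succ
    have ho := CompN.idx (hp.up (N := fun i => n i + 1))
    have hk := CompN.idx ((h.n.up (N := fun i => n i + 1)).up (N := fun i => n i.1 + 2))
    refine Comp.vec h.n.succ (CompR.mat 
      (a := fun x : Σ i, Fin (n i + 1) => (RealWhile.matchInst (sys x.1)).v x.2) hp.up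
      h.n.up (CompR.ite (ho.up.eq CompN.zero) CompR.zero (CompR.ite (ho.up.eq h.n.up.up.up.succ)
        (h.up.up.up.om hc.up.up hk) (CompR.ite (h.up.up.up.freeP hc.up.up (ho.up.sub CompN.one))
          (h.up.up.up.om (h.n.up.up.up.add (ho.up.sub CompN.one)) hk) CompR.zero))))
  · exact CompR.mat (a := fun i => (RealWhile.matchInst (sys i)).w) h.n.succ
      (h.n.add (CompN.const 2)) CompR.zero

theorem ofMatching_matchOf {n : ℕ} (I : ℕ → ℕ) : Val.ofMatching (matchOf n I) =
    vec n fun i => Val.cons (Val.ofProp (I i - 1 < n))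
      (Val.num ((if I i - 1 < n then I i - 1 else i : ℕ) : ℝ)) := by
  refine ofVec_eq_vec _ _ fun i => ?_
  unfold matchOf
  by_cases h : I i - 1 < n
  · simp [h, Val.ofPartner, Val.ofProp]
  · simp [h, Val.ofPartner, Val.ofProp]

open Classical in
theorem CompSys.matching (h : CompSys sz f sys) :
    Comp sz f fun i => if ((RealWhile.matchInst (sys i)).supp
        ((RealWhile.matchInst (sys i)).solve (n i))).card = n i then
      Val.found (Val.ofMatching (matchOf (n i) ((RealWhile.matchInst (sys i)).solve (n i))))
      else Val.nil := by
  have hlt : ∀ i c, (RealWhile.matchInst (sys i)).solve (n i) c < n i + 2 :=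
    fun i => (Inst.solve_spec (matchInst_wf (sys i)) (n i)).1.lt
  have hI : Comp sz f fun i => nvec (n i + 1) ((RealWhile.matchInst (sys i)).solve (n i)) :=
    h.matchInst.solve h.n
  generalize hJ : (fun i => (RealWhile.matchInst (sys i)).solve (n i)) = J at hI hlt
  have hJ' : ∀ i, (RealWhile.matchInst (sys i)).solve (n i) = J i := congrFun hJ
  simp only [hJ'] at hI hlt ⊢
  have hg : CompN (bsz sz n) (benv f n) fun x => J x.1 x.2 :=
    CompN.get (a := fun x => J x.1) (B := fun x => n x.1 + 2) hI.up (CompN.idx h.n)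
      (fun x => x.2.2.trans (Nat.lt_succ_self _)) (h.n.add (CompN.const 2)).up.bdd
      fun x => (hlt _ _).le
  have hcount : CompN sz f fun i => ((Finset.range (n i)).filter fun c => J i c ≠ 0).card :=
    CompN.count h.n (CompP.not (hg.eq CompN.zero))
  have hcond := (hg.sub CompN.one).lt h.n.up
  refine Comp.ite (hcount.eq h.n) (Comp.cons ?_ Comp.nil) Comp.nil
  refine (Comp.vec (a := fun i c => Val.cons (Val.ofProp (J i c - 1 < n i))
    (Val.num ((if J i c - 1 < n i then J i c - 1 else c : ℕ) : ℝ))) h.n (Comp.cons hcond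
      (CompN.ite hcond (hg.sub CompN.one) (CompN.idx h.n)).comp)).congr fun i => ?_
  rw [ofMatching_matchOf]

/-- An admissible matching is found in polynomial time. -/
theorem exists_matching_program : ∃ (P : Cmd) (p : Polynomial ℕ), ∀ (n : ℕ)
    (sys : DescriptorSystem n), ∃ out : Val, ComputesWithin P (Val.ofSystem sys) out (p.eval n) ∧
      ((∃ m, sys.IsAdmissible m ∧ out = Val.found (Val.ofMatching m)) ∨
        ((¬ ∃ m, sys.IsAdmissible m) ∧ out = Val.nil)) := by
  have hsys : CompSys (ι := Σ n, DescriptorSystem n) (fun i => i.1) (fun i => Val.ofSystem i.2)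
      fun i => i.2 := CompSys.of_comp PolyBdd.self Comp.id
  obtain ⟨P, p, hP⟩ := hsys.matching.computesWithin
  refine ⟨P, p, fun n sys => ⟨_, hP ⟨n, sys⟩, ?_⟩⟩
  obtain ⟨h1, h2, -, h4⟩ := Inst.solve_spec (matchInst_wf sys) n
  dsimp only
  split_ifs with h
  · exact Or.inl ⟨_, isAdmissible_matchOf sys h1 h2 h, rfl⟩
  · refine Or.inr ⟨?_, rfl⟩
    rintro ⟨m, hm⟩
    obtain ⟨J, hJ, hJi, hJc⟩ := exists_sel_of_isAdmissible sys hm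
    exact h4 h J hJ hJi hJc

end Matching

end RealWhile

/-! ### Strongly connected components of the auxiliary graph -/

namespace RealWhile

/-- `b` is reached from `a` in at most `t` steps through vertices below `N`. -/
def ReachIn (N : ℕ) (E : ℕ → ℕ → Prop) (a : ℕ) : ℕ → ℕ → Prop
  | 0, b => b = a
  | t + 1, b => ReachIn N E a t b ∨ ∃ c < N, ReachIn N E a t c ∧ E c b

theorem reachIn_iff {N : ℕ} {E : ℕ → ℕ → Prop} (hE : ∀ a b, E a b → a < N ∧ b < N) {a b : ℕ}
    (ha : a < N) : ReachIn N E a N b ↔ Relation.ReflTransGen E a b := by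
  have hsound : ∀ t b, ReachIn N E a t b → Relation.ReflTransGen E a b := by
    intro t
    induction t with
    | zero => rintro b rfl; exact .refl
    | succ t ih =>
      rintro b (h | ⟨c, -, h, he⟩)
      · exact ih b h
      · exact (ih c h).tail he
  refine ⟨hsound N b, fun h => ?_⟩
  classical
  set F : ℕ → Finset ℕ := fun t => (Finset.range N).filter fun b => ReachIn N E a t b with hF
  have hmem : ∀ {t b}, b ∈ F t ↔ b < N ∧ ReachIn N E a t b := by simp [hF]
  have hmono : Monotone F := monotone_nat_of_le_succ fun t b hb =>
    hmem.2 ⟨(hmem.1 hb).1, Or.inl (hmem.1 hb).2⟩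
  -- A set growing strictly in each of `N` rounds, starting from one vertex, would exceed `N`
  -- vertices.
  have hstable : ∃ t < N, F t = F (t + 1) := by
    by_contra hcon
    push Not at hcon
    have : ∀ t ≤ N, t + 1 ≤ (F t).card := by
      intro t
      induction t with
      | zero =>
        intro _
        exact Finset.card_pos.2 ⟨a, hmem.2 ⟨ha, rfl⟩⟩
      | succ t ih =>
        intro ht
        have := Finset.card_lt_card ((hmono (by omega : t ≤ t + 1)).ssubset_of_ne (hcon t (by omega)))
        have := ih (by omega)
        omega
    have h1 := this N le_rfl
    have h2 : (F N).card ≤ N := by simpa using Finset.card_filter_le (Finset.range N) _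
    omega
  obtain ⟨t, ht, heq⟩ := hstable
  have hb : b ∈ F t := by
    induction h with
    | refl => exact hmono (Nat.zero_le t) (hmem.2 ⟨ha, rfl⟩)
    | @tail c b _ he ih =>
      rw [heq]
      exact hmem.2 ⟨(hE _ _ he).2, Or.inr ⟨c, (hmem.1 ih).1, (hmem.1 ih).2, he⟩⟩
  exact (hmem.1 (hmono ht.le hb)).2

section Generic

variable {ι : Type} {sz N : ι → ℕ} {f : ι → Val}

theorem CompP.reach {E : ι → ℕ → ℕ → Prop} {a b : ι → ℕ} (hN : CompN sz f N)
    (hE : Comp sz f fun i => RealWhile.vec (N i) fun c => pvec (N i) (E i c))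
    (hlt : ∀ i a b, E i a b → a < N i ∧ b < N i) (ha : CompN sz f a) (ha' : ∀ i, a i < N i)
    (hb : CompN sz f b) (hb' : ∀ i, b i < N i) :
    CompP sz f fun i => Relation.ReflTransGen (E i) (a i) (b i) := by
  have h : Comp sz f fun i => pvec (N i) (ReachIn (N i) (E i) (a i) (N i)) := by
    refine Comp.iterate (st := fun i t => pvec (N i) (ReachIn (N i) (E i) (a i) t)) hN
      (Comp.vec hN ((CompN.idx hN).eq ha.up)) ?_
    set A : (Σ i, Fin (N i)) → Val := fun x => pvec (N x.1) (ReachIn (N x.1) (E x.1) (a x.1) x.2)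
    have hst : Comp (bsz sz N) (fun x => Val.cons (A x) (benv f N x)) A := Comp.state
    have hN' := (hN.up (N := N)).weaken A
    have hE' := (hE.up (N := N)).weaken A
    refine Comp.vec (a := fun x b => Val.ofProp (ReachIn (N x.1) (E x.1) (a x.1) (x.2 + 1) b)) hN' ?_
    have hidx := CompN.idx hN'
    refine CompP.or (CompP.get (P := fun y => ReachIn (N y.1.1) (E y.1.1) (a y.1.1) y.1.2)
      hst.up hidx fun y => y.2.2) (CompP.ex (P := fun y c =>
        ReachIn (N y.1.1) (E y.1.1) (a y.1.1) y.1.2 c ∧ E y.1.1 c y.2) hN'.up (CompP.and ?_ ?_))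
    · exact CompP.get (P := fun z : Σ y : Σ x : Σ i, Fin (N i), Fin (N x.1), Fin (N y.1.1) =>
        ReachIn (N z.1.1.1) (E z.1.1.1) (a z.1.1.1) z.1.1.2) hst.up.up (CompN.idx hN'.up) fun y => y.2.2
    · exact CompP.get (P := fun z : Σ y : Σ x : Σ i, Fin (N i), Fin (N x.1), Fin (N y.1.1) => E z.1.1.1 z.2)
        (Comp.get (a := fun z c =>
        pvec (N z.1.1.1) (E z.1.1.1 c)) hE'.up.up (CompN.idx hN'.up) fun y => y.2.2) hidx.up
        fun y => y.1.2.2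
  exact (CompP.get h hb hb').congr fun i => reachIn_iff (hlt i) (ha' i)

end Generic

/-- The position of a vertex of the auxiliary graph. -/
def ncode {n : ℕ} : AuxNode n → ℕ
  | AuxNode.wT i => i
  | AuxNode.wQ i => n + i
  | AuxNode.xQ i => 2 * n + i
  | AuxNode.xT i => 3 * n + i

theorem ncode_lt {n : ℕ} (v : AuxNode n) : ncode v < 4 * n := by
  rcases v with i | i | i | i <;> simp only [ncode] <;> omega

theorem ncode_injective {n : ℕ} : Function.Injective (ncode (n := n)) := by
  rintro (i | i | i | i) (j | j | j | j) h <;> simp only [ncode] at h <;> first | omega | skip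
  all_goals rw [Fin.ext (by omega : (i : ℕ) = j)]

theorem exists_ncode {n c : ℕ} (hc : c < 4 * n) : ∃ v : AuxNode n, ncode v = c := by
  by_cases h1 : c < n
  · exact ⟨AuxNode.wT ⟨c, h1⟩, rfl⟩
  by_cases h2 : c < 2 * n
  · exact ⟨AuxNode.wQ ⟨c - n, by omega⟩, by simp only [ncode]; omega⟩
  by_cases h3 : c < 3 * n
  · exact ⟨AuxNode.xQ ⟨c - 2 * n, by omega⟩, by simp only [ncode]; omega⟩
  · exact ⟨AuxNode.xT ⟨c - 3 * n, by omega⟩, by simp only [ncode]; omega⟩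

theorem ncode_qNode {n : ℕ} (v : Fin n ⊕ Fin n) :
    ncode (DescriptorSystem.qNode v) = n + pcode v := by
  rcases v with i | i <;> simp only [DescriptorSystem.qNode, ncode, pcode]
  omega

/-- The matching on positions. -/
def mcode {n : ℕ} (m : Fin n → Fin n ⊕ Fin n) (i : ℕ) : ℕ := if h : i < n then pcode (m ⟨i, h⟩) else 0

@[simp] theorem mcode_fin {n : ℕ} (m : Fin n → Fin n ⊕ Fin n) (i : Fin n) :
    mcode m i = pcode (m i) := by simp [mcode]

section Graph

variable {n : ℕ} (sys : DescriptorSystem n) (m : Fin n → Fin n ⊕ Fin n)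

/-- The edges on positions. -/
def ecode (a b : ℕ) : Prop := ∃ u v, sys.AuxEdge m u v ∧ ncode u = a ∧ ncode v = b

variable {sys m}

theorem reflTransGen_ecode {u v : AuxNode n} :
    Relation.ReflTransGen (ecode sys m) (ncode u) (ncode v) ↔
      Relation.ReflTransGen (sys.AuxEdge m) u v := by
  refine ⟨fun h => ?_, fun h => h.lift ncode fun a b hab => ⟨a, b, hab, rfl, rfl⟩⟩
  suffices H : ∀ c, Relation.ReflTransGen (ecode sys m) (ncode u) c → ∀ v, ncode v = c →
      Relation.ReflTransGen (sys.AuxEdge m) u v from H _ h v rfl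
  intro c hc
  induction hc with
  | refl => intro v hv; rw [ncode_injective hv]
  | tail _ he ih =>
    obtain ⟨x, y, hxy, hx, hy⟩ := he
    intro v hv
    rw [ncode_injective (hv.trans hy.symm)]
    exact (ih x hx).tail hxy

/-- Row `v` of `Ω̃` holds the coordinates of row `v` of `Ω` in the basis formed by the rows of
`Ω_J`. A coordinate vanishes iff the remaining basis vectors suffice, so the span test replaces the
inverse matrix. -/
theorem omegaTilde_eq_zero_iff (hm : sys.IsAdmissible m) (v : Fin n ⊕ Fin n) (i : Fin n) :
    sys.OmegaTilde m v i = 0 ↔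
      InSpan n n (fun t k => if t = i then 0 else om sys (mcode m t) k) (om sys (pcode v)) := by
  have hu : IsUnit (sys.OmegaJ m) := Matrix.linearIndependent_rows_iff_isUnit.1 hm.linearIndependent
  have hdet : IsUnit (sys.OmegaJ m).det := (Matrix.isUnit_iff_isUnit_det _).1 hu
  have hmul : sys.OmegaTilde m * sys.OmegaJ m = sys.Omega := by
    rw [DescriptorSystem.OmegaTilde, Matrix.mul_assoc, Matrix.nonsing_inv_mul _ hdet, Matrix.mul_one]
  have hrow : sys.Omega v = ∑ j, sys.OmegaTilde m v j • sys.OmegaJ m j := by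
    funext k
    rw [← hmul]
    simp [Matrix.mul_apply]
  have hx : (fun k : Fin n => om sys (pcode v) k) = sys.Omega v := funext fun k => om_pcode sys v k
  have himg : (fun t (k : Fin n) => if t = (i : ℕ) then (0 : ℝ) else om sys (mcode m t) k) ''
      {t | t < n} = Set.range fun j : Fin n => if j = i then 0 else sys.OmegaJ m j := by
    ext y
    constructor
    · rintro ⟨t, ht, rfl⟩
      refine ⟨⟨t, ht⟩, ?_⟩
      dsimp only
      by_cases hti : t = i
      · rw [if_pos (Fin.ext hti)]; funext k; simp [hti]
      · rw [if_neg fun h : (⟨t, ht⟩ : Fin n) = i => hti (congrArg Fin.val h)]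
        funext k
        rw [if_neg hti, show mcode m t = pcode (m ⟨t, ht⟩) from mcode_fin m ⟨t, ht⟩, om_pcode]
        rfl
    · rintro ⟨j, rfl⟩
      refine ⟨j, j.2, ?_⟩
      funext k
      by_cases hji : j = i
      · simp [hji]
      · have : (j : ℕ) ≠ i := fun h => hji (Fin.ext h)
        simp [hji, this, om_pcode, DescriptorSystem.OmegaJ]
  rw [inSpan_iff, hx, himg, Submodule.mem_span_range_iff_exists_fun]
  constructor
  · intro h
    refine ⟨sys.OmegaTilde m v, ?_⟩
    rw [hrow]
    refine Finset.sum_congr rfl fun j _ => ?_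
    by_cases hji : j = i
    · simp [hji, h]
    · simp [hji]
  · rintro ⟨c, hc⟩
    have hli := Fintype.linearIndependent_iff.1 hm.linearIndependent
      (fun j => sys.OmegaTilde m v j - if j = i then 0 else c j) (by
        simp only [sub_smul, Finset.sum_sub_distrib]
        rw [sub_eq_zero]
        refine Eq.trans hrow.symm (hc.symm.trans (Finset.sum_congr rfl fun j _ => ?_))
        by_cases hji : j = i <;> simp [hji, Matrix.row]) i
    simpa using hli

theorem ecode_iff (hm : sys.IsAdmissible m) (a b : ℕ) : ecode sys m a b ↔
    (∃ i < n, ∃ j < n, (a = i ∧ b = 2 * n + j) ∧ freeP sys i j ∧ mcode m i ≠ n + j) ∨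
    (∃ i < n, ∃ j < n, (a = 2 * n + j ∧ b = i) ∧ freeP sys i j ∧ mcode m i = n + j) ∨
    (∃ i < n, (a = i ∧ b = n + i) ∧ mcode m i ≠ i) ∨
    (∃ i < n, (a = n + i ∧ b = i) ∧ mcode m i = i) ∨
    ∃ v < 2 * n, ∃ i < n, (a = n + v ∧ b = n + mcode m i) ∧ (∀ j < n, mcode m j ≠ v) ∧
      ¬ InSpan n n (fun t k => if t = i then 0 else om sys (mcode m t) k) (om sys v) := by
  have hr : ∀ i j : Fin n, mcode m i = n + j ↔ m i = Sum.inr j := fun i j => by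
    rw [mcode_fin, show n + (j : ℕ) = pcode (Sum.inr j : Fin n ⊕ Fin n) from rfl,
      pcode_injective.eq_iff]
  have hl : ∀ i : Fin n, mcode m i = i ↔ m i = Sum.inl i := fun i => by
    rw [mcode_fin]
    exact pcode_injective.eq_iff (b := (Sum.inl i : Fin n ⊕ Fin n))
  have hf : ∀ i j : Fin n, freeP sys i j ↔ sys.TA i j = true ∨ sys.TF i j = true := fun i j => by
    simp [freeP]
  constructor
  · rintro ⟨u, w, h, rfl, rfl⟩
    cases h with
    | free i j h hm => exact Or.inl ⟨i, i.2, j, j.2, ⟨rfl, rfl⟩, (hf i j).2 h, fun e => hm ((hr i j).1 e)⟩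
    | freeMatched i j h hm =>
      exact Or.inr (Or.inl ⟨i, i.2, j, j.2, ⟨rfl, rfl⟩, (hf i j).2 h, (hr i j).2 hm⟩)
    | own i hm => exact Or.inr (Or.inr (Or.inl ⟨i, i.2, ⟨rfl, rfl⟩, fun e => hm ((hl i).1 e)⟩))
    | ownMatched i hm =>
      exact Or.inr (Or.inr (Or.inr (Or.inl ⟨i, i.2, ⟨rfl, rfl⟩, (hl i).2 hm⟩)))
    | fixed v i hv h =>
      refine Or.inr (Or.inr (Or.inr (Or.inr ⟨pcode v, pcode_lt v, i, i.2,
        ⟨ncode_qNode v, by rw [ncode_qNode, mcode_fin]⟩, fun j hj e => hv ⟨⟨j, hj⟩, ?_⟩,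
        fun e => h ((omegaTilde_eq_zero_iff hm v i).2 e)⟩)))
      exact pcode_injective ((mcode_fin m ⟨j, hj⟩).symm.trans e)
  · rintro (⟨i, hi, j, hj, ⟨rfl, rfl⟩, h, h'⟩ | ⟨i, hi, j, hj, ⟨rfl, rfl⟩, h, h'⟩ |
      ⟨i, hi, ⟨rfl, rfl⟩, h'⟩ | ⟨i, hi, ⟨rfl, rfl⟩, h'⟩ | ⟨v, hv, i, hi, ⟨rfl, rfl⟩, h, h'⟩)
    · exact ⟨_, _, .free ⟨_, hi⟩ ⟨j, hj⟩ ((hf ⟨_, hi⟩ ⟨j, hj⟩).1 h)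
        fun e => h' ((hr ⟨_, hi⟩ ⟨j, hj⟩).2 e), rfl, rfl⟩
    · exact ⟨_, _, .freeMatched ⟨_, hi⟩ ⟨j, hj⟩ ((hf ⟨_, hi⟩ ⟨j, hj⟩).1 h)
        ((hr ⟨_, hi⟩ ⟨j, hj⟩).1 h'), rfl, rfl⟩
    · exact ⟨_, _, .own ⟨_, hi⟩ fun e => h' ((hl ⟨_, hi⟩).2 e), rfl, rfl⟩
    · exact ⟨_, _, .ownMatched ⟨_, hi⟩ ((hl ⟨_, hi⟩).1 h'), rfl, rfl⟩
    · obtain ⟨w, rfl⟩ : ∃ w : Fin n ⊕ Fin n, pcode w = v := by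
        by_cases hvn : v < n
        · exact ⟨Sum.inl ⟨v, hvn⟩, rfl⟩
        · exact ⟨Sum.inr ⟨v - n, by omega⟩, by simp only [pcode]; omega⟩
      refine ⟨_, _, .fixed w ⟨i, hi⟩ ?_ fun e => h' ((omegaTilde_eq_zero_iff hm w ⟨i, hi⟩).1 e),
        ncode_qNode w, ?_⟩
      · rintro ⟨j, rfl⟩
        exact h j j.2 (mcode_fin m j)
      · rw [ncode_qNode, ← mcode_fin]

end Graph

section Access

variable {ι : Type} {sz N n : ι → ℕ} {f : ι → Val} {sys : ∀ i, DescriptorSystem (n i)}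
  {m : ∀ i, Fin (n i) → Fin (n i) ⊕ Fin (n i)}

/-- The data of a descriptor system and an admissible matching are available. -/
structure CompMat {l : ι → ℕ} (sz : ι → ℕ) (f : ι → Val) (sys : ∀ i, DescriptorSystem (l i))
    (m : ∀ i, Fin (l i) → Fin (l i) ⊕ Fin (l i)) : Prop extends CompSys sz f sys where
  mat : Comp sz f fun i => nvec (l i) (mcode (m i))
  adm : ∀ i, (sys i).IsAdmissible (m i)

theorem CompMat.reindex {κ : Type} (π : κ → ι) (h : CompMat sz f sys m) :
    CompMat (fun x => sz (π x)) (fun x => f (π x)) (fun x => sys (π x)) fun x => m (π x) :=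
  ⟨h.toCompSys.reindex π, h.mat.reindex π, fun x => h.adm (π x)⟩

theorem CompMat.weaken (a : ι → Val) (h : CompMat sz f sys m) :
    CompMat sz (fun i => Val.cons (a i) (f i)) sys m :=
  ⟨h.toCompSys.weaken a, h.mat.weaken a, h.adm⟩

theorem CompMat.up (h : CompMat sz f sys m) :
    CompMat (bsz sz N) (benv f N) (fun x => sys x.1) fun x => m x.1 :=
  (h.reindex (fun x : Σ i, Fin (N i) => x.1)).weaken _

theorem mcode_le {n : ℕ} (m : Fin n → Fin n ⊕ Fin n) (i : ℕ) : mcode m i ≤ 2 * n := by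
  unfold mcode
  split_ifs
  · exact (pcode_lt _).le
  · omega

theorem CompMat.get (h : CompMat sz f sys m) {a : ι → ℕ} (ha : CompN sz f a)
    (hlt : ∀ i, a i < n i) : CompN sz f fun i => mcode (m i) (a i) :=
  CompN.get (a := fun i => mcode (m i)) h.mat ha hlt ((CompN.const 2).mul h.n).bdd
    fun _ => mcode_le _ _

theorem CompMat.of_comp (hB : PolyBdd sz n) (hs : Comp sz f fun i => Val.ofSystem (sys i))
    (hm : Comp sz f fun i => Val.ofMatching (m i)) (adm : ∀ i, (sys i).IsAdmissible (m i)) :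
    CompMat sz f sys m := by
  have h : CompSys sz f sys := CompSys.of_comp hB hs
  refine ⟨h, ?_, adm⟩
  set a : ι → ℕ → Val := fun i k => if h : k < n i then Val.ofPartner (m i ⟨k, h⟩) else Val.nil
  have ha : Comp sz f fun i => vec (n i) (a i) :=
    hm.congr fun i => ofVec_eq_vec _ _ fun k => by simp [a]
  have hg : Comp (bsz sz n) (benv f n) fun x => a x.1 x.2 :=
    Comp.get (a := fun x => a x.1) ha.up (CompN.idx h.n) fun x => x.2.2
  have hP : CompP (bsz sz n) (benv f n) fun x => n x.1 ≤ mcode (m x.1) x.2 := by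
    refine hg.hd.congr fun x => ?_
    simp only [a, x.2.2, dif_pos, mcode]
    rcases m x.1 x.2 with j | j
    · simp [Val.ofPartner, Val.hd, pcode, Val.ofProp, not_le.2 j.2]
    · simp [Val.ofPartner, Val.hd, pcode, Val.ofProp]
  have hR := hg.tl
  classical
  refine Comp.vec h.n ?_
  refine (Comp.ite hP (Comp.bin Expr.add (Val.arith fun x y => x + y) (fun _ _ _ => rfl)
    h.n.up.comp hR) hR).congr fun x => ?_
  simp only [a, x.2.2, dif_pos, mcode]
  rcases m x.1 x.2 with j | j
  · simp [Val.ofPartner, Val.tl, pcode, not_le.2 j.2]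
  · simp [Val.ofPartner, Val.tl, pcode, Val.arith]

theorem CompMat.ecode (h : CompMat sz f sys m) {a b : ι → ℕ} (ha : CompN sz f a)
    (hb : CompN sz f b) : CompP sz f fun i => ecode (sys i) (m i) (a i) (b i) := by
  have two : ∀ {κ : Type} {s K : κ → ℕ} {e : κ → Val}, CompN s e K →
      CompN s e fun i => 2 * K i := fun hK => (CompN.const 2).mul hK
  have hi := CompN.idx h.n
  have hj := CompN.idx (h.n.up (N := n))
  have h1 := h.up (N := n)
  have h2 := h1.up (N := fun x => n x.1)
  have hmi := h1.get hi fun x => x.2.2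
  refine CompP.congr (CompP.or (CompP.ex h.n (CompP.ex h.n.up ?_)) (CompP.or
    (CompP.ex h.n (CompP.ex h.n.up ?_)) (CompP.or (CompP.ex h.n ?_) (CompP.or (CompP.ex h.n ?_)
      (CompP.ex (two h.n) (CompP.ex h.n.up ?_)))))) fun i => (ecode_iff (h.adm i) _ _).symm
  · exact ((ha.up.up.eq hi.up).and (hb.up.up.eq ((two h2.n).add hj))).and
      ((h2.freeP hi.up hj).and (hmi.up.eq (h2.n.add hj)).not)
  · exact ((ha.up.up.eq ((two h2.n).add hj)).and (hb.up.up.eq hi.up)).and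
      ((h2.freeP hi.up hj).and (hmi.up.eq (h2.n.add hj)))
  · exact ((ha.up.eq hi).and (hb.up.eq (h1.n.add hi))).and (hmi.eq hi).not
  · exact ((ha.up.eq (h1.n.add hi)).and (hb.up.eq hi)).and (hmi.eq hi)
  · have hv := CompN.idx (two h.n)
    have k2 := (h.up (N := fun i => 2 * n i)).up (N := fun x => n x.1)
    have k3 := k2.up (N := fun x => n x.1.1)
    have hi' := CompN.idx (h.n.up (N := fun i => 2 * n i))
    refine ((ha.up.up.eq (k2.n.add hv.up)).and (hb.up.up.eq (k2.n.add (k2.get hi' fun x => x.2.2)))).and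
      (CompP.and (CompP.all (P := fun x j => mcode (m x.1.1) j ≠ x.1.2) k2.n
        ((k3.get (CompN.idx k2.n) fun x => x.2.2).eq hv.up.up).not) (CompP.not (CompP.inSpan
          (u := fun x t k => if t = x.2 then 0 else om (sys x.1.1) (mcode (m x.1.1) t) k)
          (x := fun x => om (sys x.1.1) x.1.2) k2.n k2.n (CompR.mat (a := fun x t k =>
            if t = x.2 then 0 else om (sys x.1.1) (mcode (m x.1.1) t) k) k2.n k2.n ?_)
          (CompR.vec (a := fun x => om (sys x.1.1) x.1.2) k2.n (k3.om hv.up.up (CompN.idx k2.n))))))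
    exact CompR.ite ((CompN.idx k2.n).up.eq hi'.up.up) CompR.zero
      (k3.up.om (k3.get (CompN.idx k2.n) fun x => x.2.2).up (CompN.idx k3.n))

/-- Reachability on positions. -/
def reachP {n : ℕ} (sys : DescriptorSystem n) (m : Fin n → Fin n ⊕ Fin n) (a b : ℕ) : Prop :=
  (a < 4 * n ∧ b < 4 * n) ∧ Relation.ReflTransGen (ecode sys m) a b

theorem reachP_ncode {n : ℕ} {sys : DescriptorSystem n} {m : Fin n → Fin n ⊕ Fin n}
    {u v : AuxNode n} :
    reachP sys m (ncode u) (ncode v) ↔ Relation.ReflTransGen (sys.AuxEdge m) u v := by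
  rw [reachP, reflTransGen_ecode, and_iff_right ⟨ncode_lt u, ncode_lt v⟩]

theorem CompMat.reachP (h : CompMat sz f sys m) {a b : ι → ℕ} (ha : CompN sz f a)
    (hb : CompN sz f b) : CompP sz f fun i => reachP (sys i) (m i) (a i) (b i) := by
  classical
  have h4 : CompN sz f fun i => 4 * n i := (CompN.const 4).mul h.n
  set P : ι → Prop := fun i => a i < 4 * n i ∧ b i < 4 * n i with hP
  have key : CompP (fun x : {i // P i} => sz x.1) (fun x => f x.1) fun x =>
      Relation.ReflTransGen (RealWhile.ecode (sys x.1) (m x.1)) (a x.1) (b x.1) := by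
    have h' := h.reindex fun x : {i // P i} => x.1
    have h4' := h4.reindex fun x : {i // P i} => x.1
    refine CompP.reach h4' (Comp.vec h4' (Comp.vec h4'.up
      (h'.up.up.ecode (CompN.idx h4').up (CompN.idx h4'.up)))) ?_ (ha.reindex _)
      (fun x => x.2.1) (hb.reindex _) fun x => x.2.2
    rintro i _ _ ⟨u, v, -, rfl, rfl⟩
    exact ⟨ncode_lt u, ncode_lt v⟩
  refine (Comp.iteDep (P := P) (g := fun i => Val.ofProp
    (Relation.ReflTransGen (RealWhile.ecode (sys i) (m i)) (a i) (b i)))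
    (h := fun _ => Val.ofProp False) ((ha.lt h4).and (hb.lt h4)) key CompP.false).congr fun i => ?_
  split_ifs with hi
  · exact Val.ofProp_congr (and_iff_right hi).symm
  · exact Val.ofProp_congr ⟨False.elim, fun h => hi h.1⟩

end Access

/-! ### Isolated components -/

section Isolated

variable {n : ℕ} {sys : DescriptorSystem n} {m : Fin n → Fin n ⊕ Fin n} {rule : IsolationRule}

/-- Two positions are in the same component. -/
def sameP (sys : DescriptorSystem n) (m : Fin n → Fin n ⊕ Fin n) (a b : ℕ) : Prop :=
  reachP sys m a b ∧ reachP sys m b a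

/-- The component of a position is isolated. -/
def isoP (sys : DescriptorSystem n) (m : Fin n → Fin n ⊕ Fin n) (rule : IsolationRule) (a : ℕ) :
    Prop :=
  match rule with
  | IsolationRule.noOutgoing => ∀ c < 4 * n, reachP sys m a c → reachP sys m c a
  | IsolationRule.noIncoming => ∀ c < 4 * n, reachP sys m c a → reachP sys m a c

theorem mem_component_self (v : AuxNode n) : v ∈ sys.component m v := ⟨.refl, .refl⟩

theorem component_eq_iff {u v : AuxNode n} :
    sys.component m u = sys.component m v ↔ v ∈ sys.component m u := by
  refine ⟨fun h => h ▸ mem_component_self v, fun h => Set.ext fun w => ?_⟩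
  exact ⟨fun hw => ⟨h.2.trans hw.1, hw.2.trans h.1⟩, fun hw => ⟨h.1.trans hw.1, hw.2.trans h.2⟩⟩

theorem sameP_iff {u v : AuxNode n} :
    sameP sys m (ncode u) (ncode v) ↔ sys.component m u = sys.component m v := by
  rw [component_eq_iff, sameP, reachP_ncode, reachP_ncode]
  rfl

/-- If no edge leaves (or enters) the component, induction along a path keeps the path inside it. So
isolation is the statement that reachability from (or to) the vertex is symmetric. -/
theorem isoP_iff {v : AuxNode n} :
    isoP sys m rule (ncode v) ↔ sys.IsIsolated m rule (sys.component m v) := by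
  have hall : ∀ P : ℕ → Prop, (∀ c < 4 * n, P c) ↔ ∀ w : AuxNode n, P (ncode w) := fun P =>
    ⟨fun h w => h _ (ncode_lt w), fun h c hc => by
      obtain ⟨w, rfl⟩ := exists_ncode hc
      exact h w⟩
  cases rule <;> simp only [DescriptorSystem.IsIsolated] <;> rw [and_iff_right ⟨v, rfl⟩]
  · simp only [isoP, hall, reachP_ncode]
    refine ⟨fun h u w hu he => ⟨hu.1.tail he, h w (hu.1.tail he)⟩, fun h w hw => ?_⟩
    suffices w ∈ sys.component m v from this.2
    induction hw with
    | refl => exact mem_component_self v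
    | tail _ he ih => exact h _ _ ih he
  · simp only [isoP, hall, reachP_ncode]
    refine ⟨fun h u w hw he => ⟨h u (hw.2.head he), hw.2.head he⟩, fun h w hw => ?_⟩
    suffices w ∈ sys.component m v from this.1
    induction hw using Relation.ReflTransGen.head_induction_on with
    | refl => exact mem_component_self v
    | head he _ ih => exact h _ _ ih he

open Classical in
/-- Vectors that are independent on a set exactly if it contains no isolated component. -/
noncomputable def isoVec (sys : DescriptorSystem n) (m : Fin n → Fin n ⊕ Fin n)
    (rule : IsolationRule) (j k : ℕ) : ℝ :=
  if isoP sys m rule j then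
    if sameP sys m j k then
      (if k = j then (((Finset.range n).filter fun i => sameP sys m j i).card : ℝ) else 0) - 1
    else 0
  else if k = j then 1 else 0

end Isolated

section Access

variable {ι : Type} {sz N n : ι → ℕ} {f : ι → Val} {sys : ∀ i, DescriptorSystem (n i)}
  {m : ∀ i, Fin (n i) → Fin (n i) ⊕ Fin (n i)} {rule : IsolationRule}

theorem CompMat.sameP (h : CompMat sz f sys m) {a b : ι → ℕ} (ha : CompN sz f a)
    (hb : CompN sz f b) : CompP sz f fun i => sameP (sys i) (m i) (a i) (b i) :=
  (h.reachP ha hb).and (h.reachP hb ha)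

theorem CompMat.isoP (h : CompMat sz f sys m) {a : ι → ℕ} (ha : CompN sz f a) :
    CompP sz f fun i => isoP (sys i) (m i) rule (a i) := by
  have h4 : CompN sz f fun i => 4 * n i := (CompN.const 4).mul h.n
  cases rule
  · exact CompP.all h4 ((h.up.reachP ha.up (CompN.idx h4)).imp (h.up.reachP (CompN.idx h4) ha.up))
  · exact CompP.all h4 ((h.up.reachP (CompN.idx h4) ha.up).imp (h.up.reachP ha.up (CompN.idx h4)))

theorem CompMat.isoVec (h : CompMat sz f sys m) {j k : ι → ℕ} (hj : CompN sz f j)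
    (hk : CompN sz f k) : CompR sz f fun i => isoVec (sys i) (m i) rule (j i) (k i) := by
  classical
  exact CompR.ite (h.isoP hj) (CompR.ite (h.sameP hj hk) (CompR.sub (CompR.ite (hk.eq hj)
    (CompN.count h.n (h.up.sameP hj.up (CompN.idx h.n))).real CompR.zero) Comp.one) CompR.zero)
    (CompR.ite (hk.eq hj) Comp.one CompR.zero)

end Access

end RealWhile

/-! ### The second matroid -/

open IndepSystem

section Partition

variable {V α : Type*} [DecidableEq α]

theorem ofRank_card_image_iff (g : V → α) (p : V → Prop) [DecidablePred p] (X : Finset V) :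
    ofRank (fun S => ((S.filter p).image g).card) X ↔ (∀ i ∈ X, p i) ∧ Set.InjOn g X := by
  rw [ofRank]
  constructor
  · intro h
    have h1 := Finset.card_image_le (s := X.filter p) (f := g)
    have h2 := Finset.card_filter_le X p
    have h3 : X.filter p = X := Finset.eq_of_subset_of_card_le (Finset.filter_subset _ _) (by omega)
    rw [h3] at h
    exact ⟨Finset.filter_eq_self.1 h3, Finset.card_image_iff.1 h⟩
  · rintro ⟨h1, h2⟩
    rw [Finset.filter_eq_self.2 h1, Finset.card_image_of_injOn h2]

variable [Fintype V] [DecidableEq V]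

/-- The dual of a partition matroid. -/
theorem dualIndep_card_image_iff (g : V → α) (p : V → Prop) [DecidablePred p] (S : Finset V) :
    dualIndep (ofRank fun S => ((S.filter p).image g).card) Sᶜ ↔
      ∀ i, p i → ∃ j ∈ S, p j ∧ g j = g i := by
  have hsub : ∀ B : Finset V, Sᶜ ⊆ Bᶜ ↔ B ⊆ S := fun B => compl_le_compl_iff_le
  simp only [dualIndep, IsBasis, hsub, ofRank_card_image_iff]
  constructor
  · rintro ⟨B, ⟨⟨h1, h2⟩, hmax⟩, hBS⟩ i hi
    by_cases hg : g i ∈ B.image g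
    · obtain ⟨j, hj, hji⟩ := Finset.mem_image.1 hg
      exact ⟨j, hBS hj, h1 j hj, hji⟩
    · have hiB : i ∉ B := fun h => hg (Finset.mem_image_of_mem g h)
      have := hmax (insert i B) ⟨fun j hj => ?_, ?_⟩ (Finset.subset_insert _ _)
      · exact absurd (this ▸ Finset.mem_insert_self i B) hiB
      · rcases Finset.mem_insert.1 hj with rfl | hj
        · exact hi
        · exact h1 j hj
      · rw [Finset.coe_insert, Set.injOn_insert (by simpa using hiB)]
        exact ⟨h2, fun h => hg (by simpa using h)⟩
  · intro h
    -- A basis inside `S`: one representative of each class that `S` meets.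
    obtain ⟨B, hB, hinj, himg⟩ := Finset.exists_subset_injOn_image_eq_of_surjOn (f := g) (S.filter p)
      ((S.filter p).image g) (by simp [Set.SurjOn])
    refine ⟨B, ⟨⟨fun i hi => (Finset.mem_filter.1 (hB hi)).2, hinj⟩, fun C hC hBC =>
      (hBC.antisymm fun c hc => ?_).symm⟩, fun i hi => (Finset.mem_filter.1 (hB hi)).1⟩
    obtain ⟨j, hj, hpj, hgj⟩ := h c (hC.1 c hc)
    have : g c ∈ B.image g := by
      rw [himg, ← hgj]
      exact Finset.mem_image_of_mem g (Finset.mem_filter.2 ⟨hj, hpj⟩)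
    obtain ⟨b, hb, hbc⟩ := Finset.mem_image.1 this
    rwa [← hC.2 (hBC hb) hc hbc]

/-- A representation of the dual of a partition matroid. -/
theorem linearIndepOn_partition_iff (g : V → α) (p : V → Prop) [DecidablePred p]
    (hp : ∀ i j, g i = g j → p i → p j) (R : Finset V) :
    LinearIndepOn ℝ (fun j k : V => if p j then
      if g j = g k then (if k = j then ((Finset.univ.filter fun i => g j = g i).card : ℝ) else 0) - 1
      else 0 else if k = j then 1 else 0) (R : Set V) ↔
    ∀ i, p i → ∃ j ∉ R, g j = g i := by
  rw [linearIndepOn_finset_iff]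
  constructor
  · intro h i hi
    by_contra! hcon
    set K := Finset.univ.filter fun j => g i = g j with hK
    have hKR : K ⊆ R := fun j hj => by
      by_contra hjR
      exact hcon j hjR (Finset.mem_filter.1 hj).2.symm
    have hiK : i ∈ K := by simp [hK]
    refine one_ne_zero (α := ℝ) ?_
    -- For a class `K` the vectors are `|K|` times a unit vector minus the indicator of `K`, so
    -- their sum over all of `K` is zero.
    have := h (fun j => if j ∈ K then 1 else 0) ?_ i (hKR hiK)
    · simp [hiK] at this
    · simp only [ite_smul, one_smul, zero_smul]
      rw [← Finset.sum_filter, Finset.filter_mem_eq_inter, Finset.inter_eq_right.2 hKR]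
      funext k
      rw [Finset.sum_apply]
      by_cases hk : g i = g k
      · have hkK : k ∈ K := by simp [hK, hk]
        have : ∀ j ∈ K, (if p j then if g j = g k then
            (if k = j then ((Finset.univ.filter fun i => g j = g i).card : ℝ) else 0) - 1
            else 0 else if k = j then 1 else 0) = (if k = j then (K.card : ℝ) else 0) - 1 := by
          intro j hj
          have hij : g i = g j := (Finset.mem_filter.1 hj).2
          rw [if_pos (hp i j hij hi), if_pos (hij.symm.trans hk), ← hij]
        rw [Finset.sum_congr rfl this]
        simp [hkK]
      · refine Finset.sum_eq_zero fun j hj => ?_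
        have hij : g i = g j := (Finset.mem_filter.1 hj).2
        rw [if_pos (hp i j hij hi), if_neg (hij ▸ hk)]
  · intro h c hc
    have hck : ∀ k, ∑ j ∈ R, c j * (if p j then if g j = g k then
        (if k = j then ((Finset.univ.filter fun i => g j = g i).card : ℝ) else 0) - 1
        else 0 else if k = j then 1 else 0) = 0 := fun k => by
      have := congrFun hc k
      simpa only [Finset.sum_apply, Pi.smul_apply, smul_eq_mul, Pi.zero_apply] using this
    have hiso : ∀ k, p k → ∑ j ∈ R, c j * (if p j then if g j = g k then
        (if k = j then ((Finset.univ.filter fun i => g j = g i).card : ℝ) else 0) - 1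
        else 0 else if k = j then 1 else 0) =
        (if k ∈ R then ((Finset.univ.filter fun i => g k = g i).card : ℝ) * c k else 0) -
          ∑ j ∈ R.filter fun j => g j = g k, c j := by
      intro k hk
      rw [Finset.sum_filter, ← Finset.sum_ite_eq R k
        (fun j => ((Finset.univ.filter fun i => g j = g i).card : ℝ) * c j), ← Finset.sum_sub_distrib]
      refine Finset.sum_congr rfl fun j _ => ?_
      by_cases hg : g j = g k
      · rw [if_pos (hp k j hg.symm hk), if_pos hg, if_pos hg]
        split_ifs <;> ring
      · have hkj : k ≠ j := fun hkj => hg (by rw [hkj])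
        simp [hg, hkj]
    intro i hi
    by_cases hpi : p i
    -- Coordinate `j`, belonging to an absent member of the class, shows that the coefficients of
    -- the class sum to zero. Coordinate `i` then isolates a nonzero multiple of `c i`.
    · obtain ⟨j, hj, hji⟩ := h i hpi
      have h1 := (hiso j (hp i j hji.symm hpi)).symm.trans (hck j)
      have h2 := (hiso i hpi).symm.trans (hck i)
      rw [if_neg hj, hji] at h1
      rw [if_pos hi] at h2
      have h3 : ((Finset.univ.filter fun l => g i = g l).card : ℝ) * c i = 0 := by linarith
      refine (mul_eq_zero.1 h3).resolve_left ?_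
      exact_mod_cast (Finset.card_pos.2 ⟨i, by simp⟩).ne'
    · have h1 := hck i
      rw [Finset.sum_eq_single i] at h1
      · simpa [hpi] using h1
      · intro j _ hji
        by_cases hpj : p j
        · rw [if_pos hpj, if_neg fun hg => hpi (hp j i hg hpj), mul_zero]
        · rw [if_neg hpj, if_neg (Ne.symm hji), mul_zero]
      · exact fun h => absurd hi h

end Partition

namespace RealWhile

variable {n : ℕ} {sys : DescriptorSystem n} {m : Fin n → Fin n ⊕ Fin n} {rule : IsolationRule}

open Classical in
theorem rho2_eq : sys.rho2 m rule = fun S => ((S.filter fun i =>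
    sys.IsIsolated m rule (sys.component m (AuxNode.wT i))).image
      fun i => sys.component m (AuxNode.wT i)).card := by
  funext S
  rw [DescriptorSystem.rho2, ← Set.ncard_coe_finset]
  congr 1
  ext C
  simp only [Set.mem_ofPred_eq, Finset.coe_image, Finset.coe_filter, Set.mem_image]
  constructor
  · rintro ⟨hC, i, hi, hiC⟩
    obtain ⟨v, rfl⟩ := hC.1
    rw [component_eq_iff.2 hiC] at hC
    exact ⟨i, ⟨hi, hC⟩, (component_eq_iff.2 hiC).symm⟩
  · rintro ⟨i, ⟨hi, hC⟩, rfl⟩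
    exact ⟨hC, i, hi, mem_component_self _⟩

/-- Independence in the dual of the second matroid is linear independence. -/
theorem dualIndep_rho2_iff (S : Finset (Fin n)) :
    dualIndep (ofRank (sys.rho2 m rule)) Sᶜ ↔
      LinearIndepOn ℝ (fun j k : Fin n => isoVec sys m rule j k) ((Sᶜ : Finset (Fin n)) : Set (Fin n)) := by
  classical
  have hiso : ∀ i : Fin n, isoP sys m rule i ↔
      sys.IsIsolated m rule (sys.component m (AuxNode.wT i)) := fun i => isoP_iff (v := AuxNode.wT i)
  have hsame : ∀ i j : Fin n, sameP sys m i j ↔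
      sys.component m (AuxNode.wT i) = sys.component m (AuxNode.wT j) := fun i j =>
    sameP_iff (u := AuxNode.wT i) (v := AuxNode.wT j)
  have hvec : (fun j k : Fin n => isoVec sys m rule j k) = fun j k : Fin n =>
      if sys.IsIsolated m rule (sys.component m (AuxNode.wT j)) then
      if sys.component m (AuxNode.wT j) = sys.component m (AuxNode.wT k) then
        (if k = j then ((Finset.univ.filter fun i : Fin n =>
          sys.component m (AuxNode.wT j) = sys.component m (AuxNode.wT i)).card : ℝ) else 0) - 1
      else 0 else if k = j then 1 else 0 := by
    funext j k
    have hcard : ((Finset.range n).filter fun i => sameP sys m j i).card =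
        (Finset.univ.filter fun i : Fin n =>
          sys.component m (AuxNode.wT j) = sys.component m (AuxNode.wT i)).card := by
      simp only [← hsame]
      rw [Finset.card_filter, Finset.card_filter, Finset.sum_range]
    simp only [isoVec, hiso, hsame, hcard, Fin.val_inj]
  rw [hvec, linearIndepOn_partition_iff (fun i : Fin n => sys.component m (AuxNode.wT i))
    (fun i => sys.IsIsolated m rule (sys.component m (AuxNode.wT i))) (fun i j h => by rw [h]; exact id),
    rho2_eq, dualIndep_card_image_iff]
  refine forall₂_congr fun i hi => exists_congr fun j => ?_
  simp only [Finset.mem_compl, not_not]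
  refine and_congr_right fun _ => ⟨fun h => h.2, fun h => ⟨?_, h⟩⟩
  rw [h]
  exact hi

end RealWhile

/-! ### The first matroid -/

open IndepSystem

/-- Linear independence of vectors that are each concentrated in one block of coordinates. -/
theorem linearIndepOn_blocks_iff {ι T K K' : Type*} [DecidableEq T] (φ : T → K' → K)
    (hφ : ∀ k, ∃ t k', φ t k' = k) (x : ι → K → ℝ) (y : ι → K' → ℝ) (b : ι → T) (s : Finset ι)
    (hx : ∀ i ∈ s, ∀ t k', x i (φ t k') = if b i = t then y i k' else 0) :
    LinearIndepOn ℝ x (s : Set ι) ↔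
      ∀ t, LinearIndepOn ℝ y ((s.filter fun i => b i = t : Finset ι) : Set ι) := by
  have key : ∀ (g : ι → ℝ) t k', (∑ i ∈ s, g i • x i) (φ t k') =
      (∑ i ∈ s.filter fun i => b i = t, g i • y i) k' := by
    intro g t k'
    rw [Finset.sum_apply, Finset.sum_apply, Finset.sum_filter]
    refine Finset.sum_congr rfl fun i hi => ?_
    rw [Pi.smul_apply, hx i hi]
    split_ifs <;> simp
  simp only [linearIndepOn_finset_iff]
  constructor
  · intro h t g hg i hi
    have := h (fun i => if b i = t then g i else 0) ?_ i (Finset.mem_filter.1 hi).1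
    · simpa [(Finset.mem_filter.1 hi).2] using this
    · funext k
      obtain ⟨t', k', rfl⟩ := hφ k
      rw [key]
      by_cases ht : t' = t
      · subst ht
        refine Eq.trans (congrFun ?_ k') (congrFun hg k')
        exact Finset.sum_congr rfl fun j hj => by rw [if_pos (Finset.mem_filter.1 hj).2]
      · rw [Finset.sum_eq_zero fun j hj => ?_]
        · rfl
        · rw [if_neg fun h => ht ((Finset.mem_filter.1 hj).2.symm.trans h), zero_smul]
  · intro h g hg i hi
    refine h (b i) g ?_ i (Finset.mem_filter.2 ⟨hi, rfl⟩)
    funext k'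
    rw [← key, hg]
    rfl

theorem linearIndepOn_single_iff {ι K : Type*} [DecidableEq K] (r : ι → K) (p : ι → Prop)
    [DecidablePred p] (s : Set ι) :
    LinearIndepOn ℝ (fun i k => if p i ∧ r i = k then (1 : ℝ) else 0) s ↔
      (∀ i ∈ s, p i) ∧ Set.InjOn r s := by
  have hp : ∀ t : Set ι, (∀ i ∈ t, p i) → ∀ i ∈ t, (fun k => if p i ∧ r i = k then (1 : ℝ) else 0) =
      Pi.single (r i) 1 := by
    intro t ht i hi
    funext k
    by_cases hk : r i = k
    · subst hk; simp [ht i hi]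
    · rw [if_neg fun h => hk h.2, Pi.single_eq_of_ne (Ne.symm hk)]
  constructor
  · intro h
    have h1 : ∀ i ∈ s, p i := by
      intro i hi
      by_contra hpi
      refine h.ne_zero hi ?_
      funext k
      simp [hpi]
    refine ⟨h1, fun i hi j hj hij => h.injOn hi hj ?_⟩
    rw [hp s h1 i hi, hp s h1 j hj, hij]
  · rintro ⟨h1, h2⟩
    have : LinearIndependent ℝ fun k : K => (Pi.single k 1 : K → ℝ) :=
      Pi.linearIndependent_single_one K ℝ
    exact (linearIndepOn_congr (hp s h1)).2 (this.comp (fun i : s => r i) h2.injective)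

namespace RealWhile

variable {n : ℕ}

/-- The columns of `[I | A | B]`. -/
abbrev Elt (n : ℕ) : Type := Fin n ⊕ (Fin n ⊕ Fin n)

/-- The entries of `[I | T_A | T_B(S)]` that are free or nonzero. -/
def Allowed (sys : DescriptorSystem n) (S : Finset (Fin n)) : Elt n → Fin n → Prop
  | Sum.inl j, i => i = j
  | Sum.inr (Sum.inl j), i => sys.TA i j = true
  | Sum.inr (Sum.inr j), i => i = j ∧ j ∈ S

/-- A generic matrix has independent columns exactly if they can be matched to rows. -/
theorem freeIndep_iff (sys : DescriptorSystem n) (S : Finset (Fin n)) (X : Finset (Elt n)) :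
    sys.freeIndep S X ↔ ∃ r : Elt n → Fin n, Set.InjOn r X ∧ ∀ e ∈ X, Allowed sys S e (r e) := by
  classical
  constructor
  · rintro ⟨T, d, hT, hd, hli⟩
    set M : Matrix (Fin n) (Elt n) ℝ := Matrix.fromCols 1 (Matrix.fromCols T (Matrix.diagonal d))
      with hM
    have hallowed : ∀ e i, M i e ≠ 0 → Allowed sys S e i := by
      rintro (j | j | j) i h
      · by_contra hij
        exact h (by simp [hM, show i ≠ j from hij])
      · exact hT i j (by simpa [hM] using h)
      · have hij : i = j := by
          by_contra hij
          exact h (by simp [hM, Matrix.diagonal_apply_ne _ hij])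
        subst hij
        exact ⟨rfl, hd i (by simpa [hM] using h)⟩
    -- Hall's condition holds because independent columns lie in the span of the unit vectors of the
    -- rows where they have nonzero entries.
    obtain ⟨r, hr, hrs⟩ := (Finset.all_card_le_biUnion_card_iff_exists_injective
      fun e : X => Finset.univ.filter fun i => M i e ≠ 0).1 (by
        intro s
        have hs : LinearIndepOn ℝ M.col ((s.map (Function.Embedding.subtype _) : Finset (Elt n)) :
            Set (Elt n)) := LinearIndepOn.mono hli fun e he => by
          obtain ⟨x, -, rfl⟩ := Finset.mem_map.1 he
          exact x.2
        rw [← Finset.card_map (Function.Embedding.subtype _)]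
        refine LinearIndepOn.card_le_of_subset_span (x := fun i : Fin n => (Pi.single i 1 : Fin n → ℝ))
          hs fun e he => ?_
        obtain ⟨x, hx, rfl⟩ := Finset.mem_map.1 he
        rw [pi_eq_sum_univ' (M.col _)]
        refine Submodule.sum_mem _ fun i _ => ?_
        by_cases hi : M i x = 0
        · simp [Matrix.col, hi]
        · refine Submodule.smul_mem _ _ (Submodule.subset_span ⟨i, ?_, ?_⟩)
          · exact Finset.mem_biUnion.2 ⟨x, hx, Finset.mem_filter.2 ⟨Finset.mem_univ _, hi⟩⟩
          · funext k
            simp [Pi.single_apply])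
    refine ⟨fun e => if h : e ∈ X then r ⟨e, h⟩ else Sum.elim id (Sum.elim id id) e, ?_, ?_⟩
    · intro e he e' he' h
      have he : e ∈ X := he
      have he' : e' ∈ X := he'
      simp only [he, he', dif_pos] at h
      simpa using hr h
    · intro e he
      simp only [he, dif_pos]
      exact hallowed e _ (by simpa using hrs ⟨e, he⟩)
  · rintro ⟨r, hr, hX⟩
    -- Parameters are set to one at the matched positions and to zero elsewhere, which turns the
    -- columns of `X` into distinct unit vectors.
    refine ⟨Matrix.of fun i j => if Sum.inr (Sum.inl j) ∈ X ∧ r (Sum.inr (Sum.inl j)) = i then 1 else 0,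
      fun j => if Sum.inr (Sum.inr j) ∈ X then 1 else 0, fun i j h => ?_, fun i h => ?_, ?_⟩
    · have h' := (ite_ne_right_iff.1 h).1
      have := hX _ h'.1
      rw [h'.2] at this
      exact this
    · exact (hX _ (ite_ne_right_iff.1 h).1).2
    · rw [linearIndep]
      refine (linearIndepOn_congr fun e he => ?_).1
        ((linearIndepOn_single_iff r (fun _ => True) _).2 ⟨fun _ _ => trivial, hr⟩)
      have he : e ∈ X := he
      have hal := hX e he
      funext i
      rcases e with j | j | j
      · have : r (Sum.inl j) = j := hal
        simp [this, Matrix.col, Matrix.one_apply, eq_comm]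
      · simp [Matrix.col, he]
      · have : r (Sum.inr (Sum.inr j)) = j := hal.1
        by_cases hij : i = j
        · subst hij
          simp [this, Matrix.col, he]
        · simp [this, Matrix.col, Matrix.diagonal_apply_ne _ hij, Ne.symm hij]

end RealWhile

open IndepSystem

namespace RealWhile

variable {n : ℕ}

/-! ### Selections for the selection problem -/

/-- The position of a column. -/
def eltEquiv (n : ℕ) : Elt n ≃ Fin (n + (n + n)) :=
  (Equiv.sumCongr (Equiv.refl _) finSumFinEquiv).trans finSumFinEquiv

@[simp] theorem eltEquiv_inl (j : Fin n) : (eltEquiv n (Sum.inl j) : ℕ) = j := by simp [eltEquiv]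

@[simp] theorem eltEquiv_inr_inl (j : Fin n) :
    (eltEquiv n (Sum.inr (Sum.inl j)) : ℕ) = n + j := by simp [eltEquiv]

@[simp] theorem eltEquiv_inr_inr (j : Fin n) :
    (eltEquiv n (Sum.inr (Sum.inr j)) : ℕ) = n + (n + j) := by simp [eltEquiv, add_comm]

theorem exists_eltEquiv {c : ℕ} (hc : c < n + (n + n)) : ∃ e, (eltEquiv n e : ℕ) = c :=
  ⟨(eltEquiv n).symm ⟨c, hc⟩, by simp⟩

/-- `Allowed` on positions. -/
def allowedP (sys : DescriptorSystem n) (S : Finset (Fin n)) (c i : ℕ) : Prop :=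
  (c < n ∧ i = c) ∨ (n ≤ c ∧ entP sys.TA i (c - n)) ∨
    ((∃ h : i < n, (⟨i, h⟩ : Fin n) ∈ S) ∧ c = n + (n + i))

theorem allowedP_iff (sys : DescriptorSystem n) (S : Finset (Fin n)) (e : Elt n) (i : Fin n) :
    allowedP sys S (eltEquiv n e) i ↔ Allowed sys S e i := by
  rcases e with j | j | j
  · have h1 : ¬ n ≤ (j : ℕ) := by omega
    have h2 : ¬ (j : ℕ) = n + (n + i) := by omega
    simp [allowedP, Allowed, h1, h2, Fin.ext_iff]
  · have h2 : ¬ (j : ℕ) = n + i := by omega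
    simp [allowedP, Allowed, h2]
  · have h1 : ¬ entP sys.TA i (n + (n + j) - n) := fun h => by
      have := h.1.2
      omega
    simp only [allowedP, Allowed, eltEquiv_inr_inr, h1, and_false, false_or]
    constructor
    · rintro (⟨h, -⟩ | ⟨⟨_, h⟩, h'⟩)
      · exact absurd h (by omega)
      · obtain rfl : i = j := Fin.ext (by omega)
        exact ⟨rfl, h⟩
    · rintro ⟨rfl, h⟩
      exact Or.inr ⟨⟨i.2, h⟩, rfl⟩

open Classical in
/-- Selecting a set that is independent in the union of the fixed and the generic matroid, and a set
of states: option `1 + i` matches a column to row `i` of the generic matrix, option `n + 1` puts a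
column of `[I | Q_A]` into the fixed matroid, or selects the state `j` with vector `u j` in case of
the `j`-th column of `T_B`. -/
noncomputable def selInst (sys : DescriptorSystem n) (S : Finset (Fin n)) (u : ℕ → ℕ → ℝ)
    (w : ℕ → ℕ → ℝ) : Inst where
  q := n + (n + n)
  p := n + 2
  d := n + (n + n)
  v c o k :=
    -- The three blocks of coordinates hold, in this order, the column in the fixed matrix, the unit
    -- vector of the row to which the column is matched, and the vector of the state that is left
    -- out. A row that is not allowed yields the zero vector and so is never chosen.
    if k < n then
      if o = n + 1 then if c < n then if k = c then 1 else 0 else ent sys.QA k (c - n) else 0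
    else if k < n + n then if allowedP sys S c (k - n) ∧ o = k - n + 1 then 1 else 0
    else if o = n + 1 ∧ n + n ≤ c then u (c - (n + n)) (k - (n + n)) else 0
  w := w

/-- The matrix `[I | Q_A | 0]`. -/
def fixedMat (sys : DescriptorSystem n) : Matrix (Fin n) (Elt n) ℝ :=
  Matrix.fromCols 1 (Matrix.fromCols sys.QA 0)

section Entries

variable (sys : DescriptorSystem n) (S : Finset (Fin n)) (u w : ℕ → ℕ → ℝ) (e : Elt n) (o : ℕ)

theorem selInst_v_inl (k : Fin n) :
    (selInst sys S u w).v (eltEquiv n e) o (eltEquiv n (Sum.inl k)) =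
      if o = n + 1 then fixedMat sys k e else 0 := by
  simp only [selInst, eltEquiv_inl, k.2, if_true]
  congr 1
  rcases e with j | j | j
  · simp [fixedMat, Matrix.one_apply, Fin.ext_iff]
  · simp [fixedMat]
  · simp [fixedMat, ent]

open Classical in
theorem selInst_v_inr_inl (k : Fin n) :
    (selInst sys S u w).v (eltEquiv n e) o (eltEquiv n (Sum.inr (Sum.inl k))) =
      if Allowed sys S e k ∧ o = k + 1 then 1 else 0 := by
  have h1 : ¬ n + (k : ℕ) < n := by omega
  have h2 : n + (k : ℕ) < n + n := by omega
  simp only [selInst, eltEquiv_inr_inl, h1, h2, if_true, if_false, Nat.add_sub_cancel_left,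
    allowedP_iff]

theorem selInst_v_inr_inr (k : Fin n) :
    (selInst sys S u w).v (eltEquiv n e) o (eltEquiv n (Sum.inr (Sum.inr k))) =
      if o = n + 1 then Sum.elim (fun _ => 0) (Sum.elim (fun _ => 0) fun j : Fin n => u j k) e else 0 := by
  have h1 : ¬ n + (n + (k : ℕ)) < n := by omega
  have h2 : ¬ n + (n + (k : ℕ)) < n + n := by omega
  have h3 : ∀ l, n + (n + l) - (n + n) = l := by intro l; omega
  simp only [selInst, eltEquiv_inr_inr, h1, h2, if_false, h3]
  rcases e with j | j | j
  · have : ¬ n + n ≤ (j : ℕ) := by omega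
    simp [this]
  · have : ¬ n ≤ (j : ℕ) := by omega
    simp [this]
  · simp [← add_assoc]

end Entries

theorem selInst_wf (sys : DescriptorSystem n) (S : Finset (Fin n)) (u : ℕ → ℕ → ℝ)
    {w : ℕ → ℕ → ℝ} (hw : ∀ c, w c 0 = 0) : (selInst sys S u w).WF :=
  ⟨fun c => by funext k; simp [Inst.vect, selInst], hw, by simp [selInst]⟩

/-- Independence in the union of the fixed and the generic matroid, in terms of the options. -/
structure IsMixed (sys : DescriptorSystem n) (S : Finset (Fin n)) (o : Elt n → ℕ) : Prop where
  fixed : LinearIndepOn ℝ (fixedMat sys).col {e | o e = n + 1}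
  allowed : ∀ e, o e ≠ 0 → o e ≠ n + 1 → ∃ i : Fin n, o e = i + 1 ∧ Allowed sys S e i
  inj : ∀ e e₁, o e ≠ 0 → o e ≠ n + 1 → o e = o e₁ → e = e₁

/-- The states that are selected. -/
def rset (o : Elt n → ℕ) : Finset (Fin n) :=
  Finset.univ.filter fun j => o (Sum.inr (Sum.inr j)) = n + 1

/-- The selection without the selected states. -/
def core (o : Elt n → ℕ) : Elt n → ℕ
  | Sum.inl j => o (Sum.inl j)
  | Sum.inr (Sum.inl j) => o (Sum.inr (Sum.inl j))
  | Sum.inr (Sum.inr j) =>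
    if o (Sum.inr (Sum.inr j)) = n + 1 then 0 else o (Sum.inr (Sum.inr j))

theorem mem_rset {o : Elt n → ℕ} {j : Fin n} : j ∈ rset o ↔ o (Sum.inr (Sum.inr j)) = n + 1 := by
  simp [rset]

theorem core_eq_self {o : Elt n → ℕ} (h : rset o = ∅) : core o = o := by
  funext e
  rcases e with j | j | j
  · rfl
  · rfl
  · exact if_neg fun hj => by simpa [h] using mem_rset.2 hj

theorem core_ne {o : Elt n → ℕ} {e : Elt n} : core o e ≠ 0 ∧ core o e ≠ n + 1 ↔
    o e ≠ 0 ∧ o e ≠ n + 1 := by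
  rcases e with j | j | j
  · rfl
  · rfl
  · simp only [core]
    split_ifs with h <;> simp [h]

theorem core_eq_of_ne {o : Elt n → ℕ} {e : Elt n} (h : o e ≠ n + 1) : core o e = o e := by
  rcases e with j | j | j
  · rfl
  · rfl
  · exact if_neg h

theorem IsMixed.rset_eq_empty {sys : DescriptorSystem n} {S : Finset (Fin n)} {o : Elt n → ℕ}
    (h : IsMixed sys S o) : rset o = ∅ := by
  refine Finset.eq_empty_of_forall_notMem fun j hj => ?_
  refine h.fixed.ne_zero (i := Sum.inr (Sum.inr j)) (mem_rset.1 hj) ?_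
  funext k
  simp [Matrix.col, fixedMat]

theorem linearIndepOn_comp_iff {ι κ E : Type*} [AddCommGroup E] [Module ℝ E] (φ : ι → κ)
    (hφ : Function.Injective φ) (x : κ → E) (s : Set ι) :
    LinearIndepOn ℝ (fun i => x (φ i)) s ↔ LinearIndepOn ℝ x (φ '' s) := by
  rw [LinearIndepOn, LinearIndepOn, ← linearIndependent_equiv (Equiv.Set.image φ s hφ)]
  rfl

/-- Every vector is concentrated in one block, so independence splits into three conditions. The
first block expresses independence in the fixed matroid. In the second, unit vectors are independent
iff their rows are distinct and allowed. The third concerns the vectors of the states left out,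
which `core` removes from the union part. -/
theorem selInst_indep_iff (sys : DescriptorSystem n) (S : Finset (Fin n)) (u w : ℕ → ℕ → ℝ)
    {I : ℕ → ℕ} (hI : (selInst sys S u w).IsSel I) :
    (selInst sys S u w).Indep I ↔ IsMixed sys S (core fun e => I (eltEquiv n e)) ∧
      LinearIndepOn ℝ (fun j k : Fin n => u j k)
        ((rset fun e => I (eltEquiv n e) : Finset (Fin n)) : Set (Fin n)) := by
  classical
  set o : Elt n → ℕ := fun e => I (eltEquiv n e) with ho
  have hlt : ∀ e, o e < n + 2 := fun e => hI.lt _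
  have hsupp : ((selInst sys S u w).supp I : Set ℕ) = (fun e => (eltEquiv n e : ℕ)) ''
      ((Finset.univ.filter fun e => o e ≠ 0 : Finset (Elt n)) : Set (Elt n)) := by
    ext c
    simp only [Finset.mem_coe, Inst.mem_supp, Set.mem_image, Finset.mem_filter, Finset.mem_univ,
      true_and]
    constructor
    · rintro ⟨hc, h0⟩
      obtain ⟨e, rfl⟩ := exists_eltEquiv hc
      exact ⟨e, h0, rfl⟩
    · rintro ⟨e, he, rfl⟩
      exact ⟨(eltEquiv n e).2, he⟩
  set x : Elt n → Fin (n + (n + n)) → ℝ := fun e k => (selInst sys S u w).v (eltEquiv n e) (o e) k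
  have h1 : (selInst sys S u w).Indep I ↔ LinearIndepOn ℝ x
      ((Finset.univ.filter fun e => o e ≠ 0 : Finset (Elt n)) : Set (Elt n)) := by
    rw [Inst.Indep, hsupp, ← linearIndepOn_comp_iff (fun e => (eltEquiv n e : ℕ))
      fun e e' h => (eltEquiv n).injective (Fin.ext h)]
    rfl
  set φ : Fin 3 → Fin n → Fin (n + (n + n)) := fun t k =>
    eltEquiv n (![Sum.inl k, Sum.inr (Sum.inl k), Sum.inr (Sum.inr k)] t) with hφ
  set y : Elt n → Fin n → ℝ := fun e k => if o e = n + 1 then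
    Sum.elim (fun _ => fixedMat sys k e) (Sum.elim (fun _ => fixedMat sys k e) fun j : Fin n => u j k) e
    else if Allowed sys S e k ∧ o e = k + 1 then 1 else 0 with hy
  set b : Elt n → Fin 3 := fun e => if o e = n + 1 then
    Sum.elim (fun _ => 0) (Sum.elim (fun _ => 0) fun _ => 2) e else 1 with hb
  rw [h1, linearIndepOn_blocks_iff φ ?_ x y b]
  · have hb0 : ∀ e, (o e ≠ 0 ∧ b e = 0) ↔ core o e = n + 1 := by
      intro e
      by_cases h : o e = n + 1
      · rcases e with j | j | j <;> simp [hb, h, core]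
      · simp [hb, h, core_eq_of_ne h]
    have hb1 : ∀ e, (o e ≠ 0 ∧ b e = 1) ↔ o e ≠ 0 ∧ o e ≠ n + 1 := by
      intro e
      by_cases h : o e = n + 1
      · rcases e with j | j | j <;> simp [hb, h]
      · simp [hb, h]
    have hb2 : ∀ e, (o e ≠ 0 ∧ b e = 2) ↔ ∃ j ∈ rset o, Sum.inr (Sum.inr j) = e := by
      intro e
      by_cases h : o e = n + 1
      · rcases e with j | j | j <;> simp [hb, h, mem_rset]
      · simp only [hb, h, if_false]
        refine ⟨fun h' => absurd h'.2 (by decide), ?_⟩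
        rintro ⟨j, hj, rfl⟩
        exact absurd (mem_rset.1 hj) h
    have hset : ∀ t, ((Finset.filter (fun e => b e = t) (Finset.univ.filter fun e => o e ≠ 0) :
        Finset (Elt n)) : Set (Elt n)) = {e | o e ≠ 0 ∧ b e = t} := fun t => by
      ext e
      simp
    have A0 : LinearIndepOn ℝ y {e | o e ≠ 0 ∧ b e = 0} ↔
        LinearIndepOn ℝ (fixedMat sys).col {e | core o e = n + 1} := by
      simp only [hb0]
      refine linearIndepOn_congr fun e he => ?_
      have he : core o e = n + 1 := he
      funext k
      rcases e with j | j | j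
      · have he : o (Sum.inl j) = n + 1 := he
        simp [hy, he, Matrix.col]
      · have he : o (Sum.inr (Sum.inl j)) = n + 1 := he
        simp [hy, he, Matrix.col]
      · simp only [core] at he
        split_ifs at he
        omega
    have A1 : LinearIndepOn ℝ y {e | o e ≠ 0 ∧ b e = 1} ↔
        (∀ e, o e ≠ 0 ∧ o e ≠ n + 1 → ∃ i : Fin n, o e = i + 1 ∧ Allowed sys S e i) ∧
        ∀ e e', o e ≠ 0 ∧ o e ≠ n + 1 → o e = o e' → e = e' := by
      simp only [hb1]
      have hr : ∀ e, o e ≠ 0 ∧ o e ≠ n + 1 → o e - 1 < n := fun e he => by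
        have := hlt e
        omega
      set r : Elt n → Fin n := fun e => if h : o e - 1 < n then ⟨o e - 1, h⟩ else
        Sum.elim id (Sum.elim id id) e with hrdef
      have hr1 : ∀ e, o e ≠ 0 ∧ o e ≠ n + 1 → o e = r e + 1 := fun e he => by
        simp only [hrdef, hr e he, dif_pos]
        omega
      refine (linearIndepOn_congr (w := fun e k => if Allowed sys S e (r e) ∧ r e = k then (1 : ℝ)
        else 0) fun e he => ?_).trans ((linearIndepOn_single_iff r
          (fun e => Allowed sys S e (r e)) _).trans (and_congr ?_ ?_))
      · have he : o e ≠ 0 ∧ o e ≠ n + 1 := he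
        funext k
        simp only [hy, he.2, if_false]
        refine if_congr ?_ rfl rfl
        have h1 := hr1 e he
        constructor
        · rintro ⟨h, h'⟩
          obtain rfl : r e = k := Fin.ext (by omega)
          exact ⟨h, rfl⟩
        · rintro ⟨h, rfl⟩
          exact ⟨h, h1⟩
      · refine forall₂_congr fun e he => ?_
        have h1 := hr1 e he
        constructor
        · exact fun h => ⟨r e, h1, h⟩
        · rintro ⟨i, hi, h⟩
          rwa [show r e = i from Fin.ext (by omega)]
      · constructor
        · intro h e e' he hee
          refine h he (show e' ∈ {e | o e ≠ 0 ∧ o e ≠ n + 1} from ?_) ?_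
          · rw [Set.mem_ofPred_eq, ← hee]
            exact he
          · simp only [hrdef, ← hee, hr e he, dif_pos]
        · intro h e he e' he' hee
          exact h e e' he ((hr1 e he).trans (by rw [hee, hr1 e' he']))
    have A2 : LinearIndepOn ℝ y {e | o e ≠ 0 ∧ b e = 2} ↔
        LinearIndepOn ℝ (fun j k : Fin n => u j k) ((rset o : Finset (Fin n)) : Set (Fin n)) := by
      have hs : {e | o e ≠ 0 ∧ b e = 2} = (fun j : Fin n => (Sum.inr (Sum.inr j) : Elt n)) ''
          ((rset o : Finset (Fin n)) : Set (Fin n)) := by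
        ext e
        exact hb2 e
      rw [hs, ← linearIndepOn_comp_iff _ (fun i j h => by simpa using h)]
      refine linearIndepOn_congr fun j hj => ?_
      funext k
      simp [hy, mem_rset.1 hj]
    simp only [hset, Fin.forall_fin_succ, Fin.isEmpty.forall_iff, and_true]
    rw [A0, show (Fin.succ 0 : Fin 3) = 1 from rfl, A1, show (Fin.succ (Fin.succ 0) : Fin 3) = 2 from rfl, A2,
      ← and_assoc]
    refine and_congr_left fun _ => ?_
    constructor
    · rintro ⟨h0, h1, h2⟩
      refine ⟨h0, fun e h h' => ?_, fun e e' h h' hee => ?_⟩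
      · have he := core_ne.1 ⟨h, h'⟩
        rw [core_eq_of_ne he.2]
        exact h1 e he
      · have he := core_ne.1 ⟨h, h'⟩
        have he' := core_ne.1 ⟨hee ▸ h, hee ▸ h'⟩
        rw [core_eq_of_ne he.2, core_eq_of_ne he'.2] at hee
        exact h2 e e' he hee
    · rintro ⟨h0, h1, h2⟩
      refine ⟨h0, fun e he => ?_, fun e e' he hee => ?_⟩
      · have := h1 e (core_ne.2 he).1 (core_ne.2 he).2
        rwa [core_eq_of_ne he.2] at this
      · exact h2 e e' (core_ne.2 he).1 (core_ne.2 he).2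
          (by rw [core_eq_of_ne he.2, core_eq_of_ne (hee ▸ he.2), hee])
  · intro e _ t k
    fin_cases t
    · change (selInst sys S u w).v (eltEquiv n e) (o e) (eltEquiv n (Sum.inl k)) = _
      rw [selInst_v_inl]
      by_cases h : o e = n + 1
      · rcases e with j | j | j <;> simp [hb, hy, h, fixedMat]
      · simp [hb, h]
    · change (selInst sys S u w).v (eltEquiv n e) (o e) (eltEquiv n (Sum.inr (Sum.inl k))) = _
      rw [selInst_v_inr_inl]
      by_cases h : o e = n + 1
      · have : ¬ n = (k : ℕ) := by omega
        rcases e with j | j | j <;> simp [hb, h, this]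
      · simp [hb, hy, h]
    · change (selInst sys S u w).v (eltEquiv n e) (o e) (eltEquiv n (Sum.inr (Sum.inr k))) = _
      rw [selInst_v_inr_inr]
      by_cases h : o e = n + 1
      · rcases e with j | j | j <;> simp [hb, hy, h]
      · simp [hb, h]
  · intro k
    obtain ⟨e, rfl⟩ := (eltEquiv n).surjective k
    rcases e with j | j | j
    · exact ⟨0, j, rfl⟩
    · exact ⟨1, j, rfl⟩
    · exact ⟨2, j, rfl⟩

end RealWhile

/-! ### The rank of the union and the dual of the first matroid -/

open IndepSystem

namespace RealWhile

variable {n : ℕ} {sys : DescriptorSystem n} {S S' : Finset (Fin n)} {o : Elt n → ℕ}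

/-- The columns that are used. -/
def osupp (o : Elt n → ℕ) : Finset (Elt n) := Finset.univ.filter fun e => o e ≠ 0

theorem mem_osupp {e : Elt n} : e ∈ osupp o ↔ o e ≠ 0 := by simp [osupp]

theorem IsMixed.of_forall (h : IsMixed sys S o)
    (hS : ∀ j, o (Sum.inr (Sum.inr j)) ≠ 0 → j ∈ S → j ∈ S') : IsMixed sys S' o := by
  refine ⟨h.fixed, fun e h0 h1 => ?_, h.inj⟩
  obtain ⟨i, hi, ha⟩ := h.allowed e h0 h1
  refine ⟨i, hi, ?_⟩
  rcases e with j | j | j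
  · exact ha
  · exact ha
  · exact ⟨ha.1, hS j h0 ha.2⟩

theorem IsMixed.mem (h : IsMixed sys S o) {j : Fin n} (hj : o (Sum.inr (Sum.inr j)) ≠ 0) :
    j ∈ S := by
  obtain ⟨i, -, ha⟩ := h.allowed _ hj fun hj' => by
    simpa [h.rset_eq_empty] using mem_rset.2 hj'
  exact ha.2

theorem IsMixed.lt (h : IsMixed sys S o) (e : Elt n) : o e < n + 2 := by
  by_contra hlt
  obtain ⟨i, hi, -⟩ := h.allowed e (by omega) (by omega)
  omega

theorem IsMixed.card_le (h : IsMixed sys S o) : (osupp o).card ≤ 2 * n := by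
  classical
  have h1 : ((osupp o).filter fun e => o e = n + 1).card ≤ n := by
    have : LinearIndepOn ℝ (fixedMat sys).col
        (((osupp o).filter fun e => o e = n + 1 : Finset (Elt n)) : Set (Elt n)) :=
      LinearIndepOn.mono h.fixed fun e he => (Finset.mem_filter.1 he).2
    simpa using LinearIndependent.fintype_card_le_finrank this
  have h2 : ((osupp o).filter fun e => ¬ o e = n + 1).card ≤ n := by
    refine (Finset.card_le_card_of_injOn (t := Finset.range n) (fun e => o e - 1) (fun e he => ?_) fun e he e' he' hee => ?_).trans (by simp)
    · have he := Finset.mem_filter.1 he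
      obtain ⟨i, hi, -⟩ := h.allowed e (mem_osupp.1 he.1) he.2
      have := i.2
      simp only [Finset.coe_range, Set.mem_Iio]
      omega
    · have he := Finset.mem_filter.1 he
      have he' := Finset.mem_filter.1 he'
      have h0 := mem_osupp.1 he.1
      have h0' := mem_osupp.1 he'.1
      simp only at hee
      exact h.inj e e' h0 he.2 (by omega)
  have := Finset.card_filter_add_card_filter_not (s := osupp o) fun e => o e = n + 1
  omega

theorem IsMixed.card_le_mixedRank (h : IsMixed sys S o) : (osupp o).card ≤ sys.mixedRank S := by
  classical
  refine Finset.le_sup (f := Finset.card) (Finset.mem_filter.2 ⟨Finset.mem_univ _,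
    (osupp o).filter (fun e => o e = n + 1), (osupp o).filter (fun e => ¬ o e = n + 1), ?_, ?_, ?_⟩)
  · refine LinearIndepOn.mono h.fixed fun e he => ?_
    exact (Finset.mem_filter.1 he).2
  · rw [freeIndep_iff]
    have : ∀ e, ∃ i : Fin n, o e ≠ 0 → o e ≠ n + 1 → o e = i + 1 ∧ Allowed sys S e i := fun e => by
      by_cases h' : o e ≠ 0 ∧ o e ≠ n + 1
      · obtain ⟨i, hi⟩ := h.allowed e h'.1 h'.2
        exact ⟨i, fun _ _ => hi⟩
      · exact ⟨Sum.elim id (Sum.elim id id) e, fun h0 h1 => absurd ⟨h0, h1⟩ h'⟩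
    choose r hr using this
    refine ⟨r, fun e he e' he' hee => ?_, fun e he => ?_⟩
    · have he := Finset.mem_filter.1 he
      have he' := Finset.mem_filter.1 he'
      refine h.inj e e' (mem_osupp.1 he.1) he.2 ?_
      rw [(hr e (mem_osupp.1 he.1) he.2).1, (hr e' (mem_osupp.1 he'.1) he'.2).1, hee]
    · have he := Finset.mem_filter.1 he
      exact (hr e (mem_osupp.1 he.1) he.2).2
  · exact (Finset.filter_union_filter_not_eq _ _).symm

/-- A column covered by both matroids is assigned to the fixed one only, so a largest set of the
union is coded by one option per column. -/
theorem exists_isMixed (sys : DescriptorSystem n) (S : Finset (Fin n)) :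
    ∃ o, IsMixed sys S o ∧ (osupp o).card = sys.mixedRank S := by
  classical
  suffices H : ∃ o, IsMixed sys S o ∧ sys.mixedRank S ≤ (osupp o).card by
    obtain ⟨o, ho, hle⟩ := H
    exact ⟨o, ho, le_antisymm ho.card_le_mixedRank hle⟩
  have hne : (Finset.univ.filter (unionIndep sys.fixedIndep (sys.freeIndep S))).Nonempty :=
    ⟨∅, Finset.mem_filter.2 ⟨Finset.mem_univ _, ∅, ∅, by
      simp [DescriptorSystem.fixedIndep, linearIndep], by
      rw [freeIndep_iff]
      exact ⟨fun e => Sum.elim id (Sum.elim id id) e, by simp, by simp⟩, by simp⟩⟩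
  obtain ⟨X, hX, hsup⟩ := Finset.exists_mem_eq_sup _ hne Finset.card
  obtain ⟨X₁, X₂, h1, h2, rfl⟩ := (Finset.mem_filter.1 hX).2
  obtain ⟨r, hr, hal⟩ := (freeIndep_iff sys S X₂).1 h2
  set o : Elt n → ℕ := fun e => if e ∈ X₁ then n + 1 else if e ∈ X₂ then r e + 1 else 0 with ho
  have hne : ∀ e, o e ≠ 0 → o e ≠ n + 1 → e ∈ X₂ ∧ o e = r e + 1 := by
    intro e h0 h1
    simp only [ho] at h0 h1 ⊢
    split_ifs at h0 h1 ⊢ with h h'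
    · exact absurd rfl h1
    · exact ⟨h', rfl⟩
    · exact absurd rfl h0
  refine ⟨o, ⟨LinearIndepOn.mono h1 fun e he => ?_, fun e h0 h1 => ?_, fun e e' h0 h1 hee => ?_⟩, ?_⟩
  · have he : o e = n + 1 := he
    simp only [ho] at he
    split_ifs at he with h h'
    · exact h
    · have := (r e).2
      omega
  · obtain ⟨h, h'⟩ := hne e h0 h1
    exact ⟨r e, h', hal e h⟩
  · obtain ⟨h, h'⟩ := hne e h0 h1
    obtain ⟨k, k'⟩ := hne e' (hee ▸ h0) (hee ▸ h1)
    exact hr h k (Fin.ext (by omega))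
  · refine hsup.le.trans (Finset.card_le_card fun e he => mem_osupp.2 ?_)
    simp only [ho]
    rcases Finset.mem_union.1 he with he | he
    · simp [he]
    · split_ifs <;> simp

theorem mixedRank_le (S : Finset (Fin n)) : sys.mixedRank S ≤ 2 * n := by
  obtain ⟨o, ho, hc⟩ := exists_isMixed sys S
  exact hc ▸ ho.card_le

theorem mixedRank_mono (h : S ⊆ S') : sys.mixedRank S ≤ sys.mixedRank S' := by
  obtain ⟨o, ho, hc⟩ := exists_isMixed sys S
  exact hc ▸ (ho.of_forall fun j _ hj => h hj).card_le_mixedRank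

/-- With all of `T_B` available, the columns of `I` go to the fixed matroid and those of `T_B` to
the generic one. -/
theorem mixedRank_univ : sys.mixedRank Finset.univ = 2 * n := by
  classical
  refine le_antisymm (mixedRank_le _) ?_
  set o : Elt n → ℕ := Sum.elim (fun _ => n + 1) (Sum.elim (fun _ => 0) fun j => (j : ℕ) + 1) with ho
  have hm : IsMixed sys Finset.univ o := by
    refine ⟨?_, ?_, ?_⟩
    · have hs : {e | o e = n + 1} = Sum.inl '' (Set.univ : Set (Fin n)) := by
        ext e
        rcases e with j | j | j
        · simp [ho]
        · simp [ho]
        · simp [ho, j.2.ne]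
      rw [hs, ← linearIndepOn_comp_iff _ Sum.inl_injective]
      have : LinearIndependent ℝ fun k : Fin n => (Pi.single k 1 : Fin n → ℝ) :=
        Pi.linearIndependent_single_one (Fin n) ℝ
      have heq : (fun j => (fixedMat sys).col (Sum.inl j)) =
          fun k : Fin n => (Pi.single k 1 : Fin n → ℝ) := by
        funext j k
        simp [fixedMat, Matrix.col, Matrix.one_apply, Pi.single_apply]
      rw [heq]
      exact linearIndepOn_univ_iff.2 this
    · rintro (j | j | j) h0 h1
      · exact absurd rfl h1
      · exact absurd rfl h0
      · exact ⟨j, rfl, rfl, Finset.mem_univ _⟩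
    · rintro (j | j | j) e' h0 h1 h
      · exact absurd rfl h1
      · exact absurd rfl h0
      · rcases e' with k | k | k
        · have : (j : ℕ) + 1 = n + 1 := h
          omega
        · have : (j : ℕ) + 1 = 0 := h
          omega
        · have : (j : ℕ) + 1 = k + 1 := h
          rw [Fin.ext (by omega : (j : ℕ) = k)]
  refine le_trans (le_of_eq ?_) hm.card_le_mixedRank
  have : osupp o = (Finset.univ.disjSum (Finset.univ.map Function.Embedding.inr) : Finset (Elt n)) := by
    ext e
    rcases e with j | j | j <;> simp [mem_osupp, ho]
  rw [this]
  simp [two_mul]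

theorem mixedRank_insert_le (i : Fin n) : sys.mixedRank (insert i S) ≤ sys.mixedRank S + 1 := by
  classical
  obtain ⟨o, ho, hc⟩ := exists_isMixed sys (insert i S)
  set e₀ : Elt n := Sum.inr (Sum.inr i) with he₀
  set o' := Function.update o e₀ 0 with ho'
  have hne : ∀ e, o' e ≠ 0 → o' e = o e ∧ e ≠ e₀ := fun e he => by
    have : e ≠ e₀ := by
      rintro rfl
      exact he (Function.update_self _ _ _)
    exact ⟨Function.update_of_ne this _ _, this⟩
  have hm : IsMixed sys (insert i S) o' := by
    refine ⟨LinearIndepOn.mono ho.fixed fun e he => ?_, fun e h0 h1 => ?_, fun e e' h0 h1 h => ?_⟩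
    · have he : o' e = n + 1 := he
      change o e = n + 1
      rw [← (hne e (by omega)).1, he]
    · have he := (hne e h0).1
      rw [he] at h0 h1 ⊢
      exact ho.allowed e h0 h1
    · have h0' : o' e' ≠ 0 := h ▸ h0
      have he := (hne e h0).1
      rw [he] at h0 h1 h
      rw [(hne e' h0').1] at h
      exact ho.inj e e' h0 h1 h
  have hm' : IsMixed sys S o' := hm.of_forall fun j hj hjS => by
    rcases Finset.mem_insert.1 hjS with rfl | h
    · exact absurd rfl (hne _ hj).2
    · exact h
  have hsub : osupp o ⊆ insert e₀ (osupp o') := fun e he => by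
    by_cases h : e = e₀
    · simp [h]
    · refine Finset.mem_insert_of_mem (mem_osupp.2 ?_)
      rw [ho', Function.update_of_ne h]
      exact mem_osupp.1 he
  have h1 := Finset.card_le_card hsub
  have h2 := Finset.card_insert_le e₀ (osupp o')
  have h3 := hm'.card_le_mixedRank
  omega

/-- The selection with given options. -/
def toSel (o : Elt n → ℕ) (c : ℕ) : ℕ :=
  if h : c < n + (n + n) then o ((eltEquiv n).symm ⟨c, h⟩) else 0

@[simp] theorem toSel_eltEquiv (o : Elt n → ℕ) (e : Elt n) : toSel o (eltEquiv n e) = o e := by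
  simp [toSel]

theorem isSel_toSel (u w : ℕ → ℕ → ℝ) (h : ∀ e, o e < n + 2) :
    (selInst sys S u w).IsSel (toSel o) := by
  refine ⟨fun c => ?_, fun c hc => dif_neg (not_lt.2 hc)⟩
  unfold toSel
  split_ifs
  · exact h _
  · exact Nat.succ_pos _

theorem supp_eq_map (sys : DescriptorSystem n) (S : Finset (Fin n)) (u w : ℕ → ℕ → ℝ) (I : ℕ → ℕ) :
    (selInst sys S u w).supp I = (osupp fun e : Elt n => I (eltEquiv n e)).map
      ((eltEquiv n).toEmbedding.trans Fin.valEmbedding) := by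
  ext c
  simp only [Inst.mem_supp, Finset.mem_map, mem_osupp]
  constructor
  · rintro ⟨hc, h0⟩
    obtain ⟨e, rfl⟩ := exists_eltEquiv hc
    exact ⟨e, h0, rfl⟩
  · rintro ⟨e, he, rfl⟩
    exact ⟨(eltEquiv n e).2, he⟩

theorem IsMixed.indep_toSel (h : IsMixed sys S o) (u w : ℕ → ℕ → ℝ) :
    (selInst sys S u w).Indep (toSel o) := by
  rw [selInst_indep_iff sys S u w (isSel_toSel u w h.lt)]
  simp only [toSel_eltEquiv]
  rw [h.rset_eq_empty, core_eq_self h.rset_eq_empty]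
  exact ⟨h, by simp⟩

/-- Augmenting an optimal selection for `S` within `S'` keeps all used columns and adds just one. If
the result used no column of `T_B` outside `S`, the rank of `S` would have been larger. Hence the
added column is that of some state `i ∉ S`, and the result lives over `insert i S`. -/
theorem exists_mixedRank_insert (hS : S ⊆ S') (hlt : sys.mixedRank S < sys.mixedRank S') :
    ∃ i ∈ S', i ∉ S ∧ sys.mixedRank S < sys.mixedRank (insert i S) := by
  classical
  obtain ⟨o, ho, hc⟩ := exists_isMixed sys S
  obtain ⟨o', ho', hc'⟩ := exists_isMixed sys S'
  have hoS' : IsMixed sys S' o := ho.of_forall fun j _ hj => hS hj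
  -- Zero state vectors rule out leaving out any state, so the instance describes only the union
  -- matroid.
  set D := selInst sys S' (fun _ _ => 0) fun _ _ => 0 with hD
  obtain ⟨I, c, hI, hIi, hcn, hsupp⟩ := Inst.exists_augment (D := D)
    (selInst_wf sys S' _ fun _ => rfl) (isSel_toSel _ _ hoS'.lt) (hoS'.indep_toSel _ _)
    (isSel_toSel _ _ ho'.lt) (ho'.indep_toSel _ _) (by
      rw [hD, supp_eq_map, supp_eq_map, Finset.card_map, Finset.card_map]
      simpa only [toSel_eltEquiv, hc, hc'] using hlt)
  obtain ⟨hm, hr⟩ := (selInst_indep_iff sys S' _ _ hI).1 hIi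
  set o'' : Elt n → ℕ := fun e => I (eltEquiv n e) with ho''
  have hr0 : rset o'' = ∅ := Finset.eq_empty_of_forall_notMem fun j hj =>
    hr.ne_zero (Finset.mem_coe.2 hj) rfl
  rw [core_eq_self hr0] at hm
  have hcard : (osupp o'').card = sys.mixedRank S + 1 := by
    have h1 := congrArg Finset.card hsupp
    rw [Finset.card_insert_of_notMem hcn, hD, supp_eq_map, supp_eq_map, Finset.card_map,
      Finset.card_map] at h1
    simpa only [toSel_eltEquiv, hc] using h1
  have hmem : ∀ e, o'' e ≠ 0 → (eltEquiv n e : ℕ) = c ∨ o e ≠ 0 := fun e he => by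
    have : (eltEquiv n e : ℕ) ∈ D.supp I := Inst.mem_supp.2 ⟨(eltEquiv n e).2, he⟩
    rw [hsupp, Finset.mem_insert, Inst.mem_supp, toSel_eltEquiv] at this
    exact this.imp_right And.right
  by_cases hall : ∀ j, o'' (Sum.inr (Sum.inr j)) ≠ 0 → j ∈ S
  · have := (hm.of_forall fun j hj _ => hall j hj).card_le_mixedRank
    omega
  · push Not at hall
    obtain ⟨i, hi0, hiS⟩ := hall
    have hic : (eltEquiv n (Sum.inr (Sum.inr i)) : ℕ) = c :=
      (hmem _ hi0).resolve_right fun h => hiS (ho.mem h)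
    refine ⟨i, hm.mem hi0, hiS, ?_⟩
    have := (hm.of_forall (S' := insert i S) fun j hj _ => ?_).card_le_mixedRank
    · omega
    · rcases hmem _ hj with h | h
      · have := (eltEquiv n).injective (Fin.ext (h.trans hic.symm))
        simp only [Sum.inr.injEq] at this
        simp [this]
      · exact Finset.mem_insert_of_mem (ho.mem h)

/-- Independence in the dual of the first matroid. -/
theorem dualIndep_rho1_iff (S : Finset (Fin n)) :
    dualIndep (ofRank sys.rho1) Sᶜ ↔ sys.mixedRank S = 2 * n := by
  classical
  have hsub : ∀ B : Finset (Fin n), Sᶜ ⊆ Bᶜ ↔ B ⊆ S := fun B => compl_le_compl_iff_le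
  have hof : ∀ B, ofRank sys.rho1 B ↔ sys.mixedRank B = sys.mixedRank ∅ + B.card := fun B => by
    have := mixedRank_mono (sys := sys) (Finset.empty_subset B)
    rw [ofRank, DescriptorSystem.rho1]
    omega
  -- One new state raises the mixed rank by at most one, so a strict increase preserves
  -- independence. The argument works with this rank directly and does not need the matroid axioms
  -- for `rho1`.
  have hins : ∀ B i, ofRank sys.rho1 B → i ∉ B → sys.mixedRank B < sys.mixedRank (insert i B) →
      ofRank sys.rho1 (insert i B) := fun B i hB hi hlt => by
    have := mixedRank_insert_le (sys := sys) (S := B) i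
    rw [hof] at hB ⊢
    rw [Finset.card_insert_of_notMem hi]
    omega
  simp only [dualIndep, hsub]
  constructor
  -- A maximal independent set reaches rank `2 * n`, since below that value some state of `univ`
  -- would raise the rank.
  · rintro ⟨B, ⟨hB, hmax⟩, hBS⟩
    by_contra hne
    have h1 := mixedRank_mono (sys := sys) hBS
    have h2 := mixedRank_le (sys := sys) S
    obtain ⟨i, -, hiB, hlt⟩ := exists_mixedRank_insert (sys := sys) (Finset.subset_univ B)
      (by rw [mixedRank_univ]; omega)
    have := hmax _ (hins B i hB hiB hlt) (Finset.subset_insert _ _)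
    exact hiB (this ▸ Finset.mem_insert_self i B)
  · intro hS
    obtain ⟨B, hB, hmax⟩ := (S.powerset.filter (ofRank sys.rho1)).exists_max_image Finset.card
      ⟨∅, Finset.mem_filter.2 ⟨Finset.empty_mem_powerset S, (hof ∅).2 (by simp)⟩⟩
    obtain ⟨hBS, hB⟩ := Finset.mem_filter.1 hB
    rw [Finset.mem_powerset] at hBS
    have hBn : sys.mixedRank B = 2 * n := by
      by_contra hne
      have h2 := mixedRank_le (sys := sys) B
      obtain ⟨i, hi, hiB, hlt⟩ := exists_mixedRank_insert (sys := sys) hBS (by omega)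
      have := hmax (insert i B) (Finset.mem_filter.2
        ⟨Finset.mem_powerset.2 (Finset.insert_subset hi hBS), hins B i hB hiB hlt⟩)
      rw [Finset.card_insert_of_notMem hiB] at this
      omega
    -- An independent set larger than `B` would need a mixed rank above `2 * n`.
    refine ⟨B, ⟨hB, fun C hC hBC => (Finset.eq_of_subset_of_card_le hBC ?_).symm⟩, hBS⟩
    have h1 := mixedRank_le (sys := sys) C
    rw [hof] at hB hC
    omega

end RealWhile

open IndepSystem

namespace RealWhile

/-! ### The selection problem -/

section Problem

variable {n : ℕ}

/-- The weights of the states as a function on the natural numbers. -/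
noncomputable def entV (τ : Fin n → ℝ) (j : ℕ) : ℝ := if h : j < n then τ ⟨j, h⟩ else 0

@[simp] theorem entV_fin (τ : Fin n → ℝ) (j : Fin n) : entV τ j = τ j := by simp [entV]

/-- A weight that outweighs any selection of states. -/
noncomputable def bigWeight (τ : Fin n → ℝ) : ℝ :=
  1 + ∑ j ∈ Finset.range n, (1 + 1) * (entV τ j * entV τ j + 1)

/-- Leaving out state `j` costs `τ j`, so maximal weight means that the states left out have the
least total weight. All other choices earn `bigWeight`, so a selection of given size uses the union
part as much as possible first. -/
noncomputable def wts (τ : Fin n → ℝ) (c o : ℕ) : ℝ :=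
  if o = 0 then 0 else if n + n ≤ c ∧ o = n + 1 then 0 - entV τ (c - (n + n)) else bigWeight τ

/-- The rainbow independent set instance for the selection problem. -/
noncomputable def probInst (sys : DescriptorSystem n) (m : Fin n → Fin n ⊕ Fin n)
    (rule : IsolationRule) (τ : Fin n → ℝ) : Inst :=
  selInst sys Finset.univ (isoVec sys m rule) (wts τ)

/-- The solution of the instance for the number `ρ` of states that are left out. -/
noncomputable def probSol (sys : DescriptorSystem n) (m : Fin n → Fin n ⊕ Fin n)
    (rule : IsolationRule) (τ : Fin n → ℝ) (ρ : ℕ) : ℕ → ℕ :=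
  (probInst sys m rule τ).solve (2 * n + ρ)

variable {sys : DescriptorSystem n} {m : Fin n → Fin n ⊕ Fin n} {rule : IsolationRule}
  {τ : Fin n → ℝ} {k ρ : ℕ} {S : Finset (Fin n)}

theorem probInst_wf : (probInst sys m rule τ).WF :=
  selInst_wf sys _ _ fun c => by simp [wts]

/-- The free value `M` and function `r` let the same splitting serve for counting (`card_osupp`) and
for weights (`probInst_weight`). -/
theorem sum_core_add_sum_rset (o : Elt n → ℕ) (M : ℝ) (r : Fin n → ℝ) :
    (∑ e, if o e = 0 then 0 else
      Sum.elim (fun _ => M) (Sum.elim (fun _ => M) fun j => if o (Sum.inr (Sum.inr j)) = n + 1 then r j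
        else M) e) = M * (osupp (core o)).card + ∑ j ∈ rset o, r j := by
  classical
  rw [osupp, Finset.card_filter, rset, Finset.sum_filter]
  push_cast
  rw [Finset.mul_sum]
  simp only [Fintype.sum_sum_type, Sum.elim_inl, Sum.elim_inr, core]
  simp only [← Finset.sum_add_distrib]
  refine Finset.sum_congr rfl fun j _ => ?_
  have h0 : ∀ a : ℕ, (if a = 0 then 0 else M) = M * if a ≠ 0 then 1 else 0 := fun a => by
    by_cases h : a = 0 <;> simp [h]
  rw [h0, h0, add_assoc, add_assoc]
  congr 2
  by_cases h : o (Sum.inr (Sum.inr j)) = n + 1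
  · simp [h]
  · by_cases h0 : o (Sum.inr (Sum.inr j)) = 0 <;> simp [h, h0]

theorem card_osupp (o : Elt n → ℕ) : (osupp o).card = (osupp (core o)).card + (rset o).card := by
  have h := sum_core_add_sum_rset o 1 fun _ => 1
  have h' : ((osupp o).card : ℝ) = (osupp (core o)).card + (rset o).card := by
    rw [one_mul, Finset.sum_const, nsmul_eq_mul, mul_one] at h
    rw [← h, osupp, Finset.card_filter]
    push_cast
    refine Finset.sum_congr rfl fun e _ => ?_
    rcases e with j | j | j <;> simp
  exact_mod_cast h'

theorem probInst_weight (I : ℕ → ℕ) : (probInst sys m rule τ).weight I =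
    bigWeight τ * (osupp (core fun e : Elt n => I (eltEquiv n e))).card -
      ∑ j ∈ rset fun e : Elt n => I (eltEquiv n e), τ j := by
  rw [sub_eq_add_neg, ← Finset.sum_neg_distrib, ← sum_core_add_sum_rset]
  change ∑ c ∈ Finset.range (n + (n + n)), wts τ c (I c) = _
  rw [Finset.sum_range, ← (eltEquiv n).sum_comp]
  refine Finset.sum_congr rfl fun e _ => ?_
  unfold wts
  rcases e with j | j | j
  · have : ¬ n + n ≤ (j : ℕ) := by omega
    simp [this]
  · have : ¬ n ≤ (j : ℕ) := by omega
    simp [this]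
  · have h : n + (n + (j : ℕ)) - (n + n) = j := by omega
    have h' : n + n ≤ n + (n + (j : ℕ)) := by omega
    simp [h, h']

/-- By `|t| ≤ t ^ 2 + 1`, each partial sum is at most half of `bigWeight τ - 1` in absolute value.
-/
theorem sum_sub_sum_lt_bigWeight (A B : Finset (Fin n)) :
    ∑ j ∈ A, τ j - ∑ j ∈ B, τ j < bigWeight τ := by
  have habs : ∀ A : Finset (Fin n), |∑ j ∈ A, τ j| ≤ ∑ j, (τ j * τ j + 1) := fun A =>
    (Finset.abs_sum_le_sum_abs _ _).trans ((Finset.sum_le_univ_sum_of_nonneg fun j => abs_nonneg _).trans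
      (Finset.sum_le_sum fun j _ => by
        rw [← abs_mul_abs_self (τ j)]
        nlinarith [sq_nonneg (|τ j| - 1), abs_nonneg (τ j)]))
  have h1 := abs_le.1 (habs A)
  have h2 := abs_le.1 (habs B)
  rw [bigWeight, ← Finset.mul_sum, Finset.sum_range]
  simp only [entV_fin]
  linarith [h1.2, h2.1]

/-- A selection that uses up the rank leaves out the complement of a feasible set. -/
theorem isFeasible_of_indep {I : ℕ → ℕ} (hI : (probInst sys m rule τ).IsSel I)
    (hi : (probInst sys m rule τ).Indep I)
    (hc : (osupp (core fun e : Elt n => I (eltEquiv n e))).card = 2 * n)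
    (hk : n ≤ (rset fun e : Elt n => I (eltEquiv n e)).card + k) :
    sys.IsFeasible m rule k (rset fun e : Elt n => I (eltEquiv n e))ᶜ := by
  obtain ⟨h1, h2⟩ := (selInst_indep_iff sys _ _ _ hI).1 hi
  refine ⟨?_, (dualIndep_rho1_iff _).2 (le_antisymm (mixedRank_le _) ?_), (dualIndep_rho2_iff _).2 ?_⟩
  · rw [Finset.card_compl, Fintype.card_fin]
    omega
  · rw [← hc]
    refine (h1.of_forall fun j hj _ => ?_).card_le_mixedRank
    rw [Finset.mem_compl, mem_rset]
    intro h
    exact hj (if_pos h)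
  · rwa [compl_compl]

/-- A largest selection of the union part for `S` uses no column of `T_B` outside `S`; those columns
are free to mark the states left out. -/
theorem exists_indep_of_isFeasible (τ : Fin n → ℝ) (hS : sys.IsFeasible m rule k S) :
    ∃ I, (probInst sys m rule τ).IsSel I ∧ (probInst sys m rule τ).Indep I ∧
      (osupp (core fun e : Elt n => I (eltEquiv n e))).card = 2 * n ∧
      (rset fun e : Elt n => I (eltEquiv n e)) = Sᶜ := by
  classical
  obtain ⟨-, h1, h2⟩ := hS
  rw [dualIndep_rho1_iff] at h1
  rw [dualIndep_rho2_iff] at h2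
  obtain ⟨o, ho, hc⟩ := exists_isMixed sys S
  set o' : Elt n → ℕ := fun e => if ∃ j, j ∉ S ∧ e = Sum.inr (Sum.inr j) then n + 1 else o e with ho'
  have hr : rset o' = Sᶜ := by
    ext j
    rw [mem_rset, Finset.mem_compl]
    simp only [ho']
    split_ifs with h
    · simpa using h
    · have h' : j ∈ S := by simpa using h
      have := Finset.eq_empty_iff_forall_notMem.1 ho.rset_eq_empty j
      rw [mem_rset] at this
      simp [h', this]
  have hcore : core o' = o := by
    funext e
    rcases e with j | j | j
    · simp [core, ho']
    · simp [core, ho']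
    · simp only [core]
      split_ifs with h
      · have : j ∉ S := by simpa [hr] using mem_rset.2 h
        by_contra h0
        exact this (ho.mem (Ne.symm h0))
      · have : j ∈ S := by
          by_contra hj
          exact h (mem_rset.1 (hr ▸ Finset.mem_compl.2 hj))
        simp [ho', this]
  have hlt : ∀ e, o' e < n + 2 := fun e => by
    have := ho.lt e
    simp only [ho']
    split_ifs <;> omega
  refine ⟨toSel o', isSel_toSel _ _ hlt, ?_, ?_, ?_⟩
  · refine (selInst_indep_iff sys _ _ _ (isSel_toSel _ _ hlt)).2 ?_
    simp only [toSel_eltEquiv]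
    rw [hcore, hr]
    exact ⟨ho.of_forall fun j _ _ => Finset.mem_univ j, h2⟩
  · simp only [toSel_eltEquiv]
    rw [hcore, hc, h1]
  · simp only [toSel_eltEquiv]
    exact hr

/-- The states that are left out by the solution for `ρ`. -/
noncomputable def probOut (sys : DescriptorSystem n) (m : Fin n → Fin n ⊕ Fin n)
    (rule : IsolationRule) (τ : Fin n → ℝ) (ρ : ℕ) : Finset (Fin n) :=
  rset fun e : Elt n => probSol sys m rule τ ρ (eltEquiv n e)

/-- The solution for `ρ` yields a feasible set. -/
def IsGood (sys : DescriptorSystem n) (m : Fin n → Fin n ⊕ Fin n) (rule : IsolationRule)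
    (τ : Fin n → ℝ) (k ρ : ℕ) : Prop :=
  n ≤ ρ + k ∧ ((probInst sys m rule τ).supp (probSol sys m rule τ ρ)).card = 2 * n + ρ ∧
    (probOut sys m rule τ ρ).card = ρ

theorem card_supp (I : ℕ → ℕ) : ((probInst sys m rule τ).supp I).card =
    (osupp (core fun e : Elt n => I (eltEquiv n e))).card +
      (rset fun e : Elt n => I (eltEquiv n e)).card := by
  rw [probInst, supp_eq_map, Finset.card_map, card_osupp]

theorem IsGood.isFeasible (h : IsGood sys m rule τ k ρ) :
    sys.IsFeasible m rule k (probOut sys m rule τ ρ)ᶜ := by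
  obtain ⟨h1, h2, h3⟩ := h
  obtain ⟨k1, k2, -, -⟩ := Inst.solve_spec (probInst_wf (sys := sys) (m := m) (rule := rule) (τ := τ))
    (2 * n + ρ)
  rw [card_supp] at h2
  refine isFeasible_of_indep k1 k2 ?_ ?_
  · change _ + (probOut sys m rule τ ρ).card = _ at h2
    rw [h3] at h2
    exact Nat.add_right_cancel h2
  · change n ≤ (probOut sys m rule τ ρ).card + k
    omega

/-- A feasible `S` supplies a competitor of size `2 * n + ρ` with full union part. Once the solution
also has full union part, it leaves out exactly `ρ` states. Comparing weights then compares the sums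
of `τ` over the states left out, hence over the complements. -/
theorem isGood_of_isFeasible (hS : sys.IsFeasible m rule k S) :
    IsGood sys m rule τ k Sᶜ.card ∧
      ∑ j ∈ S, τ j ≤ ∑ j ∈ (probOut sys m rule τ Sᶜ.card)ᶜ, τ j := by
  obtain ⟨J, hJ, hJi, hJc, hJr⟩ := exists_indep_of_isFeasible τ hS
  set ρ := Sᶜ.card with hρ
  obtain ⟨k1, k2, k3, k4⟩ := Inst.solve_spec
    (probInst_wf (sys := sys) (m := m) (rule := rule) (τ := τ)) (2 * n + ρ)
  have hJs : ((probInst sys m rule τ).supp J).card = 2 * n + ρ := by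
    rw [card_supp, hJc, hJr]
  have hcard : ((probInst sys m rule τ).supp (probSol sys m rule τ ρ)).card = 2 * n + ρ := by
    by_contra h
    exact k4 h J hJ hJi hJs
  have hw := k3 hcard J hJ hJi hJs
  change _ ≤ (probInst sys m rule τ).weight (probSol sys m rule τ ρ) at hw
  rw [probInst_weight, probInst_weight, hJc, hJr] at hw
  have hcard' := hcard
  rw [card_supp] at hcard'
  have hle := ((selInst_indep_iff sys _ _ _ k1).1 k2).1.card_le
  change (osupp (core fun e : Elt n => probSol sys m rule τ ρ (eltEquiv n e))).card ≤ _ at hle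
  change _ ≤ _ - ∑ j ∈ probOut sys m rule τ ρ, τ j at hw
  change _ + (probOut sys m rule τ ρ).card = _ at hcard'
  set a := (osupp (core fun e : Elt n => probSol sys m rule τ ρ (eltEquiv n e))).card with ha
  have hM := sum_sub_sum_lt_bigWeight (τ := τ) Sᶜ (probOut sys m rule τ ρ)
  have hM0 : 0 < bigWeight τ := by simpa using sum_sub_sum_lt_bigWeight (τ := τ) ∅ ∅
  -- A smaller union part would lose at least one `bigWeight` against `J`, more than the states left
  -- out can make up.
  have haeq : a = 2 * n := by
    by_contra hne
    have hlt : (a : ℝ) + 1 ≤ (2 * n : ℕ) := by exact_mod_cast (show a + 1 ≤ 2 * n by omega)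
    nlinarith
  have h1 := Finset.sum_add_sum_compl S τ
  have h2 := Finset.sum_add_sum_compl (probOut sys m rule τ ρ) τ
  rw [haeq] at hw
  refine ⟨⟨?_, hcard, by omega⟩, by linarith⟩
  have h3 := hS.1
  rw [hρ, Finset.card_compl, Fintype.card_fin]
  omega

end Problem

end RealWhile

/-! ### Programs for the selection problem -/

open IndepSystem

namespace RealWhile

section Access

variable {ι : Type} {sz N n : ι → ℕ} {f : ι → Val} {sys : ∀ i, DescriptorSystem (n i)}
  {m : ∀ i, Fin (n i) → Fin (n i) ⊕ Fin (n i)} {rule : IsolationRule} {k : ι → ℕ}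
  {τ : ∀ i, Fin (n i) → ℝ}

/-- The data of a selection problem are available. -/
structure CompProb {l : ι → ℕ} (sz : ι → ℕ) (f : ι → Val) (sys : ∀ i, DescriptorSystem (l i))
    (m : ∀ i, Fin (l i) → Fin (l i) ⊕ Fin (l i)) (k : ι → ℕ) (τ : ∀ i, Fin (l i) → ℝ) : Prop
    extends CompMat sz f sys m where
  -- The bound `k` need not be polynomial in `n`, so it is available only as a real number for
  -- comparisons.
  bound : CompR sz f fun i => (k i : ℝ)
  wts : Comp sz f fun i => Val.ofVec fun j => Val.num (τ i j)

theorem CompProb.reindex {κ : Type} (π : κ → ι) (h : CompProb sz f sys m k τ) :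
    CompProb (fun x => sz (π x)) (fun x => f (π x)) (fun x => sys (π x)) (fun x => m (π x))
      (fun x => k (π x)) fun x => τ (π x) :=
  ⟨h.toCompMat.reindex π, h.bound.reindex π, h.wts.reindex π⟩

theorem CompProb.weaken (a : ι → Val) (h : CompProb sz f sys m k τ) :
    CompProb sz (fun i => Val.cons (a i) (f i)) sys m k τ :=
  ⟨h.toCompMat.weaken a, h.bound.weaken a, h.wts.weaken a⟩

theorem CompProb.up (h : CompProb sz f sys m k τ) :
    CompProb (bsz sz N) (benv f N) (fun x => sys x.1) (fun x => m x.1) (fun x => k x.1)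
      fun x => τ x.1 :=
  (h.reindex (fun x : Σ i, Fin (N i) => x.1)).weaken _

theorem CompProb.entV (h : CompProb sz f sys m k τ) {j : ι → ℕ} (hj : CompN sz f j) :
    CompR sz f fun i => entV (τ i) (j i) :=
  CompR.entV h.n h.wts hj

theorem CompProb.bigWeight (h : CompProb sz f sys m k τ) :
    CompR sz f fun i => bigWeight (τ i) := by
  have hj := h.up.entV (CompN.idx h.n)
  exact CompR.add Comp.one (CompR.sum (r := fun i j =>
    (1 + 1) * (RealWhile.entV (τ i) j * RealWhile.entV (τ i) j + 1)) h.n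
      (CompR.mul (CompR.add Comp.one Comp.one) (CompR.add (CompR.mul hj hj) Comp.one)))

theorem CompSys.allowedP (h : CompSys sz f sys) {c j : ι → ℕ} (hc : CompN sz f c)
    (hj : CompN sz f j) : CompP sz f fun i => allowedP (sys i) Finset.univ (c i) (j i) := by
  refine CompP.or ((hc.lt h.n).and (hj.eq hc)) (CompP.or ((h.n.le hc).and
    (CompP.entP h.n h.TA hj (hc.sub h.n))) (CompP.and ?_ (hc.eq (h.n.add (h.n.add hj)))))
  exact (hj.lt h.n).congr fun i => by simp

theorem CompProb.inst (h : CompProb sz f sys m k τ) :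
    CompI sz f fun i => probInst (sys i) (m i) rule (τ i) := by
  classical
  have hnn : CompN sz f fun i => n i + n i := h.n.add h.n
  have hq : CompN sz f fun i => n i + (n i + n i) := h.n.add hnn
  have hp : CompN sz f fun i => n i + 2 := h.n.add (CompN.const 2)
  refine ⟨hq, hp, hq, ?_, ?_, fun i => probInst_wf⟩
  · have hc := CompN.idx hq.succ
    have ho := CompN.idx (hp.up (N := fun i => n i + (n i + n i) + 1))
    have hk := CompN.idx ((hq.up (N := fun i => n i + (n i + n i) + 1)).up (N := fun i => n i.1 + 2))
    have h3 := ((h.up (N := fun i => n i + (n i + n i) + 1)).up (N := fun i => n i.1 + 2)).up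
      (N := fun i => n i.1.1 + (n i.1.1 + n i.1.1))
    have hc' := hc.up (N := fun i => n i.1 + 2) |>.up (N := fun i => n i.1.1 + (n i.1.1 + n i.1.1))
    have ho' := ho.up (N := fun i => n i.1.1 + (n i.1.1 + n i.1.1))
    have hs := ho'.eq h3.n.succ
    refine Comp.vec hq.succ (CompR.mat
      (a := fun x : Σ i, Fin (n i + (n i + n i) + 1) => (probInst (sys x.1) (m x.1) rule (τ x.1)).v x.2)
      hp.up hq.up ?_)
    exact CompR.ite (hk.lt h3.n) (CompR.ite hs (CompR.ite (hc'.lt h3.n)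
        (CompR.ite (hk.eq hc') Comp.one CompR.zero) (CompR.ent h3.n h3.QA hk (hc'.sub h3.n))) CompR.zero)
      (CompR.ite (hk.lt (h3.n.add h3.n)) (CompR.ite ((h3.allowedP hc' (hk.sub h3.n)).and
        (ho'.eq (hk.sub h3.n).succ)) Comp.one CompR.zero)
      (CompR.ite (hs.and ((h3.n.add h3.n).le hc')) (h3.isoVec (hc'.sub (h3.n.add h3.n))
        (hk.sub (h3.n.add h3.n))) CompR.zero))
  · have hc := CompN.idx hq.succ
    have ho := CompN.idx (hp.up (N := fun i => n i + (n i + n i) + 1))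
    have h2 := (h.up (N := fun i => n i + (n i + n i) + 1)).up (N := fun i => n i.1 + 2)
    exact CompR.mat (a := fun i => (probInst (sys i) (m i) rule (τ i)).w) hq.succ hp
      (CompR.ite (ho.eq CompN.zero) CompR.zero (CompR.ite (((h2.n.add h2.n).le hc.up).and
        (ho.eq h2.n.succ)) (CompR.sub CompR.zero (h2.entV (hc.up.sub (h2.n.add h2.n)))) h2.bigWeight))

theorem CompProb.sol (h : CompProb sz f sys m k τ) {ρ c : ι → ℕ} (hρ : CompN sz f ρ)
    (hc : CompN sz f c) (hlt : ∀ i, c i < n i + (n i + n i) + 1) :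
    CompN sz f fun i => probSol (sys i) (m i) rule (τ i) (ρ i) (c i) := by
  have h2 : CompN sz f fun i => 2 * n i + ρ i := ((CompN.const 2).mul h.n).add hρ
  have hs : Comp sz f fun i => nvec (n i + (n i + n i) + 1) (probSol (sys i) (m i) rule (τ i) (ρ i)) :=
    (h.inst (rule := rule)).solve h2
  exact CompN.get (B := fun i => n i + 2) hs hc hlt (h.n.add (CompN.const 2)).bdd fun i =>
    ((Inst.solve_spec probInst_wf _).1.lt _).le

theorem mem_probOut {n : ℕ} {sys : DescriptorSystem n} {m : Fin n → Fin n ⊕ Fin n}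
    {τ : Fin n → ℝ} {ρ : ℕ} {j : Fin n} : j ∈ probOut sys m rule τ ρ ↔
      probSol sys m rule τ ρ (n + (n + j)) = n + 1 := by
  simp [probOut, mem_rset]

theorem CompProb.out (h : CompProb sz f sys m k τ) {ρ j : ι → ℕ} (hρ : CompN sz f ρ)
    (hj : CompN sz f j) (hlt : ∀ i, j i < n i) :
    CompP sz f fun i => probSol (sys i) (m i) rule (τ i) (ρ i) (n i + (n i + j i)) = n i + 1 :=
  (h.sol hρ (h.n.add (h.n.add hj)) fun i => by have := hlt i; omega).eq h.n.succ

theorem CompProb.isGood (h : CompProb sz f sys m k τ) {ρ : ι → ℕ} (hρ : CompN sz f ρ) :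
    CompP sz f fun i => IsGood (sys i) (m i) rule (τ i) (k i) (ρ i) := by
  classical
  have hq : CompN sz f fun i => n i + (n i + n i) := h.n.add (h.n.add h.n)
  refine CompP.and ?_ (CompP.and (CompN.eq (CompN.count hq (CompP.not (CompN.eq
    (h.up.sol hρ.up (CompN.idx hq) fun x => x.2.2.trans (Nat.lt_succ_self _)) CompN.zero)))
      (((CompN.const 2).mul h.n).add hρ)) (CompN.eq ?_ hρ))
  · exact (CompR.le h.n.real (CompR.add hρ.real h.bound)).congr fun i => by norm_cast
  · refine (CompN.count (P := fun i j => probSol (sys i) (m i) rule (τ i) (ρ i) (n i + (n i + j)) =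
      n i + 1) h.n (h.up.out hρ.up (CompN.idx h.n) fun x => x.2.2)).congr fun i => ?_
    rw [Finset.card_filter, Finset.sum_range, ← Finset.card_filter]
    exact congrArg Finset.card (by ext j; simp [mem_probOut])

theorem CompProb.value (h : CompProb sz f sys m k τ) {ρ : ι → ℕ} (hρ : CompN sz f ρ) :
    CompR sz f fun i => ∑ j ∈ (probOut (sys i) (m i) rule (τ i) (ρ i))ᶜ, τ i j := by
  classical
  refine (CompR.sum (r := fun i j => if probSol (sys i) (m i) rule (τ i) (ρ i) (n i + (n i + j)) =
      n i + 1 then 0 else RealWhile.entV (τ i) j) h.n (CompR.ite (h.up.out hρ.up (CompN.idx h.n)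
        fun x => x.2.2) CompR.zero (h.up.entV (CompN.idx h.n)))).congr fun i => ?_
  dsimp only
  rw [Finset.sum_range, ← Finset.sum_filter_add_sum_filter_not Finset.univ
    (fun j => j ∈ probOut (sys i) (m i) rule (τ i) (ρ i)), Finset.sum_eq_zero, zero_add]
  · rw [← Finset.compl_filter, Finset.filter_univ_mem]
    refine congrArg Val.num (Finset.sum_congr rfl fun j hj => ?_)
    rw [if_neg fun h => Finset.mem_compl.1 hj (mem_probOut.2 h), entV_fin]
  · exact fun j hj => if_pos (mem_probOut.1 (Finset.mem_filter.1 hj).2)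

open Classical in
/-- The number of states that an optimal solution leaves out. -/
noncomputable def bestOut {n : ℕ} (sys : DescriptorSystem n) (m : Fin n → Fin n ⊕ Fin n)
    (rule : IsolationRule) (τ : Fin n → ℝ) (k : ℕ) : ℕ :=
  sel (fun ρ => IsGood sys m rule τ k ρ ∧ ∀ ρ' < n + 1, IsGood sys m rule τ k ρ' →
    ∑ j ∈ (probOut sys m rule τ ρ')ᶜ, τ j ≤ ∑ j ∈ (probOut sys m rule τ ρ)ᶜ, τ j) (n + 1)

open Classical in
theorem CompProb.solution (h : CompProb sz f sys m k τ) :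
    Comp sz f fun i => if bestOut (sys i) (m i) rule (τ i) (k i) < n i + 1 then
      Val.found (Val.ofSet (probOut (sys i) (m i) rule (τ i)
        (bestOut (sys i) (m i) rule (τ i) (k i)))ᶜ) else Val.nil := by
  have hn1 : CompN sz f fun i => n i + 1 := h.n.succ
  have h1 := h.up (N := fun i => n i + 1)
  have h2 := h1.up (N := fun x => n x.1 + 1)
  have hρ := CompN.idx hn1
  have hρ' := CompN.idx h1.n.succ
  have hbest : CompN sz f fun i => bestOut (sys i) (m i) rule (τ i) (k i) :=
    CompN.sel hn1 (CompP.and (h1.isGood hρ) (CompP.all (P := fun x ρ' =>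
      IsGood (sys x.1) (m x.1) rule (τ x.1) (k x.1) ρ' →
        ∑ j ∈ (probOut (sys x.1) (m x.1) rule (τ x.1) ρ')ᶜ, τ x.1 j ≤
          ∑ j ∈ (probOut (sys x.1) (m x.1) rule (τ x.1) x.2)ᶜ, τ x.1 j) h1.n.succ
      (CompP.imp (h2.isGood hρ') (CompR.le (h2.value hρ') (h1.value hρ).up))))
  refine Comp.ite (hbest.lt hn1) (Comp.cons ?_ Comp.nil) Comp.nil
  refine (Comp.vec (a := fun i j => Val.ofProp (¬ probSol (sys i) (m i) rule (τ i)
    (bestOut (sys i) (m i) rule (τ i) (k i)) (n i + (n i + j)) = n i + 1)) h.n (CompP.not (h.up.out hbest.up (CompN.idx h.n) fun x => x.2.2))).congr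
    fun i => (ofVec_eq_vec _ _ fun j => ?_).symm
  rw [← Val.ofProp_eq_ofBool]
  refine Val.ofProp_congr ?_
  simp [mem_probOut]

end Access

theorem bestOut_spec {n : ℕ} {sys : DescriptorSystem n} {m : Fin n → Fin n ⊕ Fin n}
    {rule : IsolationRule} {τ : Fin n → ℝ} {k : ℕ} (h : bestOut sys m rule τ k < n + 1) :
    sys.IsSolution m rule k (fun S => ∑ i ∈ S, τ i) (probOut sys m rule τ (bestOut sys m rule τ k))ᶜ := by
  obtain ⟨h1, h2⟩ := sel_spec h
  refine ⟨h1.isFeasible, fun S hS => ?_⟩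
  obtain ⟨h3, h4⟩ := isGood_of_isFeasible (τ := τ) hS
  exact h4.trans (h2 _ (Nat.lt_succ_of_le ((Finset.card_le_univ _).trans (by simp))) h3)

theorem bestOut_lt {n : ℕ} {sys : DescriptorSystem n} {m : Fin n → Fin n ⊕ Fin n}
    {rule : IsolationRule} {τ : Fin n → ℝ} {k : ℕ} {S : Finset (Fin n)}
    (hS : sys.IsFeasible m rule k S) : bestOut sys m rule τ k < n + 1 := by
  classical
  have hlt : Sᶜ.card < n + 1 := Nat.lt_succ_of_le ((Finset.card_le_univ _).trans (by simp))
  obtain ⟨ρ, hρ, hmax⟩ := ((Finset.range (n + 1)).filter (IsGood sys m rule τ k)).exists_max_image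
    (fun ρ => ∑ j ∈ (probOut sys m rule τ ρ)ᶜ, τ j)
    ⟨Sᶜ.card, Finset.mem_filter.2 ⟨Finset.mem_range.2 hlt, (isGood_of_isFeasible hS).1⟩⟩
  obtain ⟨h1, h2⟩ := Finset.mem_filter.1 hρ
  exact sel_lt ⟨ρ, Finset.mem_range.1 h1, h2, fun ρ₁ hlt hgood =>
    hmax ρ₁ (Finset.mem_filter.2 ⟨Finset.mem_range.2 hlt, hgood⟩)⟩

/-- The input of the selection problem. -/
structure ProblemData where
  n : ℕ
  sys : DescriptorSystem n
  m : Fin n → Fin n ⊕ Fin n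
  adm : sys.IsAdmissible m
  k : ℕ
  τ : Fin n → ℝ

/-- The selection problem is solved in polynomial time. -/
theorem exists_selection_program (rule : IsolationRule) :
    ∃ (P : Cmd) (p : Polynomial ℕ), ∀ (n : ℕ) (sys : DescriptorSystem n)
      (m : Fin n → Fin n ⊕ Fin n), sys.IsAdmissible m →
      ∀ (k : ℕ) (τ : Fin n → ℝ) (f : Finset (Fin n) → ℝ), (∀ S, f S = ∑ i ∈ S, τ i) →
      ∃ out : Val, ComputesWithin P (Val.ofList [Val.ofSystem sys, Val.ofMatching m, Val.num k,
          Val.ofVec fun i => Val.num (τ i)]) out (p.eval n) ∧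
        ((∃ S, sys.IsSolution m rule k f S ∧ out = Val.found (Val.ofSet S)) ∨
          ((¬ ∃ S, sys.IsFeasible m rule k S) ∧ out = Val.nil)) := by
  set F : ProblemData → Val := fun i => Val.ofList [Val.ofSystem i.sys, Val.ofMatching i.m,
    Val.num i.k, Val.ofVec fun j => Val.num (i.τ j)] with hF
  have hid : Comp (fun i : ProblemData => i.n) F F := Comp.id
  have h : CompProb (fun i : ProblemData => i.n) F (fun i => i.sys) (fun i => i.m) (fun i => i.k)
      fun i => i.τ :=
    ⟨CompMat.of_comp PolyBdd.self hid.hd hid.tl.hd fun i => i.adm, hid.tl.tl.hd, hid.tl.tl.tl.hd⟩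
  obtain ⟨P, p, hP⟩ := (h.solution (rule := rule)).computesWithin
  refine ⟨P, p, fun n sys m adm k τ f hf => ⟨_, hP ⟨n, sys, m, adm, k, τ⟩, ?_⟩⟩
  obtain rfl : f = fun S => ∑ i ∈ S, τ i := funext hf
  dsimp only
  split_ifs with hlt
  · exact Or.inl ⟨_, bestOut_spec hlt, rfl⟩
  · exact Or.inr ⟨fun ⟨S, hS⟩ => hlt (bestOut_lt hS), rfl⟩

end RealWhile

theorem theorem3p13 (rule : IsolationRule) :
    -- an admissible matching, on which the second matroid is built, is found in polynomial time
    (∃ (P : RealWhile.Cmd) (p : Polynomial ℕ), ∀ (n : ℕ) (sys : DescriptorSystem n),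
      ∃ out : RealWhile.Val,
        RealWhile.ComputesWithin P (RealWhile.Val.ofSystem sys) out (p.eval n) ∧
        ((∃ m, sys.IsAdmissible m ∧
            out = RealWhile.Val.found (RealWhile.Val.ofMatching m)) ∨
          ((¬ ∃ m, sys.IsAdmissible m) ∧ out = RealWhile.Val.nil))) ∧
    -- for every admissible matching the selection problem is solved in polynomial time
    (∃ (P : RealWhile.Cmd) (p : Polynomial ℕ), ∀ (n : ℕ) (sys : DescriptorSystem n)
      (m : Fin n → Fin n ⊕ Fin n), sys.IsAdmissible m →
      ∀ (k : ℕ) (τ : Fin n → ℝ) (f : Finset (Fin n) → ℝ), (∀ S, f S = ∑ i ∈ S, τ i) →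
      ∃ out : RealWhile.Val,
        RealWhile.ComputesWithin P
          (RealWhile.Val.ofList [RealWhile.Val.ofSystem sys, RealWhile.Val.ofMatching m,
            RealWhile.Val.num k, RealWhile.Val.ofVec fun i => RealWhile.Val.num (τ i)])
          out (p.eval n) ∧
        ((∃ S, sys.IsSolution m rule k f S ∧
            out = RealWhile.Val.found (RealWhile.Val.ofSet S)) ∨
          ((¬ ∃ S, sys.IsFeasible m rule k S) ∧ out = RealWhile.Val.nil))) :=
  ⟨RealWhile.exists_matching_program, RealWhile.exists_selection_program rule⟩
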